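/- **Setting.** Let $G=(V,E)$ be a regular weighted digraph on a finite non-empty vertex set $V$ with $n$ vertices (nonnegative edge weights; all weighted in-degrees and out-degrees equal the same $d>0$). Let $G_{v',v}=w_G(v,v')/d$ denote also its random walk matrix. The spectral expansion $\lambda(G)$ is the Euclidean operator norm of this matrix restricted to the orthogonal complement of the constant vectors, and $G$ is a $\lambda$-spectral expander if $\lambda(G)\le\lambda$. For $\mathrm{val}:V\to\{0,1\}$ put $p_b=|\mathrm{val}^{-1}(b)|/n$, and let $S_t$ denote the distribution of $\sum_{i=0}^{t-1}\mathrm{val}(v_i)$, where $v_0$ is uniform on $V$ and $\Pr[v_i=v\mid v_{i-1}]=G_{v,v_{i-1}}$. The asymptotic variance is $\sigma^2=\lim_{t\to\infty}\frac1t\mathrm{Var}(S_t)$. Total variation distance on $\mathbb Z$ is $d_{TV}(\mu,\nu)=\frac12\sum_{j\in\mathbb Z}|\mu(j)-\nu(j)|$, and $\log$ is the natural logarithm. For $p=(p_0,p_1)$, $\sigma^2>0$ and $c=(c_1,c_2,c_3)$ with all $c_i\ge 0$, a $(p,\sigma^2,c)$-discrete normal family is a family $(\mathcal N^t)_{t\ge1}$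 of probability distributions on $\mathbb Z$, with finite second moments, such that for all integers $t\ge1$: 1. $\mathbb E[\mathcal N^t]=p_1t$; 2. $|\mathrm{Var}(\mathcal N^t)-\sigma^2t|\le c_1|\sigma^2-p_0p_1|$; 3. $\mathcal N^1$ is the Bernoulli distribution giving mass $p_1$ to $1$ and $p_0$ to $0$; 4. for all positive integers $\ell\le t$ and $t_0,\dots,t_{\ell-1}$ with $\sum_i t_i=t$, one has $d_{TV}\big(\sum_{i<\ell}\mathcal N^{t_i},\mathcal N^t\big)\le\frac{c_2}{2}\cdot\frac{(\ell-1)\,|\sigma^2/(p_0p_1)-1|}{t}$, where the summands are independent; 5. for all real $a\ge0$, $\displaystyle\sum_{j\in\mathbb Z:\,|j-p_1t|\ge a}\big|\Pr[\mathcal N^t=j]-\Pr[\mathrm{Bin}(t,p_1)=j]\big|\le c_3\,|\sigma^2/(p_0p_1)-1|\,e^{-a^2/(8t)}$; 6. for all $\theta\in[-\pi,\pi]$, $|\mathbb E[e^{-i\theta\mathcal N^t}]|\le e^{-p_0p_1t\theta^2/20}$. **Theorem.** Let $\lambda\le1/100$, let $G$ be a regular $\lambda$-spectral expander, and let $\mathrm{val}:V\to\{0,1\}$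 be a labeling with label weights $p=(p_0,p_1)$. Then the limit $\sigma^2$ defining the asymptotic variance exists. Moreover, for every $c=(c_1,c_2,c_3)$ with all $c_i\ge0$, every $(p,\sigma^2,c)$-discrete normal family $(\mathcal N^t)_{t\ge1}$, and every integer $t\ge1$, $$d_{TV}\big(S_t,\ \mathcal N^t\big)\ \le\ \frac{\lambda}{\sqrt t}\,(1+\log t)^{\eta_1\log\log t+\eta_2},$$ where $$\eta_1=140,\qquad \eta_2=140+3\log\left(\frac{2^{28}+2^{10}c_1+2^{18}c_3}{(p_0p_1)^{7/2}}+3c_2\right),$$ and the power on the right-hand side is read as $1$ for $t=1$. -/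

import Mathlib

open MeasureTheory ProbabilityTheory Filter Topology
open scoped BigOperators

noncomputable section

/-- A regular weighted digraph on `V`: nonnegative edge weights `w v v'` for the edge from `v` to
`v'` (parallel edges are encoded in the weights, loops are allowed), such that every vertex has
total out-weight and total in-weight equal to the same positive number `deg`. -/
structure RegularDigraph (V : Type*) [Fintype V] where
  w : V → V → ℝ
  deg : ℝ
  w_nonneg : ∀ v v', 0 ≤ w v v'
  deg_pos : 0 < deg
  out_deg : ∀ v, ∑ v', w v v' = deg
  in_deg : ∀ v', ∑ v, w v v' = deg

namespace RegularDigraph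

variable {V : Type*} [Fintype V]

/-- The random walk matrix; the entry `(v', v)` is the transition probability from `v` to `v'`. -/
def walkMatrix (G : RegularDigraph V) : Matrix V V ℝ :=
  Matrix.of fun v' v => G.w v v' / G.deg

/-- The spectral expansion: the operator norm, with respect to the Euclidean norm, of the
random walk matrix restricted to the orthogonal complement of the constant vectors. -/
def spectralExpansion [DecidableEq V] (G : RegularDigraph V) : ℝ :=
  ‖(Matrix.toEuclideanCLM (n := V) (𝕜 := ℝ) G.walkMatrix).comp
    (Submodule.span ℝ {(WithLp.toLp 2 (fun _ : V => (1 : ℝ)) : EuclideanSpace ℝ V)})ᗮ.subtypeL‖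

/-- `G` is a `lam`-spectral expander. -/
def IsSpectralExpander [DecidableEq V] (G : RegularDigraph V) (lam : ℝ) : Prop :=
  G.spectralExpansion ≤ lam

/-- The probability of the trajectory `v 0, …, v (t - 1)`: the initial vertex is uniform, and each
later vertex is sampled from its predecessor according to the random walk matrix. -/
def pathProb (G : RegularDigraph V) {t : ℕ} (v : Fin t → V) : ℝ :=
  ∏ i : Fin t, if (i : ℕ) = 0 then (Fintype.card V : ℝ)⁻¹
    else G.walkMatrix (v i) (v ⟨(i : ℕ) - 1, by omega⟩)

lemma walkMatrix_nonneg (G : RegularDigraph V) (v' v : V) : 0 ≤ G.walkMatrix v' v :=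
  div_nonneg (G.w_nonneg v v') G.deg_pos.le

lemma sum_walkMatrix (G : RegularDigraph V) (v : V) : ∑ v', G.walkMatrix v' v = 1 := by
  simp only [walkMatrix, Matrix.of_apply]
  rw [← Finset.sum_div, G.out_deg v, div_self G.deg_pos.ne']

lemma pathProb_nonneg (G : RegularDigraph V) {t : ℕ} (v : Fin t → V) : 0 ≤ G.pathProb v := by
  refine Finset.prod_nonneg fun i _ => ?_
  split_ifs
  · positivity
  · exact G.walkMatrix_nonneg _ _

lemma sum_pathProb (G : RegularDigraph V) [Nonempty V] (t : ℕ) :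
    ∑ v : Fin t → V, G.pathProb v = 1 := by
  induction t with
  | zero => simp [pathProb]
  | succ n ih =>
    rw [← (Fin.snocEquiv (fun _ : Fin (n + 1) => V)).sum_comp, Fintype.sum_prod_type_right]
    rw [← ih]
    refine Finset.sum_congr rfl fun v _ => ?_
    have key : ∀ u : V, G.pathProb (Fin.snocEquiv (fun _ : Fin (n + 1) => V) (u, v)) =
        G.pathProb v * (if h : n = 0 then (Fintype.card V : ℝ)⁻¹
          else G.walkMatrix u (v ⟨n - 1, by omega⟩)) := by
      intro u
      unfold pathProb
      rw [Fin.prod_univ_castSucc]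
      congr 1
      · refine Finset.prod_congr rfl fun i _ => ?_
        have h1 : (Fin.snocEquiv (fun _ : Fin (n + 1) => V) (u, v)) i.castSucc = v i := by
          simp [Fin.snocEquiv]
        have h2 : (Fin.snocEquiv (fun _ : Fin (n + 1) => V) (u, v))
            ⟨(i : ℕ) - 1, by omega⟩ = v ⟨(i : ℕ) - 1, by omega⟩ := by
          exact Fin.snoc_castSucc (α := fun _ : Fin (n + 1) => V) u v
            (⟨(i : ℕ) - 1, by omega⟩ : Fin n)
        simp only [Fin.val_castSucc, h1, h2]
      · by_cases hn : n = 0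
        · simp [hn]
        · have h2 : (Fin.snocEquiv (fun _ : Fin (n + 1) => V) (u, v))
              ⟨n - 1, by omega⟩ = v ⟨n - 1, by omega⟩ := by
            exact Fin.snoc_castSucc (α := fun _ : Fin (n + 1) => V) u v
              (⟨n - 1, by omega⟩ : Fin n)
          simp only [Fin.val_last, hn, if_false, dif_neg, not_false_eq_true, h2]
          simp [Fin.snocEquiv]
    simp only [key, ← Finset.mul_sum]
    by_cases hn : n = 0
    · simp [hn]
    · simp only [hn, dif_neg, not_false_eq_true, G.sum_walkMatrix, mul_one]

/-- The law of the length-`t` random walk on `G` started from a uniform vertex. -/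
def walk (G : RegularDigraph V) [Nonempty V] (t : ℕ) : PMF (Fin t → V) :=
  PMF.ofFintype (fun v => ENNReal.ofReal (G.pathProb v)) (by
    rw [← ENNReal.ofReal_sum_of_nonneg fun v _ => G.pathProb_nonneg v, G.sum_pathProb,
      ENNReal.ofReal_one])

/-- The law on `ℤ` of the sum of the labels along the length-`t` random walk on `G`. -/
def labelSum (G : RegularDigraph V) [Nonempty V] (val : V → Fin 2) (t : ℕ) : Measure ℤ :=
  ((G.walk t).map fun v => ∑ i, ((val (v i) : ℕ) : ℤ)).toMeasure

end RegularDigraph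

/-- The variance of a distribution on `ℤ`. -/
def intVariance (μ : Measure ℤ) : ℝ := variance (fun j : ℤ => (j : ℝ)) μ

/-- The asymptotic variance `lim Var(X t) / t` of a sequence of distributions on `ℤ`. -/
def asymptoticVariance (X : ℕ → Measure ℤ) : ℝ :=
  limUnder atTop fun t : ℕ => intVariance (X t) / t

/-- Total variation distance between probability distributions on `ℤ`. -/
def tvDist (μ ν : Measure ℤ) : ℝ := (1 / 2) * ∑' j : ℤ, |μ.real {j} - ν.real {j}|

/-- The law of the sum of independent integers with laws `μ i`. -/
def indepSum {ℓ : ℕ} (μ : Fin ℓ → Measure ℤ) : Measure ℤ :=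
  (Measure.pi μ).map fun x => ∑ i, x i

/-- A distribution `(p₀, p₁)` on `{0, 1}` is given by `p = p₁`, with `p₀ = 1 - p`. -/
def labelWeight (p : unitInterval) (b : Fin 2) : ℝ := if b = 1 then (p : ℝ) else 1 - (p : ℝ)

/-- `N` is a `(p, σ², (c₁, c₂, c₃))`-discrete normal family, where `p = (labelWeight p 0,
labelWeight p 1)` and `σsq` stands for `σ²`. The family is indexed by the positive integers:
nothing is asked of `N 0`. -/
structure IsDiscreteNormalFamily (p : unitInterval) (σsq c₁ c₂ c₃ : ℝ)
    (N : ℕ → ProbabilityMeasure ℤ) : Prop where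
  sigma_pos : 0 < σsq
  /-- Mean and variance exist. -/
  memLp : ∀ t : ℕ, 1 ≤ t → MemLp (fun j : ℤ => (j : ℝ)) 2 (N t : Measure ℤ)
  mean : ∀ t : ℕ, 1 ≤ t → ∫ j : ℤ, (j : ℝ) ∂(N t : Measure ℤ) = labelWeight p 1 * t
  var : ∀ t : ℕ, 1 ≤ t → |intVariance (N t) - σsq * t| ≤
    c₁ * |σsq - labelWeight p 0 * labelWeight p 1|
  /-- `N 1` gives mass `p₁` to `1` and `p₀` to `0`. -/
  bern : (N 1 : Measure ℤ) = bernoulliMeasure (1 : ℤ) 0 p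
  sum : ∀ t : ℕ, 1 ≤ t → ∀ ℓ : ℕ, 1 ≤ ℓ → ℓ ≤ t → ∀ s : Fin ℓ → ℕ, (∀ i, 1 ≤ s i) →
    ∑ i, s i = t →
    tvDist (indepSum fun i => (N (s i) : Measure ℤ)) (N t) ≤
      c₂ / 2 * (((ℓ : ℝ) - 1) * |σsq / (labelWeight p 0 * labelWeight p 1) - 1| / t)
  tail : ∀ t : ℕ, 1 ≤ t → ∀ a : ℝ, 0 ≤ a →
    ∑' j : {j : ℤ // a ≤ |(j : ℝ) - labelWeight p 1 * t|},
      |(N t : Measure ℤ).real {(j : ℤ)} -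
        ((binomial t p).map (Nat.cast : ℕ → ℤ)).real {(j : ℤ)}| ≤
      c₃ * |σsq / (labelWeight p 0 * labelWeight p 1) - 1| * Real.exp (-a ^ 2 / (8 * t))
  fourier : ∀ t : ℕ, 1 ≤ t → ∀ θ : ℝ, -Real.pi ≤ θ → θ ≤ Real.pi →
    ‖∫ j : ℤ, Complex.exp (-Complex.I * θ * j) ∂(N t : Measure ℤ)‖ ≤
      Real.exp (-(labelWeight p 0 * labelWeight p 1 * t * θ ^ 2 / 20))

/-- The exponent `η₁`. -/
def etaOne : ℝ := 140

/-- The exponent `η₂`. -/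
def etaTwo (p : unitInterval) (c₁ c₂ c₃ : ℝ) : ℝ :=
  140 + 3 * Real.log
    ((2 ^ 28 + 2 ^ 10 * c₁ + 2 ^ 18 * c₃) / (labelWeight p 0 * labelWeight p 1) ^ (7 / 2 : ℝ)
      + 3 * c₂)

end

/-! Write q = p₀p₁. Everything is compared through characteristic functions, and every error must
carry a factor λ.

The transform of S_t is ⟨e, DGD⋯GD e⟩, with G the walk operator, D the diagonal operator of one
label's exponential and e the constant unit vector. Since G fixes e and shrinks its complement by λ,
the vector entering each D is almost a multiple of e. This yields Gaussian decay exp(-qtθ²/20) of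
the characteristic function (`norm_trigSum_labelSum_le`), and shows that cutting the walk into ℓ
independent pieces costs at most 4λℓqθ² times the same Gaussian
(`norm_trigSum_labelSum_sub_prod_le`). With real tilts the argument compares S_t to the binomial law
with exponential tails proportional to λ (`abs_labelSum_sub_binomial_le`). Covariances at lag i are
at most qλ^i, so Var(S_t) is σ²t up to 3qλ.

The core is a bootstrap from √t to t. Suppose d_TV(S_s, N^s) ≤ λR/√s for all s ≤ 3√t. The means of
S_s and N^s agree, the variances differ by O(qλ), and the total variation bound with the tails
controls the third absolute moment of the difference (`third_moment`). By Taylor expansion the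
characteristic functions differ by λ times a combination of θ² and sR|θ|³, up to logarithms. Cut t
into at most √t pieces of length at most 3√t and exchange them one at a time; the remaining pieces
supply a Gaussian. Fourier inversion bounds the differences of point masses by λR/t up to
logarithms, and summing over a window of width about √t log t gives λR/√t up to logarithms.
Replacing the sum of independent normals by N^t costs O(λ/√t), by the closure property of the family
(`tvDist_le_of_sqrt`).

Thus R(t) is at most a constant times (1 + log t)⁴ R(3√t). Each round roughly halves log t, so there
are about log log t rounds, each costing a power of log t; this is the source of the exponent. The
recursion starts at log t ≤ 20, where splitting into single labels suffices because S_1 and N^1 have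
the same law (`tvDist_le_crude`). -/

noncomputable section

/-! ### Fourier series of summable integer sequences -/

/-- The trigonometric series with real coefficients `a`. -/
def trigSum (a : ℤ → ℝ) (θ : ℝ) : ℂ := ∑' j : ℤ, (a j : ℂ) * Complex.exp (θ * j * Complex.I)

lemma norm_cexp_real_mul_int_mul_I (θ : ℝ) (j : ℤ) :
    ‖Complex.exp (θ * j * Complex.I)‖ = 1 := by
  rw [show (θ : ℂ) * j = ((θ * j : ℝ) : ℂ) by push_cast; ring, Complex.norm_exp_ofReal_mul_I]

lemma norm_ofReal_mul_cexp (x θ : ℝ) (j : ℤ) :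
    ‖(x : ℂ) * Complex.exp (θ * j * Complex.I)‖ = |x| := by
  rw [norm_mul, norm_cexp_real_mul_int_mul_I, mul_one, Complex.norm_real, Real.norm_eq_abs]

lemma summable_trigSum {a : ℤ → ℝ} (ha : Summable a) (θ : ℝ) :
    Summable fun j : ℤ => (a j : ℂ) * Complex.exp (θ * j * Complex.I) := by
  refine Summable.of_norm ?_
  simpa only [norm_ofReal_mul_cexp] using ha.abs

lemma trigSum_sub {a b : ℤ → ℝ} (ha : Summable a) (hb : Summable b) (θ : ℝ) :
    trigSum (fun j => a j - b j) θ = trigSum a θ - trigSum b θ := by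
  unfold trigSum
  rw [← (summable_trigSum ha θ).tsum_sub (summable_trigSum hb θ)]
  refine tsum_congr fun j => ?_
  push_cast
  ring

lemma integral_cexp_int (n : ℤ) :
    ∫ θ in (-Real.pi)..Real.pi, Complex.exp (θ * n * Complex.I) =
      if n = 0 then (2 * Real.pi : ℂ) else 0 := by
  split_ifs with h
  · subst h
    simp
    ring
  · have hc : (n : ℂ) * Complex.I ≠ 0 :=
      mul_ne_zero (by exact_mod_cast h) Complex.I_ne_zero
    have := integral_exp_mul_complex (a := -Real.pi) (b := Real.pi) hc
    have e : ∀ θ : ℝ, (θ : ℂ) * n * Complex.I = n * Complex.I * θ := fun θ => by ring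
    simp only [e]
    rw [this, div_eq_zero_iff]
    left
    rw [sub_eq_zero, Complex.exp_eq_exp_iff_exists_int]
    exact ⟨n, by push_cast; ring⟩

lemma integral_trigSum_mul_cexp {a : ℤ → ℝ} (ha : Summable a) (j : ℤ) :
    ∫ θ in (-Real.pi)..Real.pi, trigSum a θ * Complex.exp (-(θ * j * Complex.I)) =
      2 * Real.pi * a j := by
  have hpi : -Real.pi ≤ Real.pi := by linarith [Real.pi_pos]
  rw [intervalIntegral.integral_of_le hpi]
  let F : ℤ → ℝ → ℂ := fun k θ => (a k : ℂ) * Complex.exp (θ * (k - j : ℤ) * Complex.I)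
  have hcont : ∀ k, Continuous (F k) := fun k => by fun_prop
  have hint : ∀ k, Integrable (F k) (volume.restrict (Set.Ioc (-Real.pi) Real.pi)) := fun k =>
    ((hcont k).integrableOn_Icc (a := -Real.pi) (b := Real.pi)).mono_set Set.Ioc_subset_Icc_self
  have hnorm : ∀ k θ, ‖F k θ‖ = |a k| := fun k θ => norm_ofReal_mul_cexp _ _ _
  have hs := hasSum_integral_of_summable_integral_norm hint (by
    simp only [hnorm, integral_const, smul_eq_mul]
    exact ha.abs.mul_left _)
  have e1 : ∀ θ : ℝ, trigSum a θ * Complex.exp (-(θ * j * Complex.I)) = ∑' k, F k θ := by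
    intro θ
    unfold trigSum
    rw [← tsum_mul_right]
    refine tsum_congr fun k => ?_
    simp only [F]
    rw [mul_assoc, ← Complex.exp_add]
    congr 2
    push_cast
    ring
  simp only [e1]
  rw [← hs.tsum_eq]
  have e2 : ∀ k, ∫ θ in Set.Ioc (-Real.pi) Real.pi, F k θ =
      if k = j then (2 * Real.pi * a j : ℂ) else 0 := by
    intro k
    rw [← intervalIntegral.integral_of_le hpi]
    simp only [F]
    rw [intervalIntegral.integral_const_mul, integral_cexp_int]
    by_cases h : k = j
    · simp [h]; ring
    · simp [h, sub_eq_zero]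
  simp only [e2]
  rw [tsum_ite_eq]

/-- Fourier inversion bounds the coefficients of a trigonometric series. -/
lemma abs_coeff_le_of_norm_trigSum_le {a : ℤ → ℝ} (ha : Summable a) {g : ℝ → ℝ}
    (hg : IntervalIntegrable g volume (-Real.pi) Real.pi)
    (h : ∀ θ, -Real.pi ≤ θ → θ ≤ Real.pi → ‖trigSum a θ‖ ≤ g θ) (j : ℤ) :
    |a j| ≤ (∫ θ in (-Real.pi)..Real.pi, g θ) / (2 * Real.pi) := by
  have hpi : -Real.pi ≤ Real.pi := by linarith [Real.pi_pos]
  rw [le_div_iff₀ (by positivity)]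
  have h1 : |a j| * (2 * Real.pi) =
      ‖∫ θ in (-Real.pi)..Real.pi, trigSum a θ * Complex.exp (-(θ * j * Complex.I))‖ := by
    rw [integral_trigSum_mul_cexp ha]
    simp [abs_of_pos Real.pi_pos]
    ring
  rw [h1]
  refine intervalIntegral.norm_integral_le_of_norm_le hpi (ae_of_all _ fun θ hθ => ?_) hg
  have h2 : ‖Complex.exp (-(θ * j * Complex.I))‖ = 1 := by
    rw [Complex.exp_neg, norm_inv, norm_cexp_real_mul_int_mul_I, inv_one]
  rw [norm_mul, h2, mul_one]
  exact h θ hθ.1.le hθ.2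

/-! ### Taylor expansion of characteristic functions -/

lemma norm_cexp_taylor_two (x : ℝ) :
    ‖Complex.exp (x * Complex.I) - (1 + x * Complex.I - (x ^ 2 : ℝ) / 2)‖ ≤ 4 * |x| ^ 3 := by
  have hx : ‖(x : ℂ) * Complex.I‖ = |x| := by simp
  rcases le_total |x| 1 with h | h
  · have h0 := Complex.norm_exp_sub_sum_le_norm_mul_exp (x * Complex.I) 3
    rw [hx] at h0
    have e : ∑ m ∈ Finset.range 3, ((x : ℂ) * Complex.I) ^ m / (m.factorial : ℂ) =
        1 + x * Complex.I - (x ^ 2 : ℝ) / 2 := by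
      simp [Finset.sum_range_succ, Nat.factorial, mul_pow]
      ring
    rw [e] at h0
    refine h0.trans ?_
    rw [mul_comm]
    gcongr
    calc Real.exp |x| ≤ Real.exp 1 := Real.exp_le_exp.2 h
      _ ≤ 4 := by linarith [Real.exp_one_lt_d9]
  -- For |x| ≥ 1 each of the terms 1, |x| and x² is at most |x|³, so the triangle inequality
  -- suffices.
  · calc ‖Complex.exp (x * Complex.I) - (1 + x * Complex.I - (x ^ 2 : ℝ) / 2)‖
        ≤ ‖Complex.exp (x * Complex.I)‖ + (‖(1 : ℂ)‖ + ‖(x : ℂ) * Complex.I‖ +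
          ‖((x ^ 2 : ℝ) : ℂ) / 2‖) := by
          refine (norm_sub_le _ _).trans ?_
          gcongr
          refine (norm_sub_le _ _).trans ?_
          gcongr
          exact norm_add_le _ _
      _ = 2 + |x| + |x| ^ 2 / 2 := by
          rw [Complex.norm_exp_ofReal_mul_I, hx, norm_div, Complex.norm_real]
          simp
          ring
      _ ≤ 4 * |x| ^ 3 := by
          have h2 : |x| ≤ |x| ^ 2 := by nlinarith
          have h3 : |x| ^ 2 ≤ |x| ^ 3 := by nlinarith [sq_nonneg |x|]
          linarith

/-- A sequence with vanishing moments of orders zero and one has a trigonometric series that is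
controlled near zero by the second and the third moment. -/
lemma norm_trigSum_le_of_moments {a : ℤ → ℝ} {m A₂ A₃ : ℝ} (h0 : HasSum a 0)
    (h1 : HasSum (fun j : ℤ => ((j : ℝ) - m) * a j) 0) {c : ℝ}
    (h2 : HasSum (fun j : ℤ => ((j : ℝ) - m) ^ 2 * a j) c) (hc : |c| ≤ A₂)
    (h3 : Summable fun j : ℤ => |(j : ℝ) - m| ^ 3 * |a j|)
    (h3' : ∑' j : ℤ, |(j : ℝ) - m| ^ 3 * |a j| ≤ A₃) (θ : ℝ) :
    ‖trigSum a θ‖ ≤ A₂ / 2 * θ ^ 2 + 4 * A₃ * |θ| ^ 3 := by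
  let R : ℤ → ℂ := fun j => (a j : ℂ) * (Complex.exp ((θ * (j - m) : ℝ) * Complex.I) -
    (1 + (θ * (j - m) : ℝ) * Complex.I - ((θ * (j - m)) ^ 2 : ℝ) / 2))
  have hR : ∀ j, ‖R j‖ ≤ 4 * |θ| ^ 3 * (|(j : ℝ) - m| ^ 3 * |a j|) := by
    intro j
    simp only [R]
    rw [norm_mul, Complex.norm_real, Real.norm_eq_abs]
    calc _ ≤ |a j| * (4 * |θ * (j - m)| ^ 3) := by
          gcongr
          exact norm_cexp_taylor_two _
      _ = _ := by rw [abs_mul]; ring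
  have hRs : Summable R := Summable.of_norm_bounded (h3.mul_left _) hR
  have hRn : ‖∑' j, R j‖ ≤ 4 * A₃ * |θ| ^ 3 := by
    calc ‖∑' j, R j‖ ≤ ∑' j : ℤ, 4 * |θ| ^ 3 * (|(j : ℝ) - m| ^ 3 * |a j|) :=
          tsum_of_norm_bounded (h3.mul_left _).hasSum hR
      _ = 4 * |θ| ^ 3 * ∑' j : ℤ, (|(j : ℝ) - m| ^ 3 * |a j|) := tsum_mul_left
      _ ≤ 4 * |θ| ^ 3 * A₃ := by gcongr
      _ = _ := by ring
  have H0 : HasSum (fun j => (a j : ℂ)) 0 := by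
    simpa using Complex.hasSum_ofReal.2 h0
  have H1 : HasSum (fun j : ℤ => ((((j : ℝ) - m) * a j : ℝ) : ℂ)) 0 := by
    simpa only [Complex.ofReal_zero] using Complex.hasSum_ofReal.2 h1
  have H2 : HasSum (fun j : ℤ => ((((j : ℝ) - m) ^ 2 * a j : ℝ) : ℂ)) c :=
    Complex.hasSum_ofReal.2 h2
  have H := (H0.add (H1.mul_left (θ * Complex.I))).sub (H2.mul_left ((θ : ℂ) ^ 2 / 2))
  have H' := H.add hRs.hasSum
  -- Centring at m costs only a phase, invisible to the norm. The constant and linear Taylor terms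
  -- vanish by the moment hypotheses.
  have key : trigSum a θ = Complex.exp ((θ * m : ℝ) * Complex.I) *
      (0 + θ * Complex.I * 0 - (θ : ℂ) ^ 2 / 2 * c + ∑' j, R j) := by
    rw [← H'.tsum_eq, ← tsum_mul_left]
    unfold trigSum
    refine tsum_congr fun j => ?_
    have : Complex.exp (θ * j * Complex.I) = Complex.exp ((θ * m : ℝ) * Complex.I) *
        Complex.exp ((θ * (j - m) : ℝ) * Complex.I) := by
      rw [← Complex.exp_add]
      congr 1
      push_cast
      ring
    rw [this]
    simp only [R]
    push_cast
    ring
  rw [key, norm_mul, Complex.norm_exp_ofReal_mul_I, one_mul]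
  refine (norm_add_le _ _).trans (add_le_add ?_ hRn)
  rw [mul_zero, zero_add, zero_sub, norm_neg, norm_mul, norm_div, norm_pow, Complex.norm_real,
    Complex.norm_real, Real.norm_eq_abs, Real.norm_eq_abs, sq_abs]
  simp only [Complex.norm_ofNat]
  nlinarith [sq_nonneg θ]

/-! ### Exponential sums and `ℓ¹` norms over a window -/

lemma hasSum_exp_neg_natCast_div {τ : ℝ} (hτ : 0 < τ) :
    HasSum (fun n : ℕ => Real.exp (-(n : ℝ) / τ)) (1 - Real.exp (-1 / τ))⁻¹ := by
  have h : ∀ n : ℕ, Real.exp (-(n : ℝ) / τ) = Real.exp (-1 / τ) ^ n := fun n => by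
    rw [← Real.exp_nat_mul]
    congr 1
    ring
  simp only [h]
  refine hasSum_geometric_of_lt_one (Real.exp_pos _).le ?_
  rw [Real.exp_lt_one_iff]
  exact div_neg_of_neg_of_pos (by norm_num) hτ

/-- With x = 1/τ ≤ 1, this is exp(-x) ≤ 1/(1 + x) ≤ 1 - x/2. -/
lemma inv_one_sub_exp_neg_le {τ : ℝ} (hτ : 1 ≤ τ) : (1 - Real.exp (-1 / τ))⁻¹ ≤ 2 * τ := by
  have hτ0 : 0 < τ := by linarith
  have h1 : Real.exp (-1 / τ) ≤ 1 - 1 / (2 * τ) := by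
    have h2 := Real.add_one_le_exp (1 / τ)
    have h3 : Real.exp (-1 / τ) = (Real.exp (1 / τ))⁻¹ := by rw [← Real.exp_neg]; ring_nf
    have h4 : 1 / τ ≤ 1 := by rw [div_le_one hτ0]; exact hτ
    rw [h3]
    calc (Real.exp (1 / τ))⁻¹ ≤ (1 / τ + 1)⁻¹ := by gcongr
      _ ≤ 1 - 1 / (2 * τ) := by
        rw [inv_le_iff_one_le_mul₀ (by positivity)]
        have : 1 / (2 * τ) = 1 / τ / 2 := by field_simp
        rw [this]
        have : 0 < 1 / τ := by positivity
        nlinarith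
  rw [inv_le_comm₀ _ (by positivity)]
  · have : (2 * τ)⁻¹ = 1 / (2 * τ) := by ring
    linarith
  · have : 0 < 1 / (2 * τ) := by positivity
    linarith

/-- Two-sided exponential sums over the integers. -/
lemma summable_and_tsum_exp_neg_abs_sub_le (m : ℝ) {τ : ℝ} (hτ : 1 ≤ τ) :
    Summable (fun j : ℤ => Real.exp (-|(j : ℝ) - m| / τ)) ∧
      ∑' j : ℤ, Real.exp (-|(j : ℝ) - m| / τ) ≤ 12 * τ := by
  have hτ0 : 0 < τ := by linarith
  have hs := hasSum_exp_neg_natCast_div hτ0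
  have hle := inv_one_sub_exp_neg_le hτ
  set S := (1 - Real.exp (-1 / τ))⁻¹
  have hZ : HasSum (fun j : ℤ => Real.exp (-|(j : ℝ)| / τ)) (S + Real.exp (-1 / τ) * S) := by
    refine HasSum.of_nat_of_neg_add_one ?_ ?_
    · simpa using hs
    · refine (hs.mul_left (Real.exp (-1 / τ))).congr_fun fun n => ?_
      rw [← Real.exp_add]
      congr 1
      push_cast
      rw [abs_neg, abs_of_nonneg (by positivity)]
      ring
  -- Recentring from m to its floor moves each distance by at most 1, which costs a factor e because
  -- τ ≥ 1. The final 12 is 3 · (2 + 2), with e < 3.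
  have hZ' : HasSum (fun j : ℤ => Real.exp 1 * Real.exp (-|((j - ⌊m⌋ : ℤ) : ℝ)| / τ))
      (Real.exp 1 * (S + Real.exp (-1 / τ) * S)) :=
    ((Equiv.subRight ⌊m⌋).hasSum_iff.2 hZ).mul_left _
  have hcmp : ∀ j : ℤ, Real.exp (-|(j : ℝ) - m| / τ) ≤
      Real.exp 1 * Real.exp (-|((j - ⌊m⌋ : ℤ) : ℝ)| / τ) := by
    intro j
    rw [← Real.exp_add, Real.exp_le_exp]
    have h1 : |((j - ⌊m⌋ : ℤ) : ℝ)| ≤ |(j : ℝ) - m| + 1 := by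
      have : ((j - ⌊m⌋ : ℤ) : ℝ) = ((j : ℝ) - m) + Int.fract m := by
        have := Int.floor_add_fract m
        push_cast
        linarith
      rw [this]
      refine (abs_add_le _ _).trans ?_
      gcongr
      rw [abs_of_nonneg (Int.fract_nonneg m)]
      exact (Int.fract_lt_one m).le
    have h2 : 1 / τ ≤ 1 := by rw [div_le_one hτ0]; exact hτ
    calc -|(j : ℝ) - m| / τ ≤ (1 - |((j - ⌊m⌋ : ℤ) : ℝ)|) / τ := by gcongr; linarith
      _ = 1 / τ + -|((j - ⌊m⌋ : ℤ) : ℝ)| / τ := by ring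
      _ ≤ _ := by gcongr
  have hsum : Summable (fun j : ℤ => Real.exp (-|(j : ℝ) - m| / τ)) :=
    Summable.of_nonneg_of_le (fun j => (Real.exp_pos _).le) hcmp hZ'.summable
  refine ⟨hsum, (hsum.tsum_le_tsum hcmp hZ'.summable).trans ?_⟩
  rw [hZ'.tsum_eq]
  have h3 : Real.exp (-1 / τ) ≤ 1 := by
    rw [Real.exp_le_one_iff]
    exact (div_neg_of_neg_of_pos (by norm_num) hτ0).le
  have hS : 0 ≤ S := (hs.nonneg fun n => (Real.exp_pos _).le)
  have h4 := Real.exp_one_lt_d9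
  calc Real.exp 1 * (S + Real.exp (-1 / τ) * S) ≤ 3 * (2 * τ + 1 * (2 * τ)) := by
        gcongr
        linarith
    _ = 12 * τ := by ring

/-- Splitting an `ℓ¹` norm into a window, on which the summands are bounded, and a remainder. -/
lemma tsum_abs_le_of_window {a b : ℤ → ℝ} {m w B : ℝ} (hw : 0 ≤ w) (hB : 0 ≤ B)
    (ha : Summable a) (hb : Summable b)
    (hin : ∀ j : ℤ, |(j : ℝ) - m| ≤ w → |a j| ≤ B + b j)
    (hout : ∀ j : ℤ, w < |(j : ℝ) - m| → |a j| ≤ b j) :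
    ∑' j, |a j| ≤ (2 * w + 1) * B + ∑' j, b j := by
  classical
  let s : Finset ℤ := Finset.Icc ⌈m - w⌉ ⌊m + w⌋
  have hs : ∀ j : ℤ, |(j : ℝ) - m| ≤ w → j ∈ s := by
    intro j hj
    rw [abs_le] at hj
    rw [Finset.mem_Icc, Int.ceil_le, Int.le_floor]
    constructor <;> linarith
  have hfin : HasSum (fun j => if j ∈ s then B else 0) (∑ j ∈ s, B) := by
    rw [← Finset.sum_congr rfl fun j hj => if_pos (c := j ∈ s) (t := B) (e := 0) hj]
    exact hasSum_sum_of_ne_finset_zero fun j hj => if_neg hj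
  have hle : ∀ j, |a j| ≤ (if j ∈ s then B else 0) + b j := by
    intro j
    by_cases h : |(j : ℝ) - m| ≤ w
    · simpa [hs j h] using hin j h
    · refine (hout j (not_le.1 h)).trans ?_
      have : 0 ≤ (if j ∈ s then B else 0) := by split_ifs <;> simp [hB]
      linarith
  have h1 := ha.abs.tsum_le_tsum hle (hfin.summable.add hb)
  rw [hfin.summable.tsum_add hb, hfin.tsum_eq] at h1
  refine h1.trans ?_
  gcongr
  rw [Finset.sum_const, nsmul_eq_mul]
  gcongr
  rw [Int.card_Icc]
  have h2 : ((⌊m + w⌋ + 1 - ⌈m - w⌉ : ℤ) : ℝ) ≤ 2 * w + 1 := by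
    push_cast
    linarith [Int.floor_le (m + w), Int.le_ceil (m - w)]
  rcases le_total 0 (⌊m + w⌋ + 1 - ⌈m - w⌉) with h | h
  · have : (((⌊m + w⌋ + 1 - ⌈m - w⌉).toNat : ℤ) : ℝ) = ((⌊m + w⌋ + 1 - ⌈m - w⌉ : ℤ) : ℝ) := by
      rw [Int.toNat_of_nonneg h]
    rw [← this] at h2
    exact_mod_cast h2
  · rw [Int.toNat_of_nonpos h]
    simp
    linarith

/-! ### Odd absolute moments of Gaussians -/

lemma setIntegral_Ioi_mul_exp_neg_sq {c : ℝ} (hc : 0 < c) :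
    IntegrableOn (fun x : ℝ => |x| * Real.exp (-c * x ^ 2)) (Set.Ioi 0) ∧
      ∫ x in Set.Ioi (0 : ℝ), |x| * Real.exp (-c * x ^ 2) = 1 / (2 * c) := by
  have h1 := integral_rpow_mul_exp_neg_mul_rpow (p := 2) (q := 1) (by norm_num) (by norm_num) hc
  have h2 := integrableOn_rpow_mul_exp_neg_mul_rpow (p := 2) (s := 1) (b := c)
    (by norm_num) (by norm_num) hc
  have e : ∀ x ∈ Set.Ioi (0 : ℝ), x ^ (1 : ℝ) * Real.exp (-c * x ^ (2 : ℝ)) =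
      |x| * Real.exp (-c * x ^ 2) := fun x hx => by
    rw [Real.rpow_one, Real.rpow_two, abs_of_pos hx]
  refine ⟨h2.congr_fun e measurableSet_Ioi, ?_⟩
  rw [← setIntegral_congr_fun measurableSet_Ioi e, h1]
  norm_num
  rw [Real.rpow_neg_one]

lemma setIntegral_Ioi_cube_mul_exp_neg_sq {c : ℝ} (hc : 0 < c) :
    IntegrableOn (fun x : ℝ => |x| ^ 3 * Real.exp (-c * x ^ 2)) (Set.Ioi 0) ∧
      ∫ x in Set.Ioi (0 : ℝ), |x| ^ 3 * Real.exp (-c * x ^ 2) = 1 / (2 * c ^ 2) := by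
  have h1 := integral_rpow_mul_exp_neg_mul_rpow (p := 2) (q := 3) (by norm_num) (by norm_num) hc
  have h2 := integrableOn_rpow_mul_exp_neg_mul_rpow (p := 2) (s := 3) (b := c)
    (by norm_num) (by norm_num) hc
  have e : ∀ x ∈ Set.Ioi (0 : ℝ), x ^ (3 : ℝ) * Real.exp (-c * x ^ (2 : ℝ)) =
      |x| ^ 3 * Real.exp (-c * x ^ 2) := fun x hx => by
    rw [show (3 : ℝ) = ((3 : ℕ) : ℝ) by norm_num, Real.rpow_natCast, Real.rpow_two, abs_of_pos hx]
  refine ⟨h2.congr_fun e measurableSet_Ioi, ?_⟩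
  rw [← setIntegral_congr_fun measurableSet_Ioi e, h1]
  norm_num

lemma intervalIntegral_le_two_mul_setIntegral_Ioi {f : ℝ → ℝ} (hf : Continuous f)
    (hf0 : ∀ x, 0 ≤ f x) (heven : ∀ x, f (-x) = f x) (hint : IntegrableOn f (Set.Ioi 0))
    {b : ℝ} (hb : 0 ≤ b) :
    ∫ x in (-b)..b, f x ≤ 2 * ∫ x in Set.Ioi (0 : ℝ), f x := by
  have h1 : ∫ x in (0 : ℝ)..b, f x ≤ ∫ x in Set.Ioi (0 : ℝ), f x := by
    rw [intervalIntegral.integral_of_le hb]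
    exact setIntegral_mono_set hint (ae_of_all _ hf0)
      (Set.Ioc_subset_Ioi_self).eventuallyLE
  have h2 : ∫ x in (-b)..0, f x = ∫ x in (0 : ℝ)..b, f x := by
    have := intervalIntegral.integral_comp_neg (a := 0) (b := b) f
    simp only [heven, neg_zero] at this
    exact this.symm
  rw [← intervalIntegral.integral_add_adjacent_intervals (b := 0)
    (hf.intervalIntegrable _ _) (hf.intervalIntegrable _ _), h2]
  linarith

lemma intervalIntegral_abs_mul_exp_neg_sq_le {c b : ℝ} (hc : 0 < c) (hb : 0 ≤ b) :
    ∫ x in (-b)..b, |x| * Real.exp (-c * x ^ 2) ≤ 1 / c := by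
  obtain ⟨h1, h2⟩ := setIntegral_Ioi_mul_exp_neg_sq hc
  refine (intervalIntegral_le_two_mul_setIntegral_Ioi (by fun_prop) (fun x => by positivity)
    (fun x => by simp) h1 hb).trans (le_of_eq ?_)
  rw [h2]
  field_simp

lemma intervalIntegral_abs_cube_mul_exp_neg_sq_le {c b : ℝ} (hc : 0 < c) (hb : 0 ≤ b) :
    ∫ x in (-b)..b, |x| ^ 3 * Real.exp (-c * x ^ 2) ≤ 1 / c ^ 2 := by
  obtain ⟨h1, h2⟩ := setIntegral_Ioi_cube_mul_exp_neg_sq hc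
  refine (intervalIntegral_le_two_mul_setIntegral_Ioi (by fun_prop) (fun x => by positivity)
    (fun x => by simp) h1 hb).trans (le_of_eq ?_)
  rw [h2]
  field_simp

end

/-! ### Alternating products of a mixing operator and a block-bounded operator -/

section MixingOperators

open scoped InnerProductSpace
open ContinuousLinearMap (adjoint)

variable {H : Type*} [NormedAddCommGroup H] [InnerProductSpace ℂ H]

/-- The component of `u` orthogonal to the unit vector `e`. -/
noncomputable def perpPart (e u : H) : H := u - ⟪e, u⟫_ℂ • e

lemma inner_perpPart {e : H} (he : ‖e‖ = 1) (u : H) : ⟪e, perpPart e u⟫_ℂ = 0 := by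
  rw [perpPart, inner_sub_right, inner_smul_right, inner_self_eq_norm_sq_to_K, he]
  simp

lemma eq_add_perpPart (e u : H) : u = ⟪e, u⟫_ℂ • e + perpPart e u := by
  simp [perpPart]

lemma perpPart_add (e u v : H) : perpPart e (u + v) = perpPart e u + perpPart e v := by
  simp only [perpPart, inner_add_right, add_smul]
  abel

lemma perpPart_smul (e u : H) (c : ℂ) : perpPart e (c • u) = c • perpPart e u := by
  simp only [perpPart, inner_smul_right, smul_sub, mul_smul]

lemma norm_sq_perpPart {e : H} (he : ‖e‖ = 1) (u : H) :
    ‖perpPart e u‖ ^ 2 = ‖u‖ ^ 2 - ‖⟪e, u⟫_ℂ‖ ^ 2 := by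
  have h0 : ⟪⟪e, u⟫_ℂ • e, perpPart e u⟫_ℂ = 0 := by
    rw [inner_smul_left, inner_perpPart he, mul_zero]
  have h := norm_add_sq_eq_norm_sq_add_norm_sq_of_inner_eq_zero _ _ h0
  rw [← eq_add_perpPart, norm_smul, he, mul_one] at h
  nlinarith

lemma norm_perpPart_le {e : H} (he : ‖e‖ = 1) (u : H) : ‖perpPart e u‖ ≤ ‖u‖ := by
  have := norm_sq_perpPart he u
  exact abs_le_of_sq_le_sq (by nlinarith [sq_nonneg ‖⟪e, u⟫_ℂ‖]) (norm_nonneg _) |> (abs_le.1 · |>.2)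

lemma inner_eq_inner_perpPart {e w : H} (hw : ⟪e, w⟫_ℂ = 0) (u : H) :
    ⟪u, w⟫_ℂ = ⟪perpPart e u, w⟫_ℂ := by
  rw [perpPart, inner_sub_left, inner_smul_left, hw, mul_zero, sub_zero]

/-- The alternating product `D G D ⋯ G D` with `k + 1` factors `D`. -/
noncomputable def alternatingProduct (G D : H →L[ℂ] H) : ℕ → (H →L[ℂ] H)
  | 0 => D
  | k + 1 => D.comp (G.comp (alternatingProduct G D k))

lemma alternatingProduct_succ_apply (G D : H →L[ℂ] H) (k : ℕ) (x : H) :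
    alternatingProduct G D (k + 1) x = D (G (alternatingProduct G D k x)) := rfl

lemma alternatingProduct_add (G D : H →L[ℂ] H) (m s : ℕ) :
    alternatingProduct G D (m + s + 1) =
      (alternatingProduct G D s).comp (G.comp (alternatingProduct G D m)) := by
  induction s with
  | zero => rfl
  | succ s ih =>
    rw [show m + (s + 1) + 1 = (m + s + 1) + 1 by ring, alternatingProduct, ih,
      alternatingProduct]
    rfl

variable [CompleteSpace H]

/-- `G` fixes the unit vector `e`, as does its adjoint, and contracts the complement by `lam`. -/
structure IsMixingOperator (G : H →L[ℂ] H) (e : H) (lam : ℝ) : Prop where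
  norm_eq_one : ‖e‖ = 1
  map_eq : G e = e
  adjoint_eq : adjoint G e = e
  norm_map_le : ∀ w, ⟪e, w⟫_ℂ = 0 → ‖G w‖ ≤ lam * ‖w‖
  nonneg : 0 ≤ lam

lemma IsMixingOperator.inner_map {G : H →L[ℂ] H} {e : H} {lam : ℝ}
    (h : IsMixingOperator G e lam) (u : H) : ⟪e, G u⟫_ℂ = ⟪e, u⟫_ℂ := by
  rw [← ContinuousLinearMap.adjoint_inner_left, h.adjoint_eq]

/-- If w is orthogonal to e then so is y = G*w, and ‖y‖² = ⟨Gy, w⟩ ≤ λ‖y‖‖w‖. This lets the walk be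
read backwards, which is needed to bound the later block in a cut product. -/
lemma IsMixingOperator.adjoint {G : H →L[ℂ] H} {e : H} {lam : ℝ}
    (h : IsMixingOperator G e lam) : IsMixingOperator (adjoint G) e lam where
  norm_eq_one := h.norm_eq_one
  map_eq := h.adjoint_eq
  adjoint_eq := by rw [ContinuousLinearMap.adjoint_adjoint, h.map_eq]
  nonneg := h.nonneg
  norm_map_le w hw := by
    set y := ContinuousLinearMap.adjoint G w
    have hy : ⟪e, y⟫_ℂ = 0 := by
      rw [ContinuousLinearMap.adjoint_inner_right, h.map_eq, hw]
    have h1 : ‖y‖ ^ 2 ≤ lam * ‖w‖ * ‖y‖ := by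
      calc ‖y‖ ^ 2 = ‖⟪y, y⟫_ℂ‖ := by
            rw [inner_self_eq_norm_sq_to_K]
            simp
        _ = ‖⟪G y, w⟫_ℂ‖ := by
            rw [← inner_conj_symm, RCLike.norm_conj, ContinuousLinearMap.adjoint_inner_left,
              ← inner_conj_symm, RCLike.norm_conj]
        _ ≤ ‖G y‖ * ‖w‖ := norm_inner_le_norm _ _
        _ ≤ lam * ‖y‖ * ‖w‖ := by
          gcongr
          exact h.norm_map_le y hy
        _ = _ := by ring
    rcases (norm_nonneg y).eq_or_lt with h0 | h0
    · rw [← h0]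
      exact mul_nonneg h.nonneg (norm_nonneg _)
    · nlinarith

/-- Bounds for the blocks of an operator with respect to a unit vector. -/
structure HasBlockBounds (D : H →L[ℂ] H) (e : H) (α ε β : ℝ) : Prop where
  norm_inner_le : ‖⟪e, D e⟫_ℂ‖ ≤ α
  norm_perpPart_le : ‖perpPart e (D e)‖ ≤ ε
  norm_inner_map_le : ∀ w, ⟪e, w⟫_ℂ = 0 → ‖⟪e, D w⟫_ℂ‖ ≤ ε * ‖w‖
  norm_le : ‖D‖ ≤ β

/-- Passing to the adjoint exchanges the two off-diagonal blocks, both of which are bounded by ε. -/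
lemma HasBlockBounds.adjoint {D : H →L[ℂ] H} {e : H} {α ε β : ℝ} (he : ‖e‖ = 1)
    (h : HasBlockBounds D e α ε β) : HasBlockBounds (adjoint D) e α ε β where
  norm_inner_le := by
    rw [ContinuousLinearMap.adjoint_inner_right, ← inner_conj_symm, RCLike.norm_conj]
    exact h.norm_inner_le
  norm_perpPart_le := by
    set y := perpPart e (ContinuousLinearMap.adjoint D e)
    have hy : ⟪e, y⟫_ℂ = 0 := inner_perpPart he _
    have h1 : ‖y‖ ^ 2 ≤ ε * ‖y‖ := by
      calc ‖y‖ ^ 2 = ‖⟪y, y⟫_ℂ‖ := by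
            rw [inner_self_eq_norm_sq_to_K]
            simp
        _ = ‖⟪ContinuousLinearMap.adjoint D e, y⟫_ℂ‖ := by rw [← inner_eq_inner_perpPart hy]
        _ = ‖⟪e, D y⟫_ℂ‖ := by rw [ContinuousLinearMap.adjoint_inner_left]
        _ ≤ ε * ‖y‖ := h.norm_inner_map_le y hy
    have hε : 0 ≤ ε := (norm_nonneg _).trans h.norm_perpPart_le
    rcases (norm_nonneg y).eq_or_lt with h0 | h0
    · rw [← h0]
      exact hε
    · nlinarith
  norm_inner_map_le w hw := by
    rw [ContinuousLinearMap.adjoint_inner_right, inner_eq_inner_perpPart hw]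
    refine (norm_inner_le_norm _ _).trans ?_
    gcongr
    exact h.norm_perpPart_le
  norm_le := by
    rw [LinearIsometryEquiv.norm_map]
    exact h.norm_le

lemma adjoint_alternatingProduct (G D : H →L[ℂ] H) (k : ℕ) :
    adjoint (alternatingProduct G D k) = alternatingProduct (adjoint G) (adjoint D) k := by
  induction k with
  | zero => rfl
  | succ k ih =>
    have h := alternatingProduct_add (adjoint G) (adjoint D) 0 k
    rw [zero_add] at h
    change ContinuousLinearMap.adjoint (D.comp (G.comp (alternatingProduct G D k))) = _
    rw [h, ContinuousLinearMap.adjoint_comp, ContinuousLinearMap.adjoint_comp, ih]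
    rfl

/-- The components along e and orthogonal to e are propagated together. G leaves the first alone and
shrinks the second by λ, so an orthogonal part of size 2ερ^(k+1) feeds back only 2λε²ρ^(k+1) along e
and 2λεβρ^(k+1) across it. The two hypotheses on ρ are exactly what closes these two inductions. -/
lemma alternatingProduct_bounds {G D : H →L[ℂ] H} {e : H} {lam α ε β ρ : ℝ}
    (hG : IsMixingOperator G e lam) (hD : HasBlockBounds D e α ε β)
    (h1 : α + 2 * lam * ε ^ 2 ≤ ρ) (h2 : 1 + 2 * lam * β ≤ 2 * ρ) (k : ℕ) :
    ‖⟪e, alternatingProduct G D k e⟫_ℂ‖ ≤ ρ ^ (k + 1) ∧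
      ‖perpPart e (alternatingProduct G D k e)‖ ≤ 2 * ε * ρ ^ (k + 1) := by
  have hlam := hG.nonneg
  have hε : 0 ≤ ε := (norm_nonneg _).trans hD.norm_perpPart_le
  have hβ : 0 ≤ β := (norm_nonneg _).trans hD.norm_le
  have hρ : 1 ≤ 2 * ρ := le_trans (by nlinarith [mul_nonneg hlam hβ]) h2
  have hρ0 : 0 < ρ := by linarith
  have hαρ : α ≤ ρ := le_trans (by nlinarith [mul_nonneg hlam (sq_nonneg ε)]) h1
  induction k with
  | zero =>
    simp only [alternatingProduct, zero_add, pow_one]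
    exact ⟨hD.norm_inner_le.trans hαρ, hD.norm_perpPart_le.trans (by nlinarith)⟩
  | succ k ih =>
    obtain ⟨ih1, ih2⟩ := ih
    set u := alternatingProduct G D k e
    set c := ⟪e, u⟫_ℂ
    set w := perpPart e u
    have hw : ⟪e, w⟫_ℂ = 0 := inner_perpPart hG.norm_eq_one _
    have hGw : ⟪e, G w⟫_ℂ = 0 := by rw [hG.inner_map, hw]
    have hGw' : ‖G w‖ ≤ lam * (2 * ε * ρ ^ (k + 1)) :=
      (hG.norm_map_le w hw).trans (by gcongr)
    have hu : alternatingProduct G D (k + 1) e = c • D e + D (G w) := by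
      change D (G u) = _
      conv_lhs => rw [eq_add_perpPart e u]
      simp only [map_add, map_smul, hG.map_eq, c, w]
    rw [hu]
    constructor
    · rw [inner_add_right, inner_smul_right]
      calc ‖c * ⟪e, D e⟫_ℂ + ⟪e, D (G w)⟫_ℂ‖ ≤ ‖c‖ * ‖⟪e, D e⟫_ℂ‖ + ε * ‖G w‖ := by
            refine (norm_add_le _ _).trans ?_
            rw [norm_mul]
            gcongr
            exact hD.norm_inner_map_le _ hGw
        _ ≤ ρ ^ (k + 1) * α + ε * (lam * (2 * ε * ρ ^ (k + 1))) := by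
            gcongr
            exact hD.norm_inner_le
        _ = ρ ^ (k + 1) * (α + 2 * lam * ε ^ 2) := by ring
        _ ≤ ρ ^ (k + 1) * ρ := by gcongr
        _ = ρ ^ (k + 1 + 1) := by ring
    · rw [perpPart_add, perpPart_smul]
      calc ‖c • perpPart e (D e) + perpPart e (D (G w))‖ ≤ ‖c‖ * ε + β * ‖G w‖ := by
            refine (norm_add_le _ _).trans ?_
            rw [norm_smul]
            gcongr
            · exact hD.norm_perpPart_le
            · exact (norm_perpPart_le hG.norm_eq_one _).trans (D.le_of_opNorm_le hD.norm_le _)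
        _ ≤ ρ ^ (k + 1) * ε + β * (lam * (2 * ε * ρ ^ (k + 1))) := by gcongr
        _ = ε * ρ ^ (k + 1) * (1 + 2 * lam * β) := by ring
        _ ≤ ε * ρ ^ (k + 1) * (2 * ρ) := by gcongr
        _ = 2 * ε * ρ ^ (k + 1 + 1) := by ring

/-- The diagonal entries of alternating products are almost multiplicative. -/
lemma norm_inner_alternatingProduct_sub_mul_le {G D : H →L[ℂ] H} {e : H} {lam α ε β ρ : ℝ}
    (hG : IsMixingOperator G e lam) (hD : HasBlockBounds D e α ε β)
    (h1 : α + 2 * lam * ε ^ 2 ≤ ρ) (h2 : 1 + 2 * lam * β ≤ 2 * ρ) (m s : ℕ) :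
    ‖⟪e, alternatingProduct G D (m + s + 1) e⟫_ℂ -
      ⟪e, alternatingProduct G D m e⟫_ℂ * ⟪e, alternatingProduct G D s e⟫_ℂ‖ ≤
      4 * lam * ε ^ 2 * ρ ^ (m + 1 + (s + 1)) := by
  have hlam := hG.nonneg
  have hε : 0 ≤ ε := (norm_nonneg _).trans hD.norm_perpPart_le
  have hm := (alternatingProduct_bounds hG hD h1 h2 m).2
  have hs := (alternatingProduct_bounds hG.adjoint (hD.adjoint hG.norm_eq_one) h1 h2 s).2
  set u := alternatingProduct G D m e
  set w := perpPart e u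
  have hw : ⟪e, w⟫_ℂ = 0 := inner_perpPart hG.norm_eq_one _
  have hGw : ⟪e, G w⟫_ℂ = 0 := by rw [hG.inner_map, hw]
  -- Cut at the G joining the two blocks. The component of u along e passes through G unchanged and
  -- produces exactly the product. What is left pairs two orthogonal parts, each of size 2ε times
  -- its power of ρ, through G: hence 4λε².
  have key : ⟪e, alternatingProduct G D (m + s + 1) e⟫_ℂ -
      ⟪e, u⟫_ℂ * ⟪e, alternatingProduct G D s e⟫_ℂ =
      ⟪perpPart e (alternatingProduct (adjoint G) (adjoint D) s e), G w⟫_ℂ := by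
    rw [← inner_eq_inner_perpPart hGw, ← adjoint_alternatingProduct,
      ContinuousLinearMap.adjoint_inner_left, alternatingProduct_add]
    change ⟪e, alternatingProduct G D s (G u)⟫_ℂ - _ = _
    conv_lhs => enter [1]; rw [eq_add_perpPart e u]
    simp only [map_add, map_smul, hG.map_eq, inner_add_right, inner_smul_right, w]
    ring
  rw [key]
  have hρ : 0 ≤ ρ ^ (s + 1) := by
    have hβ : 0 ≤ β := (norm_nonneg _).trans hD.norm_le
    have hρ : 1 ≤ 2 * ρ := le_trans (by nlinarith [mul_nonneg hlam hβ]) h2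
    exact pow_nonneg (by linarith) _
  calc _ ≤ ‖perpPart e (alternatingProduct (adjoint G) (adjoint D) s e)‖ * ‖G w‖ :=
        norm_inner_le_norm _ _
    _ ≤ (2 * ε * ρ ^ (s + 1)) * (lam * (2 * ε * ρ ^ (m + 1))) := by
        gcongr
        exact (hG.norm_map_le w hw).trans (by gcongr)
    _ = _ := by ring

end MixingOperators

/-- Telescoping: detach the last piece, and bound its transform by the decay estimate so that the
accumulated error keeps the full power of R. With ℓ + 1 pieces there are ℓ cuts. -/
lemma norm_sub_prod_le_of_almost_multiplicative {Φ : ℕ → ℂ} {C R : ℝ}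
    (h1 : ∀ t, 1 ≤ t → ‖Φ t‖ ≤ R ^ t)
    (h2 : ∀ m s, 1 ≤ m → 1 ≤ s → ‖Φ (m + s) - Φ m * Φ s‖ ≤ C * R ^ (m + s)) (ℓ : ℕ)
    (s : Fin (ℓ + 1) → ℕ) (hs : ∀ i, 1 ≤ s i) :
    ‖Φ (∑ i, s i) - ∏ i, Φ (s i)‖ ≤ ℓ * (C * R ^ (∑ i, s i)) := by
  induction ℓ with
  | zero => simp
  | succ ℓ ih =>
    have ih' := ih (fun i => s i.castSucc) (fun i => hs _)
    rw [Fin.sum_univ_castSucc, Fin.prod_univ_castSucc]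
    set m := ∑ i : Fin (ℓ + 1), s i.castSucc
    set P := ∏ i : Fin (ℓ + 1), Φ (s i.castSucc)
    set r := s (Fin.last (ℓ + 1))
    have hm : 1 ≤ m := (hs (Fin.castSucc 0)).trans
      (Finset.single_le_sum (f := fun i : Fin (ℓ + 1) => s i.castSucc)
        (fun _ _ => Nat.zero_le _) (Finset.mem_univ 0))
    have hr : 1 ≤ r := hs _
    calc ‖Φ (m + r) - P * Φ r‖ = ‖(Φ (m + r) - Φ m * Φ r) + (Φ m - P) * Φ r‖ := by
          congr 1; ring
      _ ≤ C * R ^ (m + r) + ℓ * (C * R ^ m) * R ^ r := by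
          refine (norm_add_le _ _).trans ?_
          rw [norm_mul]
          refine add_le_add (h2 m r hm hr) ?_
          exact mul_le_mul ih' (h1 r hr) (norm_nonneg _) ((norm_nonneg _).trans ih')
      _ = _ := by push_cast; ring

/-! ### Moments of the label sum by conditioning on the endpoint -/

namespace RegularDigraph

variable {V : Type*} [Fintype V]

section Moments

variable {E : Type*} [NormedAddCommGroup E] [NormedSpace ℝ E]

/-- The expectation of `g` at the label sum of the walk with `k + 1` vertices, restricted to the
event that the walk ends at the given vertex. -/
noncomputable def walkMoment (G : RegularDigraph V) (val : V → Fin 2) : ℕ → (ℤ → E) → V → E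
  | 0, g, v => (Fintype.card V : ℝ)⁻¹ • g ((val v : ℕ) : ℤ)
  | k + 1, g, v =>
    ∑ v', G.walkMatrix v v' • walkMoment G val k (fun j => g (j + ((val v : ℕ) : ℤ))) v'

lemma walkMoment_map {F : Type*} [NormedAddCommGroup F] [NormedSpace ℝ F] (G : RegularDigraph V)
    (val : V → Fin 2) (k : ℕ) (L : E →ₗ[ℝ] F) (g : ℤ → E) (v : V) :
    G.walkMoment val k (fun j => L (g j)) v = L (G.walkMoment val k g v) := by
  induction k generalizing g v with
  | zero => simp only [walkMoment, map_smul]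
  | succ k ih => simp only [walkMoment, ih, map_sum, map_smul]

lemma walkMoment_smul (G : RegularDigraph V) (val : V → Fin 2) (k : ℕ) (c : ℝ) (g : ℤ → E)
    (v : V) : G.walkMoment val k (fun j => c • g j) v = c • G.walkMoment val k g v :=
  G.walkMoment_map val k (c • LinearMap.id) g v

lemma walkMoment_add (G : RegularDigraph V) (val : V → Fin 2) (k : ℕ) (g h : ℤ → E)
    (v : V) : G.walkMoment val k (fun j => g j + h j) v =
      G.walkMoment val k g v + G.walkMoment val k h v := by
  induction k generalizing g h v with
  | zero => simp only [walkMoment, smul_add]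
  | succ k ih => simp only [walkMoment, ih, smul_add, Finset.sum_add_distrib]

lemma pathProb_snoc (G : RegularDigraph V) (k : ℕ) (x : Fin (k + 1) → V) (u : V) :
    G.pathProb (Fin.snoc (α := fun _ => V) x u) =
      G.pathProb x * G.walkMatrix u (x (Fin.last k)) := by
  unfold pathProb
  rw [Fin.prod_univ_castSucc]
  congr 1
  · refine Finset.prod_congr rfl fun i _ => ?_
    have h2 : Fin.snoc (α := fun _ => V) x u ⟨(i : ℕ) - 1, by omega⟩ =
        x ⟨(i : ℕ) - 1, by omega⟩ :=
      Fin.snoc_castSucc (α := fun _ : Fin (k + 2) => V) u x (⟨(i : ℕ) - 1, by omega⟩ : Fin (k + 1))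
    simp only [Fin.val_castSucc, Fin.snoc_castSucc, h2]
  · have h2 : Fin.snoc (α := fun _ => V) x u ⟨k, by omega⟩ = x (Fin.last k) :=
      Fin.snoc_castSucc (α := fun _ : Fin (k + 2) => V) u x (Fin.last k)
    simp [h2]

/-- The function must be allowed to depend on the endpoint: removing the last vertex turns the
transition probability into it into a function of the previous endpoint, and the induction
hypothesis is applied to that function. -/
lemma sum_pathProb_smul (G : RegularDigraph V) (val : V → Fin 2) (k : ℕ) (g : ℤ → V → E) :
    ∑ x : Fin (k + 1) → V, G.pathProb x • g (∑ i, ((val (x i) : ℕ) : ℤ)) (x (Fin.last k)) =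
      ∑ v, G.walkMoment val k (fun j => g j v) v := by
  induction k generalizing g with
  | zero =>
    rw [← (Equiv.funUnique (Fin 1) V).symm.sum_comp]
    refine Finset.sum_congr rfl fun v _ => ?_
    simp [pathProb, walkMoment]
  | succ k ih =>
    rw [← (Fin.snocEquiv (fun _ : Fin (k + 2) => V)).sum_comp, Fintype.sum_prod_type]
    refine Finset.sum_congr rfl fun u _ => ?_
    rw [walkMoment]
    simp only [← walkMoment_smul]
    rw [← ih (fun j v' => G.walkMatrix u v' • g (j + ((val u : ℕ) : ℤ)) u)]
    refine Finset.sum_congr rfl fun x _ => ?_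
    have h : (Fin.snocEquiv (fun _ : Fin (k + 2) => V)) (u, x) =
        Fin.snoc (α := fun _ => V) x u := rfl
    rw [h, pathProb_snoc, Fin.sum_univ_castSucc, mul_smul]
    simp only [Fin.snoc_castSucc, Fin.snoc_last]

variable [Nonempty V]

instance isProbabilityMeasure_labelSum (G : RegularDigraph V) (val : V → Fin 2) (t : ℕ) :
    IsProbabilityMeasure (G.labelSum val t) := by
  unfold labelSum
  infer_instance

lemma labelSum_eq_map (G : RegularDigraph V) (val : V → Fin 2) (t : ℕ) :
    letI : MeasurableSpace (Fin t → V) := ⊤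
    G.labelSum val t = (G.walk t).toMeasure.map fun v => ∑ i, ((val (v i) : ℕ) : ℤ) := by
  let _ : MeasurableSpace (Fin t → V) := ⊤
  exact (PMF.toMeasure_map _ _ measurable_from_top).symm

lemma integrable_labelSum {F : Type*} [NormedAddCommGroup F] (G : RegularDigraph V) (val : V → Fin 2) (t : ℕ) (g : ℤ → F) :
    Integrable g (G.labelSum val t) := by
  let _ : MeasurableSpace (Fin t → V) := ⊤
  rw [labelSum_eq_map, integrable_map_measure
    (StronglyMeasurable.of_discrete).aestronglyMeasurable
    (by exact measurable_from_top.aemeasurable)]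
  have : MeasurableSingletonClass (Fin t → V) := ⟨fun _ => trivial⟩
  exact .of_finite

lemma integral_labelSum [CompleteSpace E] (G : RegularDigraph V) (val : V → Fin 2) (k : ℕ)
    (g : ℤ → E) :
    ∫ j, g j ∂(G.labelSum val (k + 1)) = ∑ v, G.walkMoment val k g v := by
  let _ : MeasurableSpace (Fin (k + 1) → V) := ⊤
  have : MeasurableSingletonClass (Fin (k + 1) → V) := ⟨fun _ => trivial⟩
  rw [labelSum_eq_map, integral_map (by exact measurable_from_top.aemeasurable)
    (StronglyMeasurable.of_discrete).aestronglyMeasurable, PMF.integral_eq_sum,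
    ← sum_pathProb_smul G val k (fun j _ => g j)]
  refine Finset.sum_congr rfl fun x _ => ?_
  congr 1
  simp [walk, ENNReal.toReal_ofReal (G.pathProb_nonneg x)]

end Moments

end RegularDigraph

/-! ### Averages over the vertices of functions of the label -/

section LabelAverages

variable {V : Type*} [Fintype V] [Nonempty V] {p : unitInterval} {val : V → Fin 2}

lemma sum_comp_label {E : Type*} [NormedAddCommGroup E] [NormedSpace ℝ E]
    (hval : ∀ b : Fin 2,
      (Fintype.card {v : V // val v = b} : ℝ) / Fintype.card V = labelWeight p b)
    (F : Fin 2 → E) :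
    ∑ v, F (val v) = (Fintype.card V : ℝ) • ((1 - (p : ℝ)) • F 0 + (p : ℝ) • F 1) := by
  classical
  have hn : (Fintype.card V : ℝ) ≠ 0 := by exact_mod_cast Fintype.card_ne_zero
  have h : ∀ b : Fin 2, (Fintype.card {v : V // val v = b} : ℝ) =
      Fintype.card V * labelWeight p b := fun b => by rw [← hval b]; field_simp
  have h1 : ∑ v, F (val v) = ∑ b : Fin 2, ∑ v with val v = b, F (val v) :=
    (Finset.sum_fiberwise _ _ _).symm
  have h2 : ∀ b : Fin 2, ∑ v with val v = b, F (val v) =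
      ((Fintype.card V : ℝ) * labelWeight p b) • F b := fun b => by
    rw [← h b, Fintype.card_subtype, Finset.sum_congr rfl (g := fun _ => F b)
      (fun v hv => by rw [(Finset.mem_filter.1 hv).2]), Finset.sum_const, Nat.cast_smul_eq_nsmul]
  rw [h1, Fin.sum_univ_two, h2, h2, smul_add, smul_smul, smul_smul]
  simp [labelWeight]

end LabelAverages

/-! ### The walk operator on complex vectors -/

namespace RegularDigraph

open scoped InnerProductSpace

variable {V : Type*} [Fintype V]

/-- The unit vector with constant entries. -/
noncomputable def constUnit (V : Type*) [Fintype V] : EuclideanSpace ℂ V :=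
  WithLp.toLp 2 fun _ => ((√(Fintype.card V))⁻¹ : ℝ)

lemma sum_walkMatrix_right (G : RegularDigraph V) (v : V) : ∑ v', G.walkMatrix v v' = 1 := by
  simp only [walkMatrix, Matrix.of_apply]
  rw [← Finset.sum_div, G.in_deg v, div_self G.deg_pos.ne']

lemma inner_constUnit (x : EuclideanSpace ℂ V) :
    ⟪constUnit V, x⟫_ℂ = ((√(Fintype.card V))⁻¹ : ℝ) * ∑ v, x v := by
  simp [constUnit, PiLp.inner_apply, Finset.sum_mul, mul_comm]

lemma norm_constUnit [Nonempty V] : ‖constUnit V‖ = 1 := by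
  have hn : (0 : ℝ) < Fintype.card V := by exact_mod_cast Fintype.card_pos
  rw [EuclideanSpace.norm_eq, Real.sqrt_eq_one]
  simp only [constUnit, Complex.norm_real, Real.norm_eq_abs, sq_abs, Finset.sum_const,
    Finset.card_univ, nsmul_eq_mul, inv_pow]
  rw [Real.sq_sqrt hn.le, mul_inv_cancel₀ hn.ne']

variable [DecidableEq V]

/-- The random walk operator on complex vectors. -/
noncomputable def walkOp (G : RegularDigraph V) : EuclideanSpace ℂ V →L[ℂ] EuclideanSpace ℂ V :=
  Matrix.toEuclideanCLM (n := V) (𝕜 := ℂ) (G.walkMatrix.map fun x => (x : ℂ))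

lemma walkOp_apply (G : RegularDigraph V) (x : EuclideanSpace ℂ V) (v : V) :
    G.walkOp x v = ∑ v', (G.walkMatrix v v' : ℂ) * x v' := by
  simp [walkOp, Matrix.mulVec, dotProduct]

lemma norm_toEuclideanCLM_walkMatrix_le (G : RegularDigraph V) {lam : ℝ}
    (hG : G.IsSpectralExpander lam) (x : EuclideanSpace ℝ V) (hx : ∑ v, x v = 0) :
    ‖Matrix.toEuclideanCLM (n := V) (𝕜 := ℝ) G.walkMatrix x‖ ≤ lam * ‖x‖ := by
  have hmem : x ∈ (Submodule.span ℝ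
      {(WithLp.toLp 2 (fun _ : V => (1 : ℝ)) : EuclideanSpace ℝ V)})ᗮ := by
    rw [Submodule.mem_orthogonal_singleton_iff_inner_right]
    simpa [PiLp.inner_apply] using hx
  exact ContinuousLinearMap.le_of_opNorm_le _ hG ⟨x, hmem⟩

lemma spectralExpansion_nonneg (G : RegularDigraph V) : 0 ≤ G.spectralExpansion := by
  unfold spectralExpansion
  positivity

/-- The spectral expansion refers to real vectors. The walk matrix is real, so it acts separately on
real and imaginary parts, whose squared norms add. -/
lemma norm_walkOp_le (G : RegularDigraph V) {lam : ℝ} (hG : G.IsSpectralExpander lam)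
    (w : EuclideanSpace ℂ V) (hw : ∑ v, w v = 0) : ‖G.walkOp w‖ ≤ lam * ‖w‖ := by
  have hlam : 0 ≤ lam := G.spectralExpansion_nonneg.trans hG
  let x : EuclideanSpace ℝ V := WithLp.toLp 2 fun v => (w v).re
  let y : EuclideanSpace ℝ V := WithLp.toLp 2 fun v => (w v).im
  have hx := G.norm_toEuclideanCLM_walkMatrix_le hG x (by
    simpa [x] using congrArg Complex.re hw)
  have hy := G.norm_toEuclideanCLM_walkMatrix_le hG y (by
    simpa [y] using congrArg Complex.im hw)
  have hsplit : ‖w‖ ^ 2 = ‖x‖ ^ 2 + ‖y‖ ^ 2 := by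
    rw [EuclideanSpace.norm_sq_eq, EuclideanSpace.norm_sq_eq, EuclideanSpace.norm_sq_eq,
      ← Finset.sum_add_distrib]
    refine Finset.sum_congr rfl fun v _ => ?_
    simp only [x, y, Real.norm_eq_abs, sq_abs]
    rw [Complex.sq_norm, Complex.normSq_apply]
    ring
  have hsplit' : ‖G.walkOp w‖ ^ 2 = ‖Matrix.toEuclideanCLM (n := V) (𝕜 := ℝ) G.walkMatrix x‖ ^ 2 +
      ‖Matrix.toEuclideanCLM (n := V) (𝕜 := ℝ) G.walkMatrix y‖ ^ 2 := by
    rw [EuclideanSpace.norm_sq_eq, EuclideanSpace.norm_sq_eq, EuclideanSpace.norm_sq_eq,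
      ← Finset.sum_add_distrib]
    refine Finset.sum_congr rfl fun v _ => ?_
    rw [Complex.sq_norm, Complex.normSq_apply, walkOp_apply]
    simp [Matrix.mulVec, dotProduct, x, y, pow_two]
  refine abs_le_of_sq_le_sq' (a := ‖G.walkOp w‖) ?_ (by positivity) |>.2
  rw [hsplit', mul_pow, hsplit, mul_add, ← mul_pow, ← mul_pow]
  gcongr

/-- Equal in-degrees make the constants fixed by the walk, equal out-degrees make them fixed by its
adjoint. -/
lemma isMixingOperator_walkOp [Nonempty V] (G : RegularDigraph V) {lam : ℝ}
    (hG : G.IsSpectralExpander lam) : IsMixingOperator G.walkOp (constUnit V) lam where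
  norm_eq_one := norm_constUnit
  nonneg := G.spectralExpansion_nonneg.trans hG
  map_eq := by
    ext v
    rw [walkOp_apply]
    simp only [constUnit]
    rw [← Finset.sum_mul, ← Complex.ofReal_sum, sum_walkMatrix_right, Complex.ofReal_one, one_mul]
  adjoint_eq := by
    rw [← ContinuousLinearMap.star_eq_adjoint, walkOp, ← map_star]
    ext v
    simp only [constUnit, Matrix.ofLp_toEuclideanCLM, Matrix.mulVec, dotProduct,
      Matrix.star_apply, Matrix.map_apply]
    rw [← Finset.sum_mul]
    simp only [RCLike.star_def, Complex.conj_ofReal]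
    rw [← Complex.ofReal_sum, sum_walkMatrix, Complex.ofReal_one, one_mul]
  norm_map_le w hw := by
    refine G.norm_walkOp_le hG w ?_
    rw [inner_constUnit] at hw
    refine (mul_eq_zero.1 hw).resolve_left ?_
    have hn : (0 : ℝ) < Fintype.card V := by exact_mod_cast Fintype.card_pos
    exact_mod_cast (inv_pos.2 (Real.sqrt_pos.2 hn)).ne'

/-- Multiplication by a complex function. -/
noncomputable def diagOp (g : V → ℂ) : EuclideanSpace ℂ V →L[ℂ] EuclideanSpace ℂ V :=
  Matrix.toEuclideanCLM (n := V) (𝕜 := ℂ) (Matrix.diagonal g)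

lemma diagOp_apply (g : V → ℂ) (x : EuclideanSpace ℂ V) (v : V) :
    diagOp g x v = g v * x v := by
  simp [diagOp, Matrix.mulVec_diagonal]

lemma adjoint_diagOp (g : V → ℂ) :
    ContinuousLinearMap.adjoint (diagOp g) = diagOp (fun v => starRingEnd ℂ (g v)) := by
  rw [← ContinuousLinearMap.star_eq_adjoint, diagOp, ← map_star, Matrix.star_eq_conjTranspose,
    Matrix.diagonal_conjTranspose]
  rfl

lemma norm_diagOp_le (g : V → ℂ) {β : ℝ} (hβ : 0 ≤ β) (h : ∀ v, ‖g v‖ ≤ β) :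
    ‖diagOp g‖ ≤ β := by
  refine ContinuousLinearMap.opNorm_le_bound _ hβ fun x => ?_
  refine abs_le_of_sq_le_sq' (a := ‖diagOp g x‖) ?_ (by positivity) |>.2
  rw [mul_pow, EuclideanSpace.norm_sq_eq, EuclideanSpace.norm_sq_eq, Finset.mul_sum]
  refine Finset.sum_le_sum fun v _ => ?_
  rw [diagOp_apply, norm_mul, mul_pow]
  gcongr
  exact h v

lemma inner_diagOp_constUnit [Nonempty V] (g : V → ℂ) :
    ⟪constUnit V, diagOp g (constUnit V)⟫_ℂ = (Fintype.card V : ℂ)⁻¹ * ∑ v, g v := by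
  have hn : (0 : ℝ) < Fintype.card V := by exact_mod_cast Fintype.card_pos
  rw [inner_constUnit]
  simp only [diagOp_apply, constUnit]
  rw [← Finset.sum_mul, mul_comm, mul_assoc, mul_comm, ← Complex.ofReal_mul, ← mul_inv,
    Real.mul_self_sqrt hn.le]
  push_cast
  rfl

lemma norm_sq_diagOp_constUnit [Nonempty V] (g : V → ℂ) :
    ‖diagOp g (constUnit V)‖ ^ 2 = (Fintype.card V : ℝ)⁻¹ * ∑ v, ‖g v‖ ^ 2 := by
  have hn : (0 : ℝ) < Fintype.card V := by exact_mod_cast Fintype.card_pos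
  rw [EuclideanSpace.norm_sq_eq, Finset.mul_sum]
  refine Finset.sum_congr rfl fun v _ => ?_
  simp only [diagOp_apply, constUnit]
  rw [norm_mul, mul_pow, Complex.norm_real, Real.norm_eq_abs, sq_abs, inv_pow, Real.sq_sqrt hn.le,
    mul_comm]

/-- The diagonal block is the mean of g over the vertices and ε² bounds its variance, since the part
of ge orthogonal to e is the centred function. Conjugating g changes neither, which handles the
other off-diagonal block. -/
lemma hasBlockBounds_diagOp [Nonempty V] (g : V → ℂ) {α ε β : ℝ} (hε : 0 ≤ ε) (hβ : 0 ≤ β)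
    (hgα : ‖(Fintype.card V : ℂ)⁻¹ * ∑ v, g v‖ ≤ α)
    (hgε : (Fintype.card V : ℝ)⁻¹ * ∑ v, ‖g v‖ ^ 2 -
      ‖(Fintype.card V : ℂ)⁻¹ * ∑ v, g v‖ ^ 2 ≤ ε ^ 2)
    (hgβ : ∀ v, ‖g v‖ ≤ β) : HasBlockBounds (diagOp g) (constUnit V) α ε β where
  norm_inner_le := by rwa [inner_diagOp_constUnit]
  norm_perpPart_le := by
    refine abs_le_of_sq_le_sq' ?_ hε |>.2
    rwa [norm_sq_perpPart norm_constUnit, inner_diagOp_constUnit, norm_sq_diagOp_constUnit]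
  norm_inner_map_le w hw := by
    rw [← ContinuousLinearMap.adjoint_inner_left, inner_eq_inner_perpPart hw]
    refine (norm_inner_le_norm _ _).trans ?_
    gcongr
    refine abs_le_of_sq_le_sq' ?_ hε |>.2
    rw [norm_sq_perpPart norm_constUnit, ContinuousLinearMap.adjoint_inner_right,
      ← inner_conj_symm, RCLike.norm_conj, inner_diagOp_constUnit, adjoint_diagOp,
      norm_sq_diagOp_constUnit]
    simpa only [RCLike.norm_conj] using hgε
  norm_le := norm_diagOp_le g hβ hgβ

/-- The transform of the label sum is a diagonal entry of an alternating product. -/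
lemma integral_cexp_labelSum [Nonempty V] (G : RegularDigraph V) (val : V → Fin 2) (z : ℂ)
    (c : ℝ) (k : ℕ) :
    ∫ j, Complex.exp (z * (j - c * (k + 1))) ∂(G.labelSum val (k + 1)) =
      ⟪constUnit V, alternatingProduct G.walkOp
        (diagOp fun v => Complex.exp (z * ((val v : ℕ) - c))) k (constUnit V)⟫_ℂ := by
  have hn : (0 : ℝ) < Fintype.card V := by exact_mod_cast Fintype.card_pos
  have hs : ((√(Fintype.card V))⁻¹ : ℝ) * ((√(Fintype.card V))⁻¹ : ℝ) =
      (Fintype.card V : ℝ)⁻¹ := by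
    rw [← mul_inv, Real.mul_self_sqrt hn.le]
  have key : ∀ (k : ℕ) (v : V),
      G.walkMoment val k (fun j => Complex.exp (z * (j - c * (k + 1)))) v =
        ((√(Fintype.card V))⁻¹ : ℝ) * alternatingProduct G.walkOp
          (diagOp fun v => Complex.exp (z * ((val v : ℕ) - c))) k (constUnit V) v := by
    intro k
    induction k with
    | zero =>
      intro v
      simp only [walkMoment, alternatingProduct, diagOp_apply, constUnit]
      rw [mul_left_comm, ← Complex.ofReal_mul, hs, Complex.real_smul]
      push_cast
      rw [mul_comm]
      congr 3
      ring
    | succ k ih =>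
      intro v
      -- The exponential turns adding the last label into multiplication by a scalar depending on
      -- the last vertex only, which is the diagonal factor.
      have e : (fun j : ℤ => Complex.exp (z * (((j + ((val v : ℕ) : ℤ) : ℤ) : ℂ) -
          c * (((k + 1 : ℕ) : ℂ) + 1)))) = fun j : ℤ =>
            Complex.exp (z * (j - c * (k + 1))) * Complex.exp (z * ((val v : ℕ) - c)) := by
        funext j
        rw [← Complex.exp_add]
        congr 1
        push_cast
        ring
      have h : G.walkMoment val (k + 1)
          (fun j : ℤ => Complex.exp (z * (j - c * (((k + 1 : ℕ) : ℂ) + 1)))) v =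
          ∑ v', G.walkMatrix v v' • (G.walkMoment val k
            (fun j => Complex.exp (z * (j - c * (k + 1)))) v' *
              Complex.exp (z * ((val v : ℕ) - c))) := by
        rw [walkMoment, e]
        refine Finset.sum_congr rfl fun v' _ => congrArg _ ?_
        exact G.walkMoment_map val k (LinearMap.mulRight ℝ (Complex.exp (z * ((val v : ℕ) - c))))
          (fun j : ℤ => Complex.exp (z * (j - c * (k + 1)))) v'
      rw [h]
      rw [alternatingProduct_succ_apply, diagOp_apply, walkOp_apply, Finset.mul_sum, Finset.mul_sum]
      refine Finset.sum_congr rfl fun v' _ => ?_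
      rw [ih, Complex.real_smul]
      ring
  rw [integral_labelSum, inner_constUnit, Finset.mul_sum]
  exact Finset.sum_congr rfl fun v _ => key k v

end RegularDigraph

/-! ### Transforms of integer distributions, and of the Bernoulli and binomial laws -/

section IntegerMeasures

lemma hasSum_measureReal_smul {E : Type*} [NormedAddCommGroup E] [NormedSpace ℝ E]
    [CompleteSpace E] {μ : Measure ℤ} [IsFiniteMeasure μ] {g : ℤ → E} (hg : Integrable g μ) :
    HasSum (fun j => μ.real {j} • g j) (∫ j, g j ∂μ) := by
  have hμ := Measure.sum_smul_dirac μ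
  have h := hasSum_integral_sum_dirac (f := g) (x := fun j : ℤ => j) (c := fun j => μ {j})
    (fun j => measure_ne_top _ _)
    ((integrable_sum_dirac_iff fun j => measure_ne_top _ _).1 (by rwa [hμ]))
  rw [hμ] at h
  exact h

lemma hasSum_measureReal_singleton (μ : Measure ℤ) [IsProbabilityMeasure μ] :
    HasSum (fun j => μ.real {j}) 1 := by
  simpa using hasSum_measureReal_smul (integrable_const (1 : ℝ) (μ := μ))

lemma summable_measureReal_singleton (μ : Measure ℤ) [IsProbabilityMeasure μ] :
    Summable (fun j => μ.real {j}) := (hasSum_measureReal_singleton μ).summable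

lemma integrable_cexp_real_mul_int_mul_I (μ : Measure ℤ) [IsFiniteMeasure μ] (θ : ℝ) :
    Integrable (fun j : ℤ => Complex.exp (θ * j * Complex.I)) μ :=
  Integrable.of_bound (C := 1) (StronglyMeasurable.of_discrete).aestronglyMeasurable
    (ae_of_all _ fun j => (norm_cexp_real_mul_int_mul_I θ j).le)

lemma trigSum_measureReal (μ : Measure ℤ) [IsProbabilityMeasure μ] (θ : ℝ) :
    trigSum (fun j => μ.real {j}) θ = ∫ j : ℤ, Complex.exp (θ * j * Complex.I) ∂μ := by
  rw [← (hasSum_measureReal_smul (integrable_cexp_real_mul_int_mul_I μ θ)).tsum_eq]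
  simp only [trigSum, Complex.real_smul]

end IntegerMeasures

/-- The transform of the centred Bernoulli distribution. -/
noncomputable def bernoulliTransform (p : unitInterval) (z : ℂ) : ℂ :=
  (1 - (p : ℝ) : ℝ) * Complex.exp (z * (0 - (p : ℝ))) +
    ((p : ℝ) : ℂ) * Complex.exp (z * (1 - (p : ℝ)))

lemma integral_cexp_map_cast_binomial (p : unitInterval) (z : ℂ) (t : ℕ) :
    ∫ j : ℤ, Complex.exp (z * (j - (p : ℝ) * t)) ∂((binomial t p).map (Nat.cast : ℕ → ℤ)) =
      bernoulliTransform p z ^ t := by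
  rw [integral_map_cast_binomial, bernoulliTransform, add_comm, add_pow]
  have : Finset.Iic t = Finset.range (t + 1) := by
    ext k
    simp
  rw [this]
  refine Finset.sum_congr rfl fun k hk => ?_
  have hk' : k ≤ t := Nat.lt_succ_iff.1 (Finset.mem_range.1 hk)
  obtain ⟨m, rfl⟩ := Nat.exists_eq_add_of_le hk'
  rw [mul_pow, mul_pow, ← Complex.exp_nat_mul, ← Complex.exp_nat_mul, Nat.add_sub_cancel_left,
    Complex.real_smul]
  have e : Complex.exp (z * (((k : ℕ) : ℤ) - (p : ℝ) * ((k + m : ℕ) : ℂ))) =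
      Complex.exp (k * (z * (1 - (p : ℝ)))) * Complex.exp (m * (z * (0 - (p : ℝ)))) := by
    rw [← Complex.exp_add]
    congr 1
    push_cast
    ring
  rw [e]
  push_cast
  ring

lemma norm_sq_bernoulliTransform_mul_I (p : unitInterval) (θ : ℝ) :
    ‖bernoulliTransform p (θ * Complex.I)‖ ^ 2 =
      1 - 2 * ((p : ℝ) * (1 - p)) * (1 - Real.cos θ) := by
  have e : bernoulliTransform p (θ * Complex.I) =
      Complex.exp ((-(θ * (p : ℝ)) : ℝ) * Complex.I) *
        ((1 - (p : ℝ) : ℝ) + (p : ℝ) * Complex.exp (θ * Complex.I)) := by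
    rw [bernoulliTransform, mul_add, mul_left_comm _ ((p : ℝ) : ℂ), ← Complex.exp_add]
    push_cast
    rw [mul_comm (Complex.exp _)]
    congr 3 <;> ring_nf
  rw [e, norm_mul, Complex.norm_exp_ofReal_mul_I, one_mul, Complex.sq_norm, Complex.normSq_apply]
  simp only [Complex.add_re, Complex.add_im, Complex.mul_re, Complex.mul_im, Complex.ofReal_re,
    Complex.ofReal_im, Complex.exp_ofReal_mul_I_re, Complex.exp_ofReal_mul_I_im, zero_mul,
    sub_zero, zero_add, add_zero]
  have := Real.sin_sq_add_cos_sq θ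
  linear_combination (p : ℝ) ^ 2 * this

/-! ### Decay and almost multiplicativity of the transforms of the walk -/

namespace RegularDigraph

variable {V : Type*} [Fintype V] [Nonempty V]

/-- The transform of the centred label sum of the walk on `t` vertices. -/
noncomputable def walkTransform (G : RegularDigraph V) (val : V → Fin 2) (p : unitInterval) (z : ℂ)
    (t : ℕ) : ℂ := ∫ j : ℤ, Complex.exp (z * (j - (p : ℝ) * t)) ∂(G.labelSum val t)

variable {p : unitInterval} {lam : ℝ} {G : RegularDigraph V} {val : V → Fin 2}

lemma card_inv_mul_sum_tilt (hval : ∀ b : Fin 2,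
      (Fintype.card {v : V // val v = b} : ℝ) / Fintype.card V = labelWeight p b) (z : ℂ) :
    (Fintype.card V : ℂ)⁻¹ * ∑ v, Complex.exp (z * ((val v : ℕ) - (p : ℝ))) =
      bernoulliTransform p z := by
  have hn : (Fintype.card V : ℂ) ≠ 0 := by exact_mod_cast Fintype.card_ne_zero
  rw [sum_comp_label hval (fun b => Complex.exp (z * ((b : ℕ) - (p : ℝ))))]
  simp only [Complex.real_smul, bernoulliTransform]
  push_cast
  rw [inv_mul_cancel_left₀ hn]
  simp

lemma card_inv_mul_sum_norm_sq_tilt (hval : ∀ b : Fin 2,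
      (Fintype.card {v : V // val v = b} : ℝ) / Fintype.card V = labelWeight p b) (z : ℂ) :
    (Fintype.card V : ℝ)⁻¹ * ∑ v, ‖Complex.exp (z * ((val v : ℕ) - (p : ℝ)))‖ ^ 2 =
      (1 - p) * Real.exp (-(z.re * p)) ^ 2 + p * Real.exp (z.re * (1 - p)) ^ 2 := by
  have hn : (Fintype.card V : ℝ) ≠ 0 := by exact_mod_cast Fintype.card_ne_zero
  rw [sum_comp_label hval (fun b => ‖Complex.exp (z * ((b : ℕ) - (p : ℝ)))‖ ^ 2)]
  rw [smul_eq_mul, inv_mul_cancel_left₀ hn]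
  simp [Complex.norm_exp]

lemma trigSum_labelSum (G : RegularDigraph V) (val : V → Fin 2) (p : unitInterval) (θ : ℝ)
    (t : ℕ) : trigSum (fun j => (G.labelSum val t).real {j}) θ =
      Complex.exp ((θ * (p * t) : ℝ) * Complex.I) * G.walkTransform val p (θ * Complex.I) t := by
  rw [trigSum_measureReal, walkTransform, ← integral_const_mul]
  congr 1
  funext j
  rw [← Complex.exp_add]
  congr 1
  push_cast
  ring

variable [DecidableEq V]

/-- Decay and almost multiplicativity of the transforms of the label sums. -/
lemma walkTransform_bounds (hG : G.IsSpectralExpander lam) (hval : ∀ b : Fin 2,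
      (Fintype.card {v : V // val v = b} : ℝ) / Fintype.card V = labelWeight p b) {z : ℂ}
    {α ε β ρ : ℝ} (hε : 0 ≤ ε) (hβ : 0 ≤ β) (hα : ‖bernoulliTransform p z‖ ≤ α)
    (hαε : (1 - p) * Real.exp (-(z.re * p)) ^ 2 + p * Real.exp (z.re * (1 - p)) ^ 2 -
      ‖bernoulliTransform p z‖ ^ 2 ≤ ε ^ 2)
    (hβ' : ∀ b : Fin 2, ‖Complex.exp (z * ((b : ℕ) - (p : ℝ)))‖ ≤ β)
    (h1 : α + 2 * lam * ε ^ 2 ≤ ρ) (h2 : 1 + 2 * lam * β ≤ 2 * ρ) :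
    G.walkTransform val p z 1 = bernoulliTransform p z ∧
    (∀ t, 1 ≤ t → ‖G.walkTransform val p z t‖ ≤ ρ ^ t) ∧
    ∀ m s, 1 ≤ m → 1 ≤ s → ‖G.walkTransform val p z (m + s) -
      G.walkTransform val p z m * G.walkTransform val p z s‖ ≤
        4 * lam * ε ^ 2 * ρ ^ (m + s) := by
  have hmix := G.isMixingOperator_walkOp hG
  have hD : HasBlockBounds (diagOp fun v => Complex.exp (z * ((val v : ℕ) - (p : ℝ))))
      (constUnit V) α ε β := by
    refine hasBlockBounds_diagOp _ hε hβ ?_ ?_ fun v => hβ' (val v)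
    · rwa [card_inv_mul_sum_tilt hval]
    · rwa [card_inv_mul_sum_tilt hval, card_inv_mul_sum_norm_sq_tilt hval]
  have e : ∀ k, G.walkTransform val p z (k + 1) = inner ℂ (constUnit V)
      (alternatingProduct G.walkOp
        (diagOp fun v => Complex.exp (z * ((val v : ℕ) - (p : ℝ)))) k (constUnit V)) := by
    intro k
    rw [← integral_cexp_labelSum]
    simp only [walkTransform, Nat.cast_add, Nat.cast_one]
  refine ⟨?_, fun t ht => ?_, fun m s hm hs => ?_⟩
  · rw [e 0, alternatingProduct, inner_diagOp_constUnit, card_inv_mul_sum_tilt hval]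
  · obtain ⟨k, rfl⟩ := Nat.exists_eq_add_of_le' ht
    rw [e]
    exact (alternatingProduct_bounds hmix hD h1 h2 k).1
  · obtain ⟨k, rfl⟩ := Nat.exists_eq_add_of_le' hm
    obtain ⟨l, rfl⟩ := Nat.exists_eq_add_of_le' hs
    rw [show k + 1 + (l + 1) = (k + l + 1) + 1 by ring, e, e, e]
    have := norm_inner_alternatingProduct_sub_mul_le hmix hD h1 h2 k l
    rwa [show k + 1 + (l + 1) = (k + l + 1) + 1 by ring] at this

/-- On the imaginary axis the label factors have modulus one, so β = 1 and ε² = 1 - |φ|² = 2qc,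
where φ is the Bernoulli transform and c = 1 - cos θ. From |φ|² = 1 - 2qc one gets α = 1 - qc. The
feedback 2λε² = 4λqc is a small fraction of the gap qc, which leaves room for the Gaussian. -/
lemma walkTransform_mul_I_bounds (hlam : lam ≤ 1 / 100) (hG : G.IsSpectralExpander lam)
    (hval : ∀ b : Fin 2,
      (Fintype.card {v : V // val v = b} : ℝ) / Fintype.card V = labelWeight p b) {θ : ℝ}
    (hθ : |θ| ≤ Real.pi) :
    (∀ t, 1 ≤ t → ‖G.walkTransform val p (θ * Complex.I) t‖ ≤
      Real.exp (-((p : ℝ) * (1 - p) * θ ^ 2 / 20)) ^ t) ∧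
    ∀ m s, 1 ≤ m → 1 ≤ s → ‖G.walkTransform val p (θ * Complex.I) (m + s) -
      G.walkTransform val p (θ * Complex.I) m * G.walkTransform val p (θ * Complex.I) s‖ ≤
        4 * lam * ((p : ℝ) * (1 - p)) * θ ^ 2 *
          Real.exp (-((p : ℝ) * (1 - p) * θ ^ 2 / 20)) ^ (m + s) := by
  have hlam0 : 0 ≤ lam := G.spectralExpansion_nonneg.trans hG
  have hp0 := p.2.1
  have hp1 := p.2.2
  set q : ℝ := (p : ℝ) * (1 - p) with hq
  have hq0 : 0 ≤ q := mul_nonneg hp0 (by linarith)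
  have hq1 : q ≤ 1 / 4 := by nlinarith [sq_nonneg ((p : ℝ) - 1 / 2)]
  have hpi := Real.pi_lt_d2
  have hpi0 := Real.pi_pos
  have hc1 := Real.cos_le_one_sub_mul_cos_sq hθ
  have hc2 := Real.one_sub_sq_div_two_le_cos (x := θ)
  have hθ2 : θ ^ 2 ≤ 10 := by
    rw [← sq_abs]
    nlinarith [abs_nonneg θ]
  -- This is where |θ| ≤ π matters. The decay rate only asks for qθ²/20 ≤ qc/4, which this implies.
  have hcos : θ ^ 2 / 5 ≤ 1 - Real.cos θ := by
    have : 1 / 5 ≤ 2 / Real.pi ^ 2 := by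
      rw [div_le_div_iff₀ (by norm_num) (by positivity)]
      nlinarith
    nlinarith [sq_nonneg θ]
  set c := 1 - Real.cos θ with hc
  have hc0 : 0 ≤ c := by linarith [Real.cos_le_one θ]
  have hc3 : c ≤ 2 := by linarith [Real.neg_one_le_cos θ]
  have hεsq : (√(2 * q * c)) ^ 2 = 2 * q * c := Real.sq_sqrt (by positivity)
  have hx : 2 * q * c ≤ 1 := by nlinarith
  have hx0 : 0 ≤ 2 * q * c := by positivity
  have hnorm := norm_sq_bernoulliTransform_mul_I p θ
  rw [← hq, ← hc] at hnorm
  have hlow := Real.add_one_le_exp (-(q * θ ^ 2 / 20))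
  have hqθ : q * θ ^ 2 ≤ 5 * (q * c) := by nlinarith
  have hb := walkTransform_bounds (G := G) (z := θ * Complex.I) (α := 1 - q * c)
    (ε := √(2 * q * c)) (β := 1) (ρ := Real.exp (-(q * θ ^ 2 / 20))) hG hval
    (Real.sqrt_nonneg _) zero_le_one
    (abs_le_of_sq_le_sq (by nlinarith) (by nlinarith) |> (abs_le.1 · |>.2))
    (by
      rw [hnorm, hεsq]
      simp)
    (fun b => by
      rw [show (θ : ℂ) * Complex.I * ((b : ℕ) - (p : ℝ)) =
        ((θ * ((b : ℕ) - p) : ℝ) : ℂ) * Complex.I by push_cast; ring,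
        Complex.norm_exp_ofReal_mul_I])
    (by rw [hεsq]; nlinarith)
    (by nlinarith)
  refine ⟨hb.2.1, fun m s hm hs => (hb.2.2 m s hm hs).trans ?_⟩
  rw [hεsq]
  gcongr ?_ * _
  have : q * c ≤ q * (θ ^ 2 / 2) := by
    gcongr
    linarith
  nlinarith

/-- Gaussian decay of the characteristic functions of the label sums. -/
lemma norm_trigSum_labelSum_le (hlam : lam ≤ 1 / 100) (hG : G.IsSpectralExpander lam)
    (hval : ∀ b : Fin 2,
      (Fintype.card {v : V // val v = b} : ℝ) / Fintype.card V = labelWeight p b) {θ : ℝ}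
    (hθ : |θ| ≤ Real.pi) {t : ℕ} (ht : 1 ≤ t) :
    ‖trigSum (fun j => (G.labelSum val t).real {j}) θ‖ ≤
      Real.exp (-((p : ℝ) * (1 - p) * t * θ ^ 2 / 20)) := by
  rw [trigSum_labelSum (p := p), norm_mul, Complex.norm_exp_ofReal_mul_I, one_mul]
  refine ((walkTransform_mul_I_bounds hlam hG hval hθ).1 t ht).trans (le_of_eq ?_)
  rw [← Real.exp_nat_mul]
  congr 1
  ring

/-- The characteristic functions of the label sums are almost multiplicative. -/
lemma norm_trigSum_labelSum_sub_prod_le (hlam : lam ≤ 1 / 100) (hG : G.IsSpectralExpander lam)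
    (hval : ∀ b : Fin 2,
      (Fintype.card {v : V // val v = b} : ℝ) / Fintype.card V = labelWeight p b) {θ : ℝ}
    (hθ : |θ| ≤ Real.pi) {ℓ : ℕ} (hℓ : 1 ≤ ℓ) (s : Fin ℓ → ℕ) (hs : ∀ i, 1 ≤ s i) {t : ℕ}
    (hst : ∑ i, s i = t) :
    ‖trigSum (fun j => (G.labelSum val t).real {j}) θ -
      ∏ i, trigSum (fun j => (G.labelSum val (s i)).real {j}) θ‖ ≤
      4 * lam * ℓ * ((p : ℝ) * (1 - p)) * θ ^ 2 *
        Real.exp (-((p : ℝ) * (1 - p) * t * θ ^ 2 / 20)) := by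
  subst hst
  obtain ⟨k, rfl⟩ := Nat.exists_eq_add_of_le' hℓ
  have hlam0 : 0 ≤ lam := G.spectralExpansion_nonneg.trans hG
  have hq0 : 0 ≤ (p : ℝ) * (1 - p) := mul_nonneg p.2.1 (by linarith [p.2.2])
  obtain ⟨h1, h2⟩ := walkTransform_mul_I_bounds hlam hG hval hθ
  have h := norm_sub_prod_le_of_almost_multiplicative h1 h2 k s hs
  simp only [trigSum_labelSum (p := p)]
  rw [Finset.prod_mul_distrib, ← Complex.exp_sum]
  have e : ∑ i, (((θ * (p * (s i : ℕ)) : ℝ) : ℂ) * Complex.I) =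
      ((θ * (p * ((∑ i, s i : ℕ) : ℝ)) : ℝ) : ℂ) * Complex.I := by
    push_cast
    rw [← Finset.sum_mul, ← Finset.mul_sum, ← Finset.mul_sum]
  rw [e, ← mul_sub, norm_mul, Complex.norm_exp_ofReal_mul_I, one_mul]
  refine h.trans ?_
  rw [← Real.exp_nat_mul]
  have e2 : ((∑ i, s i : ℕ) : ℝ) * -((p : ℝ) * (1 - p) * θ ^ 2 / 20) =
      -((p : ℝ) * (1 - p) * ((∑ i, s i : ℕ) : ℝ) * θ ^ 2 / 20) := by ring
  rw [e2]
  have hk : (k : ℝ) ≤ ((k + 1 : ℕ) : ℝ) := by push_cast; linarith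
  calc _ ≤ ((k + 1 : ℕ) : ℝ) * (4 * lam * ((p : ℝ) * (1 - p)) * θ ^ 2 *
        Real.exp (-((p : ℝ) * (1 - p) * ((∑ i, s i : ℕ) : ℝ) * θ ^ 2 / 20))) := by
        gcongr
    _ = _ := by ring

end RegularDigraph

/-! ### Exponential tilting and tails relative to the binomial law -/

namespace RegularDigraph

variable {V : Type*} [Fintype V] [Nonempty V]

/-- Exponentially tilted point masses are bounded by the transforms. -/
lemma abs_labelSum_sub_binomial_le_of_transform (G : RegularDigraph V) (val : V → Fin 2)
    (p : unitInterval) (r B : ℝ) (t : ℕ)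
    (h : ∀ θ : ℝ, ‖G.walkTransform val p (r + θ * Complex.I) t -
      bernoulliTransform p (r + θ * Complex.I) ^ t‖ ≤ B) (j : ℤ) :
    |(G.labelSum val t).real {j} - ((binomial t p).map (Nat.cast : ℕ → ℤ)).real {j}| ≤
      B * Real.exp (-(r * (j - p * t))) := by
  set μ := G.labelSum val t
  set ν := (binomial t p).map (Nat.cast : ℕ → ℤ)
  let g : ℤ → ℝ := fun j => Real.exp (r * (j - p * t))
  let a : ℤ → ℝ := fun j => μ.real {j} * g j - ν.real {j} * g j
  have hμ : Summable fun j => μ.real {j} * g j :=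
    (hasSum_measureReal_smul (integrable_labelSum G val t g)).summable
  have hν : Summable fun j => ν.real {j} * g j :=
    (hasSum_measureReal_smul (integrable_map_cast_binomial g)).summable
  have ha : Summable a := hμ.sub hν
  have htilt : ∀ (κ : Measure ℤ) [IsProbabilityMeasure κ] (θ : ℝ),
      Integrable (fun j : ℤ => Complex.exp ((r + θ * Complex.I) * (j - (p : ℝ) * t))) κ →
      trigSum (fun j => κ.real {j} * g j) θ = Complex.exp ((θ * (p * t) : ℝ) * Complex.I) *
        ∫ j : ℤ, Complex.exp ((r + θ * Complex.I) * (j - (p : ℝ) * t)) ∂κ := by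
    intro κ _ θ hint
    rw [← (hasSum_measureReal_smul hint).tsum_eq, ← tsum_mul_left]
    refine tsum_congr fun j => ?_
    simp only [g, Complex.real_smul]
    rw [mul_left_comm, ← Complex.exp_add, Complex.ofReal_mul, Complex.ofReal_exp, mul_assoc,
      ← Complex.exp_add]
    congr 2
    push_cast
    ring
  -- The tilted difference is an integer sequence whose Fourier series is the difference of
  -- transforms on the line Re z = r. Inversion bounds its coefficients, and undoing the tilt yields
  -- the exponential factor.
  have hbound : ∀ θ : ℝ, ‖trigSum a θ‖ ≤ B := by
    intro θ
    rw [trigSum_sub hμ hν, htilt μ θ (integrable_labelSum G val t _),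
      htilt ν θ (integrable_map_cast_binomial _), ← mul_sub, norm_mul,
      Complex.norm_exp_ofReal_mul_I, one_mul, integral_cexp_map_cast_binomial]
    exact h θ
  have h1 := abs_coeff_le_of_norm_trigSum_le ha (g := fun _ => B) (by simp)
    (fun θ _ _ => hbound θ) j
  have h2 : (∫ _ in (-Real.pi)..Real.pi, B) / (2 * Real.pi) = B := by
    rw [intervalIntegral.integral_const, smul_eq_mul]
    field_simp
    ring
  rw [h2] at h1
  have h3 : a j = (μ.real {j} - ν.real {j}) * g j := by simp only [a]; ring
  rw [h3, abs_mul, abs_of_pos (Real.exp_pos _)] at h1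
  rw [Real.exp_neg, ← div_eq_mul_inv, le_div_iff₀ (Real.exp_pos _)]
  exact h1

end RegularDigraph

/-- Second moment of a tilted label. After exp(x) ≤ 1 + x + x² for |x| ≤ 1 the linear terms cancel
by centring, and 4p(1 - p) ≤ 1. -/
lemma sum_exp_sq_le {p r : ℝ} (hp0 : 0 ≤ p) (hp1 : p ≤ 1) (hr : |r| ≤ 1 / 2) :
    (1 - p) * Real.exp (-(r * p)) ^ 2 + p * Real.exp (r * (1 - p)) ^ 2 ≤ Real.exp (r ^ 2) := by
  have hr' := abs_le.1 hr
  have h1 : |-(2 * r * p)| ≤ 1 := by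
    rw [abs_neg, abs_mul, abs_mul, abs_of_nonneg hp0, abs_two]
    nlinarith [abs_nonneg r]
  have h2 : |2 * r * (1 - p)| ≤ 1 := by
    rw [abs_mul, abs_mul, abs_of_nonneg (by linarith : 0 ≤ 1 - p), abs_two]
    nlinarith [abs_nonneg r]
  have e1 : Real.exp (-(r * p)) ^ 2 = Real.exp (-(2 * r * p)) := by
    rw [← Real.exp_nat_mul]; congr 1; push_cast; ring
  have e2 : Real.exp (r * (1 - p)) ^ 2 = Real.exp (2 * r * (1 - p)) := by
    rw [← Real.exp_nat_mul]; congr 1; push_cast; ring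
  have h3 := (abs_le.1 (Real.abs_exp_sub_one_sub_id_le h1)).2
  have h4 := (abs_le.1 (Real.abs_exp_sub_one_sub_id_le h2)).2
  rw [e1, e2]
  have h5 := Real.add_one_le_exp (r ^ 2)
  have hq : p * (1 - p) ≤ 1 / 4 := by nlinarith [sq_nonneg (p - 1 / 2)]
  calc _ ≤ (1 - p) * (1 + -(2 * r * p) + (-(2 * r * p)) ^ 2) +
        p * (1 + 2 * r * (1 - p) + (2 * r * (1 - p)) ^ 2) := by
        gcongr <;> linarith
    _ = 1 + 4 * (p * (1 - p)) * r ^ 2 := by ring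
    _ ≤ 1 + 4 * (1 / 4) * r ^ 2 := by gcongr
    _ ≤ _ := by linarith

namespace RegularDigraph

variable {V : Type*} [Fintype V] [Nonempty V]
variable {p : unitInterval} {lam : ℝ} {G : RegularDigraph V} {val : V → Fin 2}
variable [DecidableEq V]

/-- Cutting into t single vertices leaves t - 1 cuts, each costing 4λε²ρ^t with ε² ≤ ρ² ≤ 9/4; each
single piece has exactly the Bernoulli transform. Keeping the factor λ is the point: separate tail
bounds for the two laws would lose it. -/
lemma norm_walkTransform_sub_pow_le (hlam : lam ≤ 1 / 100) (hG : G.IsSpectralExpander lam)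
    (hval : ∀ b : Fin 2,
      (Fintype.card {v : V // val v = b} : ℝ) / Fintype.card V = labelWeight p b) {r : ℝ}
    (hr : |r| ≤ 1 / 2) (θ : ℝ) {t : ℕ} (ht : 1 ≤ t) :
    ‖G.walkTransform val p (r + θ * Complex.I) t - bernoulliTransform p (r + θ * Complex.I) ^ t‖ ≤
      9 * lam * t * Real.exp (r ^ 2 / 2) ^ t := by
  have hlam0 : 0 ≤ lam := G.spectralExpansion_nonneg.trans hG
  have hp0 := p.2.1
  have hp1 := p.2.2
  set z : ℂ := r + θ * Complex.I
  have hzre : z.re = r := by simp [z]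
  have hh := sum_exp_sq_le hp0 hp1 hr
  have hnz : ‖bernoulliTransform p z‖ ≤
      (1 - p) * Real.exp (-(r * p)) + p * Real.exp (r * (1 - p)) := by
    unfold bernoulliTransform
    refine (norm_add_le _ _).trans (le_of_eq ?_)
    rw [norm_mul, norm_mul, Complex.norm_real, Complex.norm_real, Complex.norm_exp,
      Complex.norm_exp, Real.norm_of_nonneg hp0, Real.norm_of_nonneg (by linarith : 0 ≤ 1 - (p : ℝ))]
    simp [hzre]
  set A := ‖bernoulliTransform p z‖
  set x := Real.exp (-(r * p))
  set y := Real.exp (r * (1 - p))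
  set h := (1 - (p : ℝ)) * x ^ 2 + p * y ^ 2
  set ρ := Real.exp (r ^ 2 / 2)
  have hρ1 : 1 ≤ ρ := Real.one_le_exp (by positivity)
  have hρsq : Real.exp (r ^ 2) = ρ ^ 2 := by
    rw [← Real.exp_nat_mul]; congr 1; push_cast; ring
  have hr2 : r ^ 2 ≤ 1 / 4 := by
    rw [← sq_abs]; nlinarith [abs_nonneg r]
  have hρ2 : ρ ≤ 3 / 2 := by
    have h1 : r ^ 2 / 2 ≤ 1 / 8 := by linarith
    have h2 := Real.abs_exp_sub_one_sub_id_le (x := r ^ 2 / 2)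
      (by rw [abs_of_nonneg (by positivity)]; linarith)
    have := (abs_le.1 h2).2
    nlinarith [sq_nonneg r]
  have hA0 : 0 ≤ A := norm_nonneg _
  have hAh : A ^ 2 ≤ h := by
    calc A ^ 2 ≤ ((1 - p) * x + p * y) ^ 2 := by gcongr
      _ ≤ h := by
        have : 0 ≤ (p : ℝ) * (1 - p) := mul_nonneg hp0 (by linarith)
        nlinarith [mul_nonneg this (sq_nonneg (x - y))]
  rw [hρsq] at hh
  have hεsq : √(h - A ^ 2) ^ 2 = h - A ^ 2 := Real.sq_sqrt (by linarith)
  have hAρ : A ≤ ρ := abs_le_of_sq_le_sq (hAh.trans hh) (by linarith) |> (abs_le.1 · |>.2)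
  have hb := walkTransform_bounds (G := G) (z := z) (α := A) (ε := √(h - A ^ 2)) (β := 2) (ρ := ρ)
    hG hval (Real.sqrt_nonneg _) (by norm_num) le_rfl
    (by rw [hεsq, hzre])
    (fun b => by
      rw [Complex.norm_exp]
      have : (z * ((b : ℕ) - (p : ℝ))).re = r * ((b : ℕ) - p) := by
        simp [Complex.mul_re, hzre]
      rw [this]
      have hb : |((b : ℕ) : ℝ) - p| ≤ 1 := by
        fin_cases b <;> simp [abs_le] <;> constructor <;> linarith
      have h1 : r * ((b : ℕ) - p) ≤ 1 / 2 := by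
        refine (le_abs_self _).trans ?_
        rw [abs_mul]
        nlinarith [abs_nonneg r, abs_nonneg (((b : ℕ) : ℝ) - p)]
      have h2 : Real.exp (1 / 2) ^ 2 ≤ 2 ^ 2 := by
        rw [← Real.exp_nat_mul]
        norm_num
        linarith [Real.exp_one_lt_d9]
      exact (Real.exp_le_exp.2 h1).trans (abs_le_of_sq_le_sq h2 (by norm_num) |> (abs_le.1 · |>.2)))
    (by
      rw [hεsq]
      -- Since ρ² - A² = (ρ - A)(ρ + A) ≤ 3(ρ - A), the right side is below ρ - A. So ρ absorbs the
      -- feedback without a loss growing with t.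
      have h1 : 2 * lam * (h - A ^ 2) ≤ 1 / 50 * (ρ ^ 2 - A ^ 2) := by
        have : 0 ≤ h - A ^ 2 := by linarith
        nlinarith
      nlinarith)
    (by linarith)
  obtain ⟨k, rfl⟩ := Nat.exists_eq_add_of_le' ht
  have h1 := norm_sub_prod_le_of_almost_multiplicative hb.2.1 hb.2.2 k (fun _ => 1)
    (fun _ => le_rfl)
  simp only [Finset.sum_const, Finset.card_univ, Fintype.card_fin, smul_eq_mul, mul_one,
    Finset.prod_const, hb.1] at h1
  refine h1.trans ?_
  rw [hεsq]
  have h2 : 4 * lam * (h - A ^ 2) ≤ 9 * lam := by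
    have : h - A ^ 2 ≤ 9 / 4 := by nlinarith [sq_nonneg A]
    nlinarith
  have hk : (k : ℝ) ≤ ((k + 1 : ℕ) : ℝ) := by push_cast; linarith
  calc (k : ℝ) * (4 * lam * (h - A ^ 2) * ρ ^ (k + 1))
      ≤ ((k + 1 : ℕ) : ℝ) * (9 * lam * ρ ^ (k + 1)) := by gcongr
    _ = _ := by ring

/-- Exponential tails, linear in the expansion, for the difference to the binomial distribution. -/
lemma abs_labelSum_sub_binomial_le (hlam : lam ≤ 1 / 100) (hG : G.IsSpectralExpander lam)
    (hval : ∀ b : Fin 2,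
      (Fintype.card {v : V // val v = b} : ℝ) / Fintype.card V = labelWeight p b)
    {t : ℕ} (ht : 1 ≤ t) (j : ℤ) :
    |(G.labelSum val t).real {j} - ((binomial t p).map (Nat.cast : ℕ → ℤ)).real {j}| ≤
      16 * lam * t * Real.exp (-|(j : ℝ) - p * t| / (2 * √t)) := by
  have hlam0 : 0 ≤ lam := G.spectralExpansion_nonneg.trans hG
  have ht' : (1 : ℝ) ≤ t := by exact_mod_cast ht
  have hst : 1 ≤ √(t : ℝ) := Real.one_le_sqrt.2 ht'
  -- A tilt of size 1/(2√t) makes exp(tr²/2) the constant e^(1/8) ≤ 16/9, whence 9 · 16/9 = 16. The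
  -- sign of r is chosen according to the side of the mean.
  have key : ∀ r : ℝ, |r| = 1 / (2 * √t) →
      |(G.labelSum val t).real {j} - ((binomial t p).map (Nat.cast : ℕ → ℤ)).real {j}| ≤
        16 * lam * t * Real.exp (-(r * (j - p * t))) := by
    intro r hr
    have hr1 : |r| ≤ 1 / 2 := by
      rw [hr]
      exact one_div_le_one_div_of_le (by norm_num) (by linarith)
    refine abs_labelSum_sub_binomial_le_of_transform G val p r _ t (fun θ => ?_) j
    refine (norm_walkTransform_sub_pow_le hlam hG hval hr1 θ ht).trans ?_
    have h1 : Real.exp (r ^ 2 / 2) ^ t ≤ 16 / 9 := by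
      rw [← Real.exp_nat_mul]
      have h2 : (t : ℝ) * (r ^ 2 / 2) = 1 / 8 := by
        rw [← sq_abs, hr, div_pow, mul_pow, Real.sq_sqrt (by linarith)]
        field_simp
        norm_num
      rw [h2]
      have h3 := (abs_le.1 (Real.abs_exp_sub_one_sub_id_le (x := 1 / 8) (by norm_num))).2
      linarith
    calc 9 * lam * t * Real.exp (r ^ 2 / 2) ^ t ≤ 9 * lam * t * (16 / 9) := by gcongr
      _ = _ := by ring
  have hpos : 0 < 1 / (2 * √(t : ℝ)) := by positivity
  rcases le_total 0 ((j : ℝ) - p * t) with h | h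
  · convert key (1 / (2 * √t)) (abs_of_pos hpos) using 3
    rw [abs_of_nonneg h]
    ring
  · convert key (-(1 / (2 * √t))) (by rw [abs_neg, abs_of_pos hpos]) using 3
    rw [abs_of_nonpos h]
    ring

end RegularDigraph

/-! ### Linear growth of the variance -/

/-- A sequence whose increments converge geometrically grows linearly up to a bounded error. -/
lemma abs_sub_natCast_mul_le_of_increments {u γ : ℕ → ℝ} {q lam : ℝ} (hq : 0 ≤ q)
    (hlam0 : 0 ≤ lam) (hlam : lam ≤ 1 / 100) (hγ : ∀ i, |γ i| ≤ q * lam ^ (i + 1))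
    (h1 : u 1 = q) (hu : ∀ t, 1 ≤ t → u (t + 1) = u t + 2 * ∑ i ∈ Finset.range t, γ i + q)
    {t : ℕ} (ht : 1 ≤ t) : |u t - (q + 2 * ∑' i, γ i) * t| ≤ 3 * (q * lam) := by
  have hlam1 : lam < 1 := by linarith
  have hgeo : Summable fun i : ℕ => q * lam ^ (i + 1) :=
    (((summable_nat_add_iff 1).2 (summable_geometric_of_lt_one hlam0 hlam1))).mul_left q
  have hs : Summable γ := Summable.of_norm_bounded hgeo hγ
  have htail : ∀ t, |∑ i ∈ Finset.range t, γ i - ∑' i, γ i| ≤ q * lam ^ (t + 1) / (1 - lam) := by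
    intro t
    rw [← hs.sum_add_tsum_nat_add t, sub_add_cancel_left, abs_neg]
    have hg : HasSum (fun i : ℕ => q * lam ^ (t + 1) * lam ^ i) (q * lam ^ (t + 1) * (1 - lam)⁻¹) :=
      (hasSum_geometric_of_lt_one hlam0 hlam1).mul_left _
    refine tsum_of_norm_bounded (f := fun i => γ (i + t)) hg fun i => ?_
    refine (hγ _).trans (le_of_eq ?_)
    ring
  -- The tails of the series of γ are themselves geometric. This form sums them exactly, and (1 -
  -- λ)² ≥ 2/3 then gives the constant 3.
  have hmain : ∀ t, 1 ≤ t → |u t - (q + 2 * ∑' i, γ i) * t| ≤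
      2 * (q * lam) * (1 - lam ^ t) / (1 - lam) ^ 2 := by
    have h1lam : 0 < 1 - lam := by linarith
    intro t ht
    induction t, ht using Nat.le_induction with
    | base =>
      have h := htail 0
      simp only [Finset.range_zero, Finset.sum_empty, zero_sub, abs_neg, zero_add, pow_one] at h
      rw [h1]
      have e : q - (q + 2 * ∑' i, γ i) * (1 : ℕ) = -(2 * ∑' i, γ i) := by push_cast; ring
      rw [e, abs_neg, abs_mul, abs_two]
      calc _ ≤ 2 * (q * lam / (1 - lam)) := by gcongr
        _ = _ := by field_simp
    | succ t ht ih =>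
      have h := htail t
      rw [hu t ht]
      have e : u t + 2 * ∑ i ∈ Finset.range t, γ i + q - (q + 2 * ∑' i, γ i) * (t + 1 : ℕ) =
          (u t - (q + 2 * ∑' i, γ i) * t) + 2 * (∑ i ∈ Finset.range t, γ i - ∑' i, γ i) := by
        push_cast; ring
      rw [e]
      refine (abs_add_le _ _).trans ?_
      rw [abs_mul, abs_two]
      calc _ ≤ 2 * (q * lam) * (1 - lam ^ t) / (1 - lam) ^ 2 +
            2 * (q * lam ^ (t + 1) / (1 - lam)) := by gcongr
        _ = _ := by field_simp; ring
  refine (hmain t ht).trans ?_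
  have h0 : 0 ≤ lam ^ t := pow_nonneg hlam0 t
  have hql : 0 ≤ q * lam := mul_nonneg hq hlam0
  rw [div_le_iff₀ (by nlinarith)]
  have h2 : 2 / 3 ≤ (1 - lam) ^ 2 := by nlinarith
  calc 2 * (q * lam) * (1 - lam ^ t) ≤ 2 * (q * lam) * 1 := by
        gcongr
        linarith
    _ = 3 * (q * lam) * (2 / 3) := by ring
    _ ≤ _ := by gcongr

namespace RegularDigraph

variable {V : Type*} [Fintype V]

/-- Iterates of the walk matrix applied to a function. -/
noncomputable def walkIterate (G : RegularDigraph V) (f : V → ℝ) : ℕ → V → ℝ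
  | 0 => f
  | i + 1 => fun v => ∑ v', G.walkMatrix v v' * walkIterate G f i v'

lemma sum_walkIterate (G : RegularDigraph V) {f : V → ℝ} (hf : ∑ v, f v = 0) (i : ℕ) :
    ∑ v, G.walkIterate f i v = 0 := by
  induction i with
  | zero => exact hf
  | succ i ih =>
    simp only [walkIterate]
    rw [Finset.sum_comm]
    simp only [← Finset.sum_mul, sum_walkMatrix, one_mul, ih]

lemma norm_walkIterate_le [DecidableEq V] (G : RegularDigraph V) {lam : ℝ}
    (hG : G.IsSpectralExpander lam) {f : V → ℝ} (hf : ∑ v, f v = 0) (i : ℕ) :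
    ‖(WithLp.toLp 2 (G.walkIterate f i) : EuclideanSpace ℝ V)‖ ≤
      lam ^ i * ‖(WithLp.toLp 2 f : EuclideanSpace ℝ V)‖ := by
  have hlam0 : 0 ≤ lam := G.spectralExpansion_nonneg.trans hG
  induction i with
  | zero => simp [walkIterate]
  | succ i ih =>
    have h := G.norm_toEuclideanCLM_walkMatrix_le hG
      (WithLp.toLp 2 (G.walkIterate f i)) (G.sum_walkIterate hf i)
    rw [Matrix.toEuclideanCLM_toLp] at h
    refine h.trans ?_
    calc _ ≤ lam * (lam ^ i * ‖(WithLp.toLp 2 f : EuclideanSpace ℝ V)‖) := by gcongr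
      _ = _ := by ring

lemma abs_sum_mul_walkIterate_le [DecidableEq V] (G : RegularDigraph V) {lam : ℝ}
    (hG : G.IsSpectralExpander lam) {f : V → ℝ} (hf : ∑ v, f v = 0) (i : ℕ) :
    |∑ v, f v * G.walkIterate f i v| ≤ lam ^ i * ∑ v, f v ^ 2 := by
  set x : EuclideanSpace ℝ V := WithLp.toLp 2 f
  set y : EuclideanSpace ℝ V := WithLp.toLp 2 (G.walkIterate f i)
  have h1 : ∑ v, f v * G.walkIterate f i v = inner ℝ x y := by
    simp [x, y, PiLp.inner_apply, mul_comm]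
  have h2 : ∑ v, f v ^ 2 = ‖x‖ ^ 2 := by
    rw [EuclideanSpace.norm_sq_eq]
    simp [x]
  rw [h1, h2]
  calc |inner ℝ x y| ≤ ‖x‖ * ‖y‖ := abs_real_inner_le_norm _ _
    _ ≤ ‖x‖ * (lam ^ i * ‖x‖) := by
      gcongr
      exact G.norm_walkIterate_le hG hf i
    _ = _ := by ring

section CentredMoments

variable (G : RegularDigraph V) (val : V → Fin 2) (c : ℝ)

lemma walkMoment_const (k : ℕ) (x : ℝ) (v : V) :
    G.walkMoment val k (fun _ => x) v = (Fintype.card V : ℝ)⁻¹ * x := by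
  induction k generalizing v with
  | zero => rfl
  | succ k ih =>
    simp only [walkMoment, ih, smul_eq_mul]
    rw [← Finset.sum_mul, sum_walkMatrix_right, one_mul]

/-- The label seen i steps before the end contributes the i-th iterate of the walk matrix on the
centred label, evaluated at the endpoint. -/
lemma walkMoment_centred (k : ℕ) (v : V) :
    G.walkMoment val k (fun j => (j : ℝ) - c * (k + 1)) v = (Fintype.card V : ℝ)⁻¹ *
      ∑ i ∈ Finset.range (k + 1), G.walkIterate (fun v => ((val v : ℕ) : ℝ) - c) i v := by
  induction k generalizing v with
  | zero => simp [walkMoment, walkIterate]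
  | succ k ih =>
    have e : (fun j : ℤ => (((j + ((val v : ℕ) : ℤ) : ℤ) : ℝ) - c * (((k + 1 : ℕ) : ℝ) + 1))) =
        fun j : ℤ => ((j : ℝ) - c * (k + 1)) + (((val v : ℕ) : ℝ) - c) := by
      funext j
      push_cast
      ring
    rw [walkMoment, e]
    simp only [walkMoment_add, ih, walkMoment_const]
    simp only [smul_eq_mul, mul_add, Finset.sum_add_distrib]
    rw [← Finset.sum_mul, sum_walkMatrix_right, one_mul, Finset.sum_range_succ', mul_add]
    congr 1
    rw [Finset.mul_sum]
    simp only [walkIterate, Finset.mul_sum]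
    rw [Finset.sum_comm]
    refine Finset.sum_congr rfl fun i _ => Finset.sum_congr rfl fun v' _ => ?_
    ring

/-- Expanding the square around the last label. Summed over v, the cross terms become the
covariances of the last label with the earlier ones. -/
lemma walkMoment_centred_sq (k : ℕ) (v : V) :
    G.walkMoment val (k + 1) (fun j => ((j : ℝ) - c * (((k + 1 : ℕ) : ℝ) + 1)) ^ 2) v =
      ∑ v', G.walkMatrix v v' * G.walkMoment val k (fun j => ((j : ℝ) - c * (k + 1)) ^ 2) v' +
      (Fintype.card V : ℝ)⁻¹ * (2 * ∑ i ∈ Finset.range (k + 1), (((val v : ℕ) : ℝ) - c) *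
        G.walkIterate (fun v => ((val v : ℕ) : ℝ) - c) (i + 1) v) +
      (Fintype.card V : ℝ)⁻¹ * (((val v : ℕ) : ℝ) - c) ^ 2 := by
  have e : (fun j : ℤ => (((j + ((val v : ℕ) : ℤ) : ℤ) : ℝ) - c * (((k + 1 : ℕ) : ℝ) + 1)) ^ 2) =
      fun j : ℤ => ((j : ℝ) - c * (k + 1)) ^ 2 +
        ((2 * (((val v : ℕ) : ℝ) - c)) • ((j : ℝ) - c * (k + 1)) + (((val v : ℕ) : ℝ) - c) ^ 2) := by
    funext j
    rw [smul_eq_mul]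
    push_cast
    ring
  rw [walkMoment, e]
  simp only [walkMoment_add, walkMoment_smul, walkMoment_centred, walkMoment_const]
  simp only [smul_eq_mul, mul_add, Finset.sum_add_distrib]
  rw [← Finset.sum_mul, sum_walkMatrix_right, one_mul, ← add_assoc]
  congr 2
  simp only [walkIterate, Finset.mul_sum]
  rw [Finset.sum_comm]
  refine Finset.sum_congr rfl fun i _ => Finset.sum_congr rfl fun v' _ => ?_
  ring

end CentredMoments

variable [Nonempty V] {p : unitInterval} {lam : ℝ} {G : RegularDigraph V} {val : V → Fin 2}

lemma sum_label_sub (hval : ∀ b : Fin 2,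
    (Fintype.card {v : V // val v = b} : ℝ) / Fintype.card V = labelWeight p b) :
    ∑ v, (((val v : ℕ) : ℝ) - p) = 0 := by
  rw [sum_comp_label hval (fun b => ((b : ℕ) : ℝ) - p)]
  simp
  ring

lemma sum_label_sub_sq (hval : ∀ b : Fin 2,
    (Fintype.card {v : V // val v = b} : ℝ) / Fintype.card V = labelWeight p b) :
    ∑ v, (((val v : ℕ) : ℝ) - p) ^ 2 = Fintype.card V * ((p : ℝ) * (1 - p)) := by
  rw [sum_comp_label hval (fun b => (((b : ℕ) : ℝ) - p) ^ 2)]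
  simp
  ring

lemma integral_labelSum_sub (hval : ∀ b : Fin 2,
    (Fintype.card {v : V // val v = b} : ℝ) / Fintype.card V = labelWeight p b)
    {t : ℕ} (ht : 1 ≤ t) : ∫ j : ℤ, ((j : ℝ) - p * t) ∂(G.labelSum val t) = 0 := by
  obtain ⟨k, rfl⟩ := Nat.exists_eq_add_of_le' ht
  rw [integral_labelSum]
  push_cast
  simp only [walkMoment_centred]
  rw [← Finset.mul_sum, Finset.sum_comm]
  simp only [G.sum_walkIterate (sum_label_sub hval), Finset.sum_const_zero, mul_zero]

lemma integral_labelSum_id (hval : ∀ b : Fin 2,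
    (Fintype.card {v : V // val v = b} : ℝ) / Fintype.card V = labelWeight p b)
    {t : ℕ} (ht : 1 ≤ t) : ∫ j : ℤ, (j : ℝ) ∂(G.labelSum val t) = p * t := by
  have h := integral_labelSum_sub (G := G) hval ht
  rw [integral_sub (integrable_labelSum G val t _) (integrable_labelSum G val t _)] at h
  simp only [integral_const, probReal_univ, smul_eq_mul, one_mul] at h
  linarith

lemma intVariance_labelSum (hval : ∀ b : Fin 2,
    (Fintype.card {v : V // val v = b} : ℝ) / Fintype.card V = labelWeight p b)
    {t : ℕ} (ht : 1 ≤ t) :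
    intVariance (G.labelSum val t) = ∫ j : ℤ, ((j : ℝ) - p * t) ^ 2 ∂(G.labelSum val t) := by
  rw [intVariance, variance_eq_integral (StronglyMeasurable.of_discrete).measurable.aemeasurable,
    integral_labelSum_id hval ht]

lemma intVariance_labelSum_one (hval : ∀ b : Fin 2,
    (Fintype.card {v : V // val v = b} : ℝ) / Fintype.card V = labelWeight p b) :
    intVariance (G.labelSum val 1) = (p : ℝ) * (1 - p) := by
  have hn : (0 : ℝ) < Fintype.card V := by exact_mod_cast Fintype.card_pos
  rw [intVariance_labelSum hval le_rfl, integral_labelSum G val 0]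
  simp only [walkMoment, Nat.cast_one, mul_one, smul_eq_mul, Int.cast_natCast]
  rw [← Finset.mul_sum, sum_label_sub_sq hval, inv_mul_cancel_left₀ hn.ne']

variable [DecidableEq V]

/-- The limit is q plus twice the sum of the covariances at all positive lags. The covariance at lag
i is at most qλ^i, because the centred label is orthogonal to the constants. -/
lemma exists_asymptotic_variance (hlam : lam ≤ 1 / 100) (hG : G.IsSpectralExpander lam)
    (hval : ∀ b : Fin 2,
      (Fintype.card {v : V // val v = b} : ℝ) / Fintype.card V = labelWeight p b) :
    ∃ σsq : ℝ, ∀ t : ℕ, 1 ≤ t → |intVariance (G.labelSum val t) - σsq * t| ≤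
      3 * ((p : ℝ) * (1 - p) * lam) := by
  have hlam0 : 0 ≤ lam := G.spectralExpansion_nonneg.trans hG
  have hn : (0 : ℝ) < Fintype.card V := by exact_mod_cast Fintype.card_pos
  have hq0 : 0 ≤ (p : ℝ) * (1 - p) := mul_nonneg p.2.1 (by linarith [p.2.2])
  set f : V → ℝ := fun v => ((val v : ℕ) : ℝ) - p with hf
  have hf0 : ∑ v, f v = 0 := sum_label_sub hval
  have hf2 : ∑ v, f v ^ 2 = Fintype.card V * ((p : ℝ) * (1 - p)) := sum_label_sub_sq hval
  have hvar : ∀ k, intVariance (G.labelSum val (k + 1)) =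
      ∑ v, G.walkMoment val k (fun j => ((j : ℝ) - p * (k + 1)) ^ 2) v := by
    intro k
    rw [intVariance_labelSum hval (by omega), integral_labelSum]
    push_cast
    rfl
  refine ⟨(p : ℝ) * (1 - p) + 2 * ∑' i, (Fintype.card V : ℝ)⁻¹ *
    ∑ v, f v * G.walkIterate f (i + 1) v, fun t ht => ?_⟩
  refine abs_sub_natCast_mul_le_of_increments (u := fun t => intVariance (G.labelSum val t))
    hq0 hlam0 hlam (fun i => ?_) ?_ (fun t ht => ?_) ht
  · rw [abs_mul, abs_of_pos (inv_pos.2 hn)]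
    calc _ ≤ (Fintype.card V : ℝ)⁻¹ * (lam ^ (i + 1) * ∑ v, f v ^ 2) := by
          gcongr
          exact G.abs_sum_mul_walkIterate_le hG hf0 _
      _ = _ := by
          rw [hf2]
          field_simp
  · change intVariance (G.labelSum val (0 + 1)) = _
    rw [hvar 0]
    simp only [walkMoment, Nat.cast_zero, zero_add, mul_one, smul_eq_mul]
    rw [← Finset.mul_sum]
    have : ∑ v, ((((val v : ℕ) : ℤ) : ℝ) - p) ^ 2 = ∑ v, f v ^ 2 := by simp [hf]
    rw [this, hf2, inv_mul_cancel_left₀ hn.ne']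
  · obtain ⟨k, rfl⟩ := Nat.exists_eq_add_of_le' ht
    simp only [hvar, walkMoment_centred_sq, Finset.sum_add_distrib]
    congr 2
    · rw [Finset.sum_comm]
      simp only [← Finset.sum_mul, sum_walkMatrix, one_mul]
    · rw [← Finset.mul_sum, ← Finset.mul_sum, ← Finset.mul_sum, Finset.sum_comm]
      ring
    · rw [← Finset.mul_sum]
      change (Fintype.card V : ℝ)⁻¹ * ∑ v, f v ^ 2 = _
      rw [hf2, inv_mul_cancel_left₀ hn.ne']

/-- The asymptotic variance exists and linearises the variances up to a bounded error. -/
lemma tendsto_intVariance_div_and_bound (hlam : lam ≤ 1 / 100) (hG : G.IsSpectralExpander lam)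
    (hval : ∀ b : Fin 2,
      (Fintype.card {v : V // val v = b} : ℝ) / Fintype.card V = labelWeight p b) :
    Tendsto (fun t : ℕ => intVariance (G.labelSum val t) / t) atTop
      (𝓝 (asymptoticVariance (G.labelSum val))) ∧
    ∀ t : ℕ, 1 ≤ t →
      |intVariance (G.labelSum val t) - asymptoticVariance (G.labelSum val) * t| ≤
        3 * ((p : ℝ) * (1 - p) * lam) := by
  obtain ⟨σsq, h⟩ := exists_asymptotic_variance hlam hG hval
  set B := 3 * ((p : ℝ) * (1 - p) * lam)
  have hlim : Tendsto (fun t : ℕ => intVariance (G.labelSum val t) / t) atTop (𝓝 σsq) := by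
    rw [tendsto_iff_norm_sub_tendsto_zero]
    refine squeeze_zero' (Eventually.of_forall fun _ => norm_nonneg _) ?_
      (tendsto_const_div_atTop_nhds_zero_nat B)
    filter_upwards [eventually_ge_atTop 1] with t ht
    have ht' : (0 : ℝ) < t := by exact_mod_cast ht
    have e : intVariance (G.labelSum val t) / t - σsq =
        (intVariance (G.labelSum val t) - σsq * t) / t := by field_simp
    rw [e, norm_div, Real.norm_eq_abs, Real.norm_of_nonneg ht'.le]
    gcongr
    exact h t ht
  have hσ : asymptoticVariance (G.labelSum val) = σsq := hlim.limUnder_eq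
  rw [hσ]
  exact ⟨hlim, h⟩

end RegularDigraph

/-! ### Independent sums and telescoping of products -/

section IndependentSums

instance isProbabilityMeasure_indepSum {ℓ : ℕ} (μ : Fin ℓ → Measure ℤ)
    [∀ i, IsProbabilityMeasure (μ i)] : IsProbabilityMeasure (indepSum μ) :=
  Measure.isProbabilityMeasure_map (by fun_prop)

lemma trigSum_indepSum {ℓ : ℕ} (μ : Fin ℓ → Measure ℤ) [∀ i, IsProbabilityMeasure (μ i)] (θ : ℝ) :
    trigSum (fun j => (indepSum μ).real {j}) θ = ∏ i, trigSum (fun j => (μ i).real {j}) θ := by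
  simp only [trigSum_measureReal]
  rw [← integral_fintype_prod_eq_prod (fun _ (j : ℤ) => Complex.exp (θ * j * Complex.I)),
    indepSum, integral_map (by fun_prop) (StronglyMeasurable.of_discrete).aestronglyMeasurable]
  congr 1
  funext x
  rw [← Complex.exp_sum]
  congr 1
  push_cast
  rw [← Finset.sum_mul, ← Finset.mul_sum]

end IndependentSums

lemma tvDist_nonneg (μ ν : Measure ℤ) : 0 ≤ tvDist μ ν :=
  mul_nonneg (by norm_num) (tsum_nonneg fun _ => abs_nonneg _)

lemma tsum_abs_sub (μ ν : Measure ℤ) :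
    ∑' j : ℤ, |μ.real {j} - ν.real {j}| = 2 * tvDist μ ν := by
  rw [tvDist]
  ring

/-- Factors are exchanged one at a time. Writing the error of a factor as a multiple of its own
decay keeps the full exponential in every term. -/
lemma norm_prod_sub_prod_le {ι : Type*} (s : Finset ι) (x y : ι → ℂ) (u E : ι → ℝ)
    (hx : ∀ i ∈ s, ‖x i‖ ≤ Real.exp (-u i)) (hy : ∀ i ∈ s, ‖y i‖ ≤ Real.exp (-u i))
    (hxy : ∀ i ∈ s, ‖x i - y i‖ ≤ E i * Real.exp (-u i)) :
    ‖∏ i ∈ s, x i - ∏ i ∈ s, y i‖ ≤ (∑ i ∈ s, E i) * Real.exp (-∑ i ∈ s, u i) := by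
  classical
  induction s using Finset.induction_on with
  | empty => simp
  | insert a s ha ih =>
    have ih' := ih (fun i hi => hx i (Finset.mem_insert_of_mem hi))
      (fun i hi => hy i (Finset.mem_insert_of_mem hi))
      (fun i hi => hxy i (Finset.mem_insert_of_mem hi))
    have hP : ‖∏ i ∈ s, x i‖ ≤ Real.exp (-∑ i ∈ s, u i) := by
      rw [norm_prod, ← Finset.sum_neg_distrib, Real.exp_sum]
      exact Finset.prod_le_prod (fun _ _ => norm_nonneg _)
        fun i hi => hx i (Finset.mem_insert_of_mem hi)
    rw [Finset.prod_insert ha, Finset.prod_insert ha, Finset.sum_insert ha, Finset.sum_insert ha]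
    have e : x a * ∏ i ∈ s, x i - y a * ∏ i ∈ s, y i =
        (x a - y a) * ∏ i ∈ s, x i + y a * (∏ i ∈ s, x i - ∏ i ∈ s, y i) := by ring
    have hE : 0 ≤ E a * Real.exp (-u a) :=
      (norm_nonneg _).trans (hxy a (Finset.mem_insert_self _ _))
    rw [e, neg_add, Real.exp_add]
    calc _ ≤ E a * Real.exp (-u a) * Real.exp (-∑ i ∈ s, u i) +
          Real.exp (-u a) * ((∑ i ∈ s, E i) * Real.exp (-∑ i ∈ s, u i)) := by
          refine (norm_add_le _ _).trans ?_
          rw [norm_mul, norm_mul]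
          gcongr
          · exact hxy a (Finset.mem_insert_self _ _)
          · exact hy a (Finset.mem_insert_self _ _)
      _ = _ := by ring

/-! ### Comparable families: third moments and behaviour near frequency zero -/

/-- Two sequences `μ`, `ν` of distributions on the integers which have equal means, close
variances, close tails, Gaussian characteristic functions, and which are almost closed under
convolution. -/
structure ComparableFamilies (m q lam c₁ c₂ c₃ : ℝ) (μ ν : ℕ → Measure ℤ) : Prop where
  prob_left : ∀ t, IsProbabilityMeasure (μ t)
  prob_right : ∀ t, IsProbabilityMeasure (ν t)
  lam_nonneg : 0 ≤ lam
  q_pos : 0 < q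
  q_le : q ≤ 1 / 4
  c₁_nonneg : 0 ≤ c₁
  c₂_nonneg : 0 ≤ c₂
  c₃_nonneg : 0 ≤ c₃
  one : ∀ j, (μ 1).real {j} = (ν 1).real {j}
  fourier_left : ∀ t : ℕ, 1 ≤ t → ∀ θ, |θ| ≤ Real.pi →
    ‖trigSum (fun j => (μ t).real {j}) θ‖ ≤ Real.exp (-(q * t * θ ^ 2 / 20))
  fourier_right : ∀ t : ℕ, 1 ≤ t → ∀ θ, |θ| ≤ Real.pi →
    ‖trigSum (fun j => (ν t).real {j}) θ‖ ≤ Real.exp (-(q * t * θ ^ 2 / 20))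
  mult_left : ∀ t ℓ : ℕ, 1 ≤ ℓ → ∀ s : Fin ℓ → ℕ, (∀ i, 1 ≤ s i) → ∑ i, s i = t →
    ∀ θ, |θ| ≤ Real.pi → ‖trigSum (fun j => (μ t).real {j}) θ -
      ∏ i, trigSum (fun j => (μ (s i)).real {j}) θ‖ ≤
      4 * lam * ℓ * q * θ ^ 2 * Real.exp (-(q * t * θ ^ 2 / 20))
  conv_right : ∀ t : ℕ, 1 ≤ t → ∀ ℓ : ℕ, 1 ≤ ℓ → ℓ ≤ t → ∀ s : Fin ℓ → ℕ, (∀ i, 1 ≤ s i) →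
    ∑ i, s i = t → tvDist (indepSum fun i => ν (s i)) (ν t) ≤ 3 / 2 * c₂ * lam * (ℓ / t)
  tail : ∀ t : ℕ, 1 ≤ t → ∀ j : ℤ, |(μ t).real {j} - (ν t).real {j}| ≤
    lam * (16 * t + 6 * c₃) * Real.exp (-|(j : ℝ) - m * t| / (2 * √t))
  memLp_left : ∀ t : ℕ, 1 ≤ t → MemLp (fun j : ℤ => (j : ℝ)) 2 (μ t)
  memLp_right : ∀ t : ℕ, 1 ≤ t → MemLp (fun j : ℤ => (j : ℝ)) 2 (ν t)
  mean_left : ∀ t : ℕ, 1 ≤ t → ∫ j : ℤ, (j : ℝ) ∂(μ t) = m * t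
  mean_right : ∀ t : ℕ, 1 ≤ t → ∫ j : ℤ, (j : ℝ) ∂(ν t) = m * t
  variance : ∀ t : ℕ, 1 ≤ t → |intVariance (μ t) - intVariance (ν t)| ≤ 3 * q * lam * (1 + c₁)

lemma hasSum_centred_moments {μ : Measure ℤ} [IsProbabilityMeasure μ] {x : ℝ}
    (h : MemLp (fun j : ℤ => (j : ℝ)) 2 μ) (hx : ∫ j : ℤ, (j : ℝ) ∂μ = x) :
    HasSum (fun j : ℤ => ((j : ℝ) - x) * μ.real {j}) 0 ∧
      HasSum (fun j : ℤ => ((j : ℝ) - x) ^ 2 * μ.real {j}) (intVariance μ) := by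
  have h1 : Integrable (fun j : ℤ => (j : ℝ)) μ := h.integrable (by norm_num)
  have h2 : Integrable (fun j : ℤ => ((j : ℝ) - x) ^ 2) μ :=
    (h.sub (memLp_const x)).integrable_sq
  constructor
  · have := hasSum_measureReal_smul (h1.sub (integrable_const x))
    simp only [Pi.sub_apply, smul_eq_mul] at this
    rw [integral_sub h1 (integrable_const x), hx] at this
    simpa [mul_comm] using this
  · have := hasSum_measureReal_smul h2
    rw [intVariance, variance_eq_integral
      (StronglyMeasurable.of_discrete).measurable.aemeasurable, hx]
    simpa only [smul_eq_mul, mul_comm] using this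

/-- Beyond the threshold x/(4√t) ≥ 4(1 + log t), so half of the decay is worth t⁻⁴. This beats the
polynomial prefactor of the tails and fixes the window width used below. -/
lemma exp_neg_half_le_of_large {t : ℕ} (ht : 1 ≤ t) {x : ℝ}
    (hx : 16 * √t * (1 + Real.log t) ≤ x) :
    Real.exp (-x / (2 * √t)) ≤ ((t : ℝ) ^ 4)⁻¹ * Real.exp (-x / (4 * √t)) := by
  have ht0 : (0 : ℝ) < t := by exact_mod_cast ht
  have hs : 0 < √(t : ℝ) := Real.sqrt_pos.2 ht0
  have e1 : ((t : ℝ) ^ 4)⁻¹ = Real.exp (-(4 * Real.log t)) := by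
    rw [Real.exp_neg, show 4 * Real.log t = ((4 : ℕ) : ℝ) * Real.log t by norm_num,
      Real.exp_nat_mul, Real.exp_log ht0]
  rw [e1, ← Real.exp_add, Real.exp_le_exp]
  have h1 : 4 * (1 + Real.log t) ≤ x / (4 * √t) := by
    rw [le_div_iff₀ (by positivity)]
    linarith
  have e2 : -x / (2 * √t) = -(x / (4 * √t)) + -x / (4 * √t) := by field_simp; ring
  rw [e2]
  linarith

/-- From y³/3! ≤ exp(y) at y = x/(8√t); the constant is 6 · 8³. -/
lemma cube_mul_exp_neg_le {t : ℕ} (ht : 1 ≤ t) {x : ℝ} (hx : 0 ≤ x) :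
    x ^ 3 * Real.exp (-x / (4 * √t)) ≤ 3072 * √t ^ 3 * Real.exp (-x / (8 * √t)) := by
  have ht0 : (0 : ℝ) < t := by exact_mod_cast ht
  have hs : 0 < √(t : ℝ) := Real.sqrt_pos.2 ht0
  have h := Real.pow_div_factorial_le_exp (x / (8 * √t)) (by positivity) 3
  have e : Real.exp (-x / (4 * √t)) = (Real.exp (x / (8 * √t)))⁻¹ * Real.exp (-x / (8 * √t)) := by
    rw [← Real.exp_neg, ← Real.exp_add]
    congr 1
    field_simp
    ring
  rw [e, ← mul_assoc]
  refine mul_le_mul_of_nonneg_right ?_ (Real.exp_pos _).le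
  rw [← div_eq_mul_inv, div_le_iff₀ (Real.exp_pos _)]
  calc x ^ 3 = 3072 * √t ^ 3 * ((x / (8 * √t)) ^ 3 / (Nat.factorial 3)) := by
        simp only [Nat.factorial]
        field_simp
        ring
    _ ≤ _ := by gcongr

namespace ComparableFamilies

variable {m q lam c₁ c₂ c₃ : ℝ} {μ ν : ℕ → Measure ℤ}

lemma summable_sub (h : ComparableFamilies m q lam c₁ c₂ c₃ μ ν) (t : ℕ) :
    Summable fun j => (μ t).real {j} - (ν t).real {j} := by
  have := h.prob_left t
  have := h.prob_right t
  exact (summable_measureReal_singleton _).sub (summable_measureReal_singleton _)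

/-- The third absolute moment of the difference. -/
lemma third_moment (h : ComparableFamilies m q lam c₁ c₂ c₃ μ ν) {s : ℕ} (hs : 1 ≤ s) {L R : ℝ}
    (hL : 1 + Real.log s ≤ L) (hR : 1 ≤ R) (hD : tvDist (μ s) (ν s) ≤ lam / √s * R) :
    (Summable fun j : ℤ => |(j : ℝ) - m * s| ^ 3 * |(μ s).real {j} - (ν s).real {j}|) ∧
      ∑' j : ℤ, |(j : ℝ) - m * s| ^ 3 * |(μ s).real {j} - (ν s).real {j}| ≤
        lam * s * (2 ^ 24 * (1 + c₃) * L ^ 3 * R) := by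
  have hs1 : (1 : ℝ) ≤ s := by exact_mod_cast hs
  have hs0 : (0 : ℝ) < s := by linarith
  have hlog : 0 ≤ Real.log s := Real.log_nonneg hs1
  have hq1 : 1 ≤ √(s : ℝ) := Real.one_le_sqrt.2 hs1
  have hsq : √(s : ℝ) ^ 2 = s := Real.sq_sqrt hs0.le
  have hlam := h.lam_nonneg
  have hc₃ := h.c₃_nonneg
  set r := √(s : ℝ)
  set w := 16 * r * (1 + Real.log s)
  have hw0 : 0 ≤ w := by positivity
  set e : ℤ → ℝ := fun j => (μ s).real {j} - (ν s).real {j}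
  have he : Summable e := h.summable_sub s
  obtain ⟨hexp, hexp'⟩ := summable_and_tsum_exp_neg_abs_sub_le (m * s) (τ := 8 * r) (by linarith)
  set C := lam * (16 * s + 6 * c₃) * ((s : ℝ) ^ 4)⁻¹ * (3072 * r ^ 3)
  have hC0 : 0 ≤ C := by positivity
  -- Within distance w the cube is at most w³ and the total variation bound takes over; farther out
  -- the tails absorb the cube.
  have hpt : ∀ j : ℤ, |(j : ℝ) - m * s| ^ 3 * |e j| ≤
      w ^ 3 * |e j| + C * Real.exp (-|(j : ℝ) - m * s| / (8 * r)) := by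
    intro j
    set x := |(j : ℝ) - m * s|
    have hx0 : 0 ≤ x := abs_nonneg _
    rcases le_total x w with hxw | hxw
    · have : x ^ 3 * |e j| ≤ w ^ 3 * |e j| := by gcongr
      have : 0 ≤ C * Real.exp (-x / (8 * r)) := by positivity
      linarith
    · have h1 : |e j| ≤ lam * (16 * s + 6 * c₃) * (((s : ℝ) ^ 4)⁻¹ * Real.exp (-x / (4 * r))) := by
        refine (h.tail s hs j).trans ?_
        gcongr
        exact exp_neg_half_le_of_large hs hxw
      have h2 := cube_mul_exp_neg_le hs hx0
      have h3 : 0 ≤ w ^ 3 * |e j| := by positivity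
      calc x ^ 3 * |e j| ≤
            x ^ 3 * (lam * (16 * s + 6 * c₃) * (((s : ℝ) ^ 4)⁻¹ * Real.exp (-x / (4 * r)))) := by
            gcongr
        _ = lam * (16 * s + 6 * c₃) * ((s : ℝ) ^ 4)⁻¹ * (x ^ 3 * Real.exp (-x / (4 * r))) := by
            ring
        _ ≤ lam * (16 * s + 6 * c₃) * ((s : ℝ) ^ 4)⁻¹ *
            (3072 * r ^ 3 * Real.exp (-x / (8 * r))) := by gcongr
        _ = C * Real.exp (-x / (8 * r)) := by ring
        _ ≤ _ := by linarith
  have hb : Summable fun j : ℤ => w ^ 3 * |e j| + C * Real.exp (-|(j : ℝ) - m * s| / (8 * r)) :=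
    (he.abs.mul_left _).add (hexp.mul_left _)
  have hsum : Summable fun j : ℤ => |(j : ℝ) - m * s| ^ 3 * |e j| :=
    Summable.of_nonneg_of_le (fun j => by positivity) hpt hb
  refine ⟨hsum, (hsum.tsum_le_tsum hpt hb).trans ?_⟩
  rw [(he.abs.mul_left _).tsum_add (hexp.mul_left _), tsum_mul_left, tsum_mul_left,
    tsum_abs_sub (μ s) (ν s)]
  have hwL : w ≤ 16 * r * L := by
    simp only [w]
    gcongr
  have hL1 : 1 ≤ L := by linarith
  have hL3 : 1 ≤ L ^ 3 := one_le_pow₀ hL1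
  have hfirst : w ^ 3 * (2 * tvDist (μ s) (ν s)) ≤ lam * s * (8192 * L ^ 3 * R) := by
    calc _ ≤ (16 * r * L) ^ 3 * (2 * (lam / r * R)) := by
          have := tvDist_nonneg (μ s) (ν s)
          gcongr
      _ = lam * r ^ 2 * (8192 * L ^ 3 * R) := by field_simp; ring
      _ = _ := by rw [hsq]
  have hsecond : C * ∑' j : ℤ, Real.exp (-|(j : ℝ) - m * s| / (8 * r)) ≤
      lam * s * (2 ^ 23 * (1 + c₃)) := by
    have h1 : (s : ℝ) ^ 4 = r ^ 8 := by rw [← hsq]; ring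
    have h2 : 16 * (s : ℝ) + 6 * c₃ ≤ 16 * (1 + c₃) * s := by nlinarith [mul_nonneg hc₃ hs0.le]
    have hr3 : 1 ≤ r ^ 4 := one_le_pow₀ hq1
    calc _ ≤ lam * (16 * (1 + c₃) * s) * ((s : ℝ) ^ 4)⁻¹ * (3072 * r ^ 3) * (12 * (8 * r)) := by
          simp only [C]
          gcongr
      _ = lam * s * (4718592 * (1 + c₃) * (r ^ 4)⁻¹) := by
          rw [h1]
          field_simp
          ring
      _ ≤ lam * s * (4718592 * (1 + c₃) * 1) := by
          gcongr
          exact inv_le_one_of_one_le₀ hr3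
      _ ≤ _ := mul_le_mul_of_nonneg_left (by linarith) (by positivity)
  have hLR : 1 ≤ L ^ 3 * R := one_le_mul_of_one_le_of_one_le hL3 hR
  calc _ ≤ lam * s * (8192 * L ^ 3 * R) + lam * s * (2 ^ 23 * (1 + c₃)) := add_le_add hfirst hsecond
    _ = lam * s * (8192 * (1 * (L ^ 3 * R)) + 2 ^ 23 * ((1 + c₃) * 1)) := by ring
    _ ≤ lam * s * (8192 * ((1 + c₃) * (L ^ 3 * R)) + 2 ^ 23 * ((1 + c₃) * (L ^ 3 * R))) := by
        gcongr
        linarith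
    _ = lam * s * ((8192 + 2 ^ 23) * ((1 + c₃) * (L ^ 3 * R))) := by ring
    _ ≤ lam * s * (2 ^ 24 * ((1 + c₃) * (L ^ 3 * R))) := by
        gcongr
        norm_num
    _ = _ := by ring

/-- The characteristic functions of the two families are close near zero. -/
lemma norm_trigSum_sub_le (h : ComparableFamilies m q lam c₁ c₂ c₃ μ ν) {s : ℕ} (hs : 1 ≤ s)
    {L R : ℝ} (hL : 1 + Real.log s ≤ L) (hR : 1 ≤ R)
    (hD : tvDist (μ s) (ν s) ≤ lam / √s * R) (θ : ℝ) :
    ‖trigSum (fun j => (μ s).real {j}) θ - trigSum (fun j => (ν s).real {j}) θ‖ ≤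
      lam * (2 * q * (1 + c₁) * θ ^ 2 + s * (2 ^ 26 * (1 + c₃) * L ^ 3 * R) * |θ| ^ 3) := by
  have := h.prob_left s
  have := h.prob_right s
  have hlam := h.lam_nonneg
  have hq := h.q_pos
  have hc₁ := h.c₁_nonneg
  obtain ⟨h3, h3'⟩ := h.third_moment hs hL hR hD
  obtain ⟨a1, a2⟩ := hasSum_centred_moments (h.memLp_left s hs) (h.mean_left s hs)
  obtain ⟨b1, b2⟩ := hasSum_centred_moments (h.memLp_right s hs) (h.mean_right s hs)
  rw [← trigSum_sub (summable_measureReal_singleton _) (summable_measureReal_singleton _)]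
  have H := norm_trigSum_le_of_moments (a := fun j => (μ s).real {j} - (ν s).real {j}) (m := m * s)
    (A₂ := 3 * q * lam * (1 + c₁))
    (by simpa using (hasSum_measureReal_singleton (μ s)).sub (hasSum_measureReal_singleton (ν s)))
    (by simpa only [mul_sub, sub_zero] using a1.sub b1)
    (by simpa only [mul_sub] using a2.sub b2)
    (h.variance s hs) h3 h3' θ
  refine H.trans ?_
  have : 0 ≤ lam * q * (1 + c₁) * θ ^ 2 := by positivity
  linarith

end ComparableFamilies

/-! ### The step from times of order `√t` to time `t` -/

/-- A positive integer `t` is a sum of about `√t` integers of size about `√t`. -/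
lemma exists_balanced_partition {t : ℕ} (ht : 1 ≤ t) :
    ∃ ℓ : ℕ, 1 ≤ ℓ ∧ ℓ ≤ t ∧ (ℓ : ℝ) ≤ √t ∧ ∃ s : Fin ℓ → ℕ, (∀ i, 1 ≤ s i) ∧
      (∀ i, (s i : ℝ) ≤ 3 * √t) ∧ ∑ i, s i = t := by
  have hn : 1 ≤ Nat.sqrt t := by rw [Nat.le_sqrt]; omega
  have h1 := Nat.sqrt_le t
  have h2 := Nat.sqrt_le_add t
  have hle : (Nat.sqrt t : ℝ) ≤ √t := Real.nat_sqrt_le_real_sqrt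
  obtain ⟨k, hk⟩ := Nat.exists_eq_add_of_le' hn
  rw [hk] at h1 h2 hle
  -- With k + 1 the integer square root of t, take k pieces of length k + 1 and one piece for the
  -- remainder. From (k+1)² ≤ t ≤ (k+1)² + 2(k+1) the remainder is at least k + 1 and at most
  -- 3(k+1).
  have hx : 1 ≤ t - k * (k + 1) ∧ t - k * (k + 1) ≤ 3 * (k + 1) ∧
      t - k * (k + 1) + k * (k + 1) = t := by
    have e : (k + 1) * (k + 1) = k * (k + 1) + (k + 1) := by ring
    rw [e] at h1 h2
    omega
  refine ⟨k + 1, by omega, by nlinarith, hle, Fin.cons (t - k * (k + 1)) (fun _ => k + 1), ?_, ?_, ?_⟩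
  · intro i
    refine Fin.cases ?_ (fun j => ?_) i
    · exact hx.1
    · simp
  · intro i
    refine Fin.cases ?_ (fun j => ?_) i
    · rw [Fin.cons_zero]
      calc ((t - k * (k + 1) : ℕ) : ℝ) ≤ ((3 * (k + 1) : ℕ) : ℝ) := by exact_mod_cast hx.2.1
        _ = 3 * ((k + 1 : ℕ) : ℝ) := by push_cast; ring
        _ ≤ _ := by gcongr
    · rw [Fin.cons_succ]
      linarith [Real.sqrt_nonneg (t : ℝ)]
  · rw [Fin.sum_univ_succ]
    simpa using hx.2.2

namespace ComparableFamilies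

variable {m q lam c₁ c₂ c₃ : ℝ} {μ ν : ℕ → Measure ℤ}

/-- Comparison of the characteristic functions after splitting into independent pieces. -/
lemma norm_trigSum_sub_indepSum_le (h : ComparableFamilies m q lam c₁ c₂ c₃ μ ν) {t : ℕ}
    (ht : 36 ≤ t) {ℓ : ℕ} (hℓ : 1 ≤ ℓ) (hℓt : (ℓ : ℝ) ≤ √t) {s : Fin ℓ → ℕ}
    (hs : ∀ i, 1 ≤ s i) (hs3 : ∀ i, (s i : ℝ) ≤ 3 * √t) (hsum : ∑ i, s i = t) {L R : ℝ}
    (hL : 1 + Real.log t ≤ L) (hR : 1 ≤ R)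
    (hD : ∀ i, tvDist (μ (s i)) (ν (s i)) ≤ lam / √(s i) * R) {θ : ℝ} (hθ : |θ| ≤ Real.pi) :
    ‖trigSum (fun j => (μ t).real {j}) θ -
      trigSum (fun j => (indepSum fun i => ν (s i)).real {j}) θ‖ ≤
      lam * (1 + c₁) * (|θ| * Real.exp (-(q * t / 40) * θ ^ 2)) +
      lam * (1 + c₁ + 2 ^ 26 * (1 + c₃) * L ^ 3 * R) * t *
        (|θ| ^ 3 * Real.exp (-(q * t / 40) * θ ^ 2)) := by
  have := h.prob_right
  have hlam := h.lam_nonneg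
  have hq := h.q_pos
  have hq4 := h.q_le
  have hc₁ := h.c₁_nonneg
  have hc₃ := h.c₃_nonneg
  have ht36 : (36 : ℝ) ≤ t := by exact_mod_cast ht
  have ht0 : (0 : ℝ) < t := by linarith
  have hsq : √(t : ℝ) ^ 2 = t := Real.sq_sqrt ht0.le
  have h6 : 6 ≤ √(t : ℝ) := Real.le_sqrt_of_sq_le (by linarith)
  -- No piece exceeds half of t; this uses √t ≥ 6. The bound for an exchanged piece has no decay, so
  -- the other pieces must supply at least half of the Gaussian exponent.
  have hst : ∀ i, (s i : ℝ) ≤ t / 2 := fun i => (hs3 i).trans (by nlinarith)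
  have hsumR : ∑ i, (s i : ℝ) = t := by rw [← hsum]; push_cast; rfl
  set Q := 2 ^ 26 * (1 + c₃) * L ^ 3 * R
  set E := Real.exp (-(q * t / 40) * θ ^ 2) with hE
  have hE0 : 0 ≤ E := (Real.exp_pos _).le
  rw [trigSum_indepSum]
  set d : Fin ℓ → ℝ := fun i => lam * (2 * q * (1 + c₁) * θ ^ 2 + s i * Q * |θ| ^ 3)
  have hQ0 : 0 ≤ Q := by
    have : 0 ≤ L := by linarith [Real.log_nonneg (by linarith : (1 : ℝ) ≤ t)]
    positivity
  have hd0 : ∀ i, 0 ≤ d i := fun i => by positivity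
  have hdiff : ∀ i, ‖trigSum (fun j => (μ (s i)).real {j}) θ -
      trigSum (fun j => (ν (s i)).real {j}) θ‖ ≤ d i := by
    intro i
    refine h.norm_trigSum_sub_le (hs i) (le_trans ?_ hL) hR (hD i) θ
    have h1 : (1 : ℝ) ≤ s i := by exact_mod_cast hs i
    have h2 : (s i : ℝ) ≤ t := (hst i).trans (by linarith)
    gcongr
  have hprod := norm_prod_sub_prod_le Finset.univ
    (fun i => trigSum (fun j => (μ (s i)).real {j}) θ)
    (fun i => trigSum (fun j => (ν (s i)).real {j}) θ) (fun i => q * s i * θ ^ 2 / 20)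
    (fun i => d i * Real.exp (q * s i * θ ^ 2 / 20))
    (fun i _ => h.fourier_left _ (hs i) θ hθ) (fun i _ => h.fourier_right _ (hs i) θ hθ)
    (fun i _ => by
      rw [mul_assoc, ← Real.exp_add, add_neg_cancel, Real.exp_zero, mul_one]
      exact hdiff i)
  have hU : ∑ i, q * s i * θ ^ 2 / 20 = q * t * θ ^ 2 / 20 := by
    rw [← Finset.sum_div, ← Finset.sum_mul, ← Finset.mul_sum, hsumR]
  rw [hU, Finset.sum_mul] at hprod
  have hprod' : ‖∏ i, trigSum (fun j => (μ (s i)).real {j}) θ -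
      ∏ i, trigSum (fun j => (ν (s i)).real {j}) θ‖ ≤ ∑ i, d i * E := by
    refine hprod.trans (Finset.sum_le_sum fun i _ => ?_)
    rw [mul_assoc, ← Real.exp_add, hE]
    refine mul_le_mul_of_nonneg_left (Real.exp_le_exp.2 ?_) (hd0 i)
    have h1 : q * θ ^ 2 * s i ≤ q * θ ^ 2 * (t / 2) := by
      gcongr
      exact hst i
    linarith
  have hmult := h.mult_left t ℓ hℓ s hs hsum θ hθ
  have hEE : Real.exp (-(q * t * θ ^ 2 / 20)) ≤ E := by
    rw [hE, Real.exp_le_exp]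
    have : 0 ≤ q * t * θ ^ 2 := by positivity
    linarith
  have hdsum : ∑ i, d i = lam * (2 * q * (1 + c₁) * ℓ * θ ^ 2 + t * Q * |θ| ^ 3) := by
    simp only [d]
    rw [← Finset.mul_sum, Finset.sum_add_distrib, Finset.sum_const, Finset.card_univ,
      Fintype.card_fin, nsmul_eq_mul, ← Finset.sum_mul, ← Finset.sum_mul, hsumR]
    ring
  -- Arithmetic-geometric mean with ℓ ≤ √t. It trades θ² for |θ| and t|θ|³, both of which integrate
  -- to order 1/t against the Gaussian.
  have hAM : ℓ * θ ^ 2 ≤ (|θ| + t * |θ| ^ 3) / 2 := by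
    have h1 : 0 ≤ |θ| * (1 - √t * |θ|) ^ 2 := by positivity
    have h2 : √t * |θ| ^ 2 ≤ (|θ| + √t ^ 2 * |θ| ^ 3) / 2 := by nlinarith
    rw [hsq, sq_abs] at h2
    refine le_trans ?_ h2
    gcongr
  calc _ ≤ 4 * lam * ℓ * q * θ ^ 2 * E + ∑ i, d i * E := by
        have e : trigSum (fun j => (μ t).real {j}) θ -
          ∏ i, trigSum (fun j => (ν (s i)).real {j}) θ =
          (trigSum (fun j => (μ t).real {j}) θ -
            ∏ i, trigSum (fun j => (μ (s i)).real {j}) θ) +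
          (∏ i, trigSum (fun j => (μ (s i)).real {j}) θ -
            ∏ i, trigSum (fun j => (ν (s i)).real {j}) θ) := by ring
        rw [e]
        refine (norm_add_le _ _).trans (add_le_add (hmult.trans ?_) hprod')
        gcongr
    _ = lam * E * ((4 * q + 2 * q * (1 + c₁)) * (ℓ * θ ^ 2) + t * Q * |θ| ^ 3) := by
        rw [← Finset.sum_mul, hdsum]
        ring
    _ ≤ lam * E * ((2 * (1 + c₁)) * ((|θ| + t * |θ| ^ 3) / 2) + t * Q * |θ| ^ 3) := by
        gcongr
        nlinarith
    _ = _ := by ring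

/-- Pointwise comparison after splitting into independent pieces. -/
lemma abs_sub_indepSum_le (h : ComparableFamilies m q lam c₁ c₂ c₃ μ ν) {t : ℕ}
    (ht : 36 ≤ t) {ℓ : ℕ} (hℓ : 1 ≤ ℓ) (hℓt : (ℓ : ℝ) ≤ √t) {s : Fin ℓ → ℕ}
    (hs : ∀ i, 1 ≤ s i) (hs3 : ∀ i, (s i : ℝ) ≤ 3 * √t) (hsum : ∑ i, s i = t) {L R : ℝ}
    (hL : 1 + Real.log t ≤ L) (hR : 1 ≤ R)
    (hD : ∀ i, tvDist (μ (s i)) (ν (s i)) ≤ lam / √(s i) * R) (j : ℤ) :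
    |(μ t).real {j} - (indepSum fun i => ν (s i)).real {j}| ≤
      lam / t * (2 ^ 37 * ((1 + c₁ + c₃) / q ^ 2) * L ^ 3 * R) := by
  have := h.prob_right
  have := h.prob_left t
  have hlam := h.lam_nonneg
  have hq := h.q_pos
  have hq4 := h.q_le
  have hc₁ := h.c₁_nonneg
  have hc₃ := h.c₃_nonneg
  have ht0 : (0 : ℝ) < t := by
    have : (36 : ℝ) ≤ t := by exact_mod_cast ht
    linarith
  have hL1 : 1 ≤ L := by
    have : (1 : ℝ) ≤ t := by exact_mod_cast (by omega : 1 ≤ t)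
    linarith [Real.log_nonneg this]
  have hc : 0 < q * t / 40 := by positivity
  set c := q * t / 40 with hcdef
  set Q := 2 ^ 26 * (1 + c₃) * L ^ 3 * R with hQ
  have hQ0 : 0 ≤ Q := by positivity
  have hpi := Real.pi_pos
  have H := abs_coeff_le_of_norm_trigSum_le
    (a := fun j => (μ t).real {j} - (indepSum fun i => ν (s i)).real {j})
    (g := fun θ => lam * (1 + c₁) * (|θ| * Real.exp (-c * θ ^ 2)) +
      lam * (1 + c₁ + Q) * t * (|θ| ^ 3 * Real.exp (-c * θ ^ 2)))
    ((summable_measureReal_singleton _).sub (summable_measureReal_singleton _))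
    (Continuous.intervalIntegrable (by fun_prop) _ _)
    (fun θ h1 h2 => by
      rw [trigSum_sub (summable_measureReal_singleton _) (summable_measureReal_singleton _)]
      exact h.norm_trigSum_sub_indepSum_le ht hℓ hℓt hs hs3 hsum hL hR hD (abs_le.2 ⟨h1, h2⟩)) j
  refine H.trans ?_
  rw [intervalIntegral.integral_add (Continuous.intervalIntegrable (by fun_prop) _ _)
    (Continuous.intervalIntegrable (by fun_prop) _ _), intervalIntegral.integral_const_mul,
    intervalIntegral.integral_const_mul]
  have I1 := intervalIntegral_abs_mul_exp_neg_sq_le hc hpi.le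
  have I3 := intervalIntegral_abs_cube_mul_exp_neg_sq_le hc hpi.le
  have hLR : 1 ≤ L ^ 3 * R := one_le_mul_of_one_le_of_one_le (one_le_pow₀ hL1) hR
  rw [div_le_iff₀ (by positivity)]
  calc _ ≤ lam * (1 + c₁) * (1 / c) + lam * (1 + c₁ + Q) * t * (1 / c ^ 2) := by gcongr
    _ = lam / t * ((40 * q * (1 + c₁) + 1600 * (1 + c₁ + Q)) / q ^ 2) := by
        rw [hcdef]
        field_simp
        ring
    _ ≤ lam / t * ((2 ^ 37 * (1 + c₁ + c₃) * (L ^ 3 * R)) / q ^ 2) := by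
        gcongr
        have e : Q = 2 ^ 26 * ((1 + c₃) * (L ^ 3 * R)) := by rw [hQ]; ring
        have h1 : (1 + c₁) * 1 ≤ (1 + c₁ + c₃) * (L ^ 3 * R) :=
          mul_le_mul (by linarith) hLR (by norm_num) (by linarith)
        have h2 : (1 + c₃) * (L ^ 3 * R) ≤ (1 + c₁ + c₃) * (L ^ 3 * R) :=
          mul_le_mul_of_nonneg_right (by linarith) (by linarith)
        have h3 : q * (1 + c₁) ≤ 1 / 4 * (1 + c₁) := by gcongr
        rw [e]
        linarith
    _ = lam / t * (2 ^ 37 * ((1 + c₁ + c₃) / q ^ 2) * L ^ 3 * R) * 1 := by ring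
    _ ≤ _ := by
        gcongr
        linarith [Real.pi_gt_three]

/-- A total variation bound from a pointwise comparison with a sum of independent pieces. -/
lemma tvDist_le_of_pointwise (h : ComparableFamilies m q lam c₁ c₂ c₃ μ ν) {t ℓ : ℕ}
    (hℓ : 1 ≤ ℓ) (hℓt : ℓ ≤ t) {s : Fin ℓ → ℕ} (hs : ∀ i, 1 ≤ s i) (hsum : ∑ i, s i = t) {B : ℝ}
    (hB : ∀ j : ℤ, |(μ t).real {j} - (indepSum fun i => ν (s i)).real {j}| ≤ B) :
    2 * tvDist (μ t) (ν t) ≤ 33 * (√t * (1 + Real.log t)) * B + 3 * c₂ * lam * (ℓ / t) +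
      lam / √t * (768 * ((1 + c₁ + c₃) / q ^ 2)) := by
  have := h.prob_right
  have := h.prob_left t
  have hlam := h.lam_nonneg
  have hq := h.q_pos
  have hq4 := h.q_le
  have hc₁ := h.c₁_nonneg
  have hc₃ := h.c₃_nonneg
  have ht : 1 ≤ t := hℓ.trans hℓt
  have ht1 : (1 : ℝ) ≤ t := by exact_mod_cast ht
  have ht0 : (0 : ℝ) < t := by linarith
  have hr1 : 1 ≤ √(t : ℝ) := Real.one_le_sqrt.2 ht1
  have hsq : (t : ℝ) = √(t : ℝ) ^ 2 := (Real.sq_sqrt ht0.le).symm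
  set L := 1 + Real.log t
  have hL1 : 1 ≤ L := by linarith [Real.log_nonneg ht1]
  set r := √(t : ℝ)
  set κ := indepSum fun i => ν (s i)
  have hB0 : 0 ≤ B := (abs_nonneg _).trans (hB 0)
  obtain ⟨hexp, hexp'⟩ := summable_and_tsum_exp_neg_abs_sub_le (m * t) (τ := 4 * r) (by linarith)
  have hκν : Summable fun j => |κ.real {j} - (ν t).real {j}| :=
    ((summable_measureReal_singleton κ).sub (summable_measureReal_singleton (ν t))).abs
  set C := lam * (16 * t + 6 * c₃) * ((t : ℝ) ^ 4)⁻¹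
  have hC0 : 0 ≤ C := by positivity
  -- Inside the window the comparison passes through κ; outside it the tail bound compares the two
  -- families directly. The distance from κ to ν t is kept in the remainder, where it is paid once
  -- by almost closure under convolution.
  have hW := tsum_abs_le_of_window (a := fun j => (μ t).real {j} - (ν t).real {j})
    (b := fun j => |κ.real {j} - (ν t).real {j}| + C * Real.exp (-|(j : ℝ) - m * t| / (4 * r)))
    (m := m * t) (w := 16 * r * L) (B := B) (by positivity) hB0 (h.summable_sub t)
    (hκν.add (hexp.mul_left C))
    (fun j _ => by
      have h1 := abs_sub_le ((μ t).real {j}) (κ.real {j}) ((ν t).real {j})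
      have h2 : 0 ≤ C * Real.exp (-|(j : ℝ) - m * t| / (4 * r)) := by positivity
      linarith [hB j])
    (fun j hj => by
      have h1 : lam * (16 * t + 6 * c₃) * Real.exp (-|(j : ℝ) - m * t| / (2 * r)) ≤
          C * Real.exp (-|(j : ℝ) - m * t| / (4 * r)) := by
        rw [mul_assoc (lam * _)]
        gcongr
        exact exp_neg_half_le_of_large ht hj.le
      have h2 := h.tail t ht j
      have h3 := abs_nonneg (κ.real {j} - (ν t).real {j})
      linarith)
  rw [hκν.tsum_add (hexp.mul_left C), tsum_mul_left, tsum_abs_sub, tsum_abs_sub] at hW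
  have hconv := h.conv_right t ht ℓ hℓ hℓt s hs hsum
  have T1 : (2 * (16 * r * L) + 1) * B ≤ 33 * (r * L) * B := by
    gcongr
    have : 1 ≤ r * L := one_le_mul_of_one_le_of_one_le hr1 hL1
    linarith
  set A := (1 + c₁ + c₃) / q ^ 2
  have hA : 1 + c₃ ≤ A := by
    rw [le_div_iff₀ (by positivity)]
    have : q ^ 2 ≤ 1 := by nlinarith
    nlinarith
  have hA0 : 0 ≤ A := by linarith
  have T3 : C * ∑' j : ℤ, Real.exp (-|(j : ℝ) - m * t| / (4 * r)) ≤ lam / r * (768 * A) := by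
    have h2 : 16 * (t : ℝ) + 6 * c₃ ≤ 16 * A * t := by
      nlinarith [mul_nonneg hc₃ ht0.le]
    calc _ ≤ lam * (16 * A * t) * ((t : ℝ) ^ 4)⁻¹ * (12 * (4 * r)) := by
          simp only [C]
          gcongr
      _ = lam / r * (768 * A * (r ^ 4)⁻¹) := by
          rw [hsq]
          field_simp
          ring
      _ ≤ lam / r * (768 * A * 1) := by
          gcongr
          exact inv_le_one_of_one_le₀ (one_le_pow₀ hr1)
      _ = _ := by ring
  linarith

/-- The total variation bound at time `t` in terms of the bounds at times of order `√t`. -/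
lemma tvDist_le_of_sqrt (h : ComparableFamilies m q lam c₁ c₂ c₃ μ ν) {t : ℕ}
    (ht : 36 ≤ t) {R : ℝ} (hR : 1 ≤ R)
    (hD : ∀ s : ℕ, 1 ≤ s → (s : ℝ) ≤ 3 * √t → tvDist (μ s) (ν s) ≤ lam / √s * R) :
    tvDist (μ t) (ν t) ≤
      lam / √t * (2 ^ 43 * ((1 + c₁ + c₃) / q ^ 2 + c₂) * (1 + Real.log t) ^ 4 * R) := by
  have hlam := h.lam_nonneg
  have hq := h.q_pos
  have hc₁ := h.c₁_nonneg
  have hc₂ := h.c₂_nonneg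
  have hc₃ := h.c₃_nonneg
  have ht1 : (1 : ℝ) ≤ t := by exact_mod_cast (by omega : 1 ≤ t)
  have ht0 : (0 : ℝ) < t := by linarith
  obtain ⟨ℓ, hℓ, hℓt', hℓt, s, hs, hs3, hsum⟩ := exists_balanced_partition (by omega : 1 ≤ t)
  have H := h.tvDist_le_of_pointwise hℓ hℓt' hs hsum
    (h.abs_sub_indepSum_le ht hℓ hℓt hs hs3 hsum le_rfl hR fun i => hD _ (hs i) (hs3 i))
  have hr1 : 1 ≤ √(t : ℝ) := Real.one_le_sqrt.2 ht1
  have hsq : (t : ℝ) = √(t : ℝ) ^ 2 := (Real.sq_sqrt ht0.le).symm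
  set A := (1 + c₁ + c₃) / q ^ 2
  have hA0 : 0 ≤ A := by positivity
  set L := 1 + Real.log t
  have hL1 : 1 ≤ L := by linarith [Real.log_nonneg ht1]
  set r := √(t : ℝ)
  have hLR : 1 ≤ L ^ 4 * R := one_le_mul_of_one_le_of_one_le (one_le_pow₀ hL1) hR
  -- Three powers of L come from the third moment, the fourth from the window width.
  have T1 : 33 * (r * L) * (lam / t * (2 ^ 37 * A * L ^ 3 * R)) =
      lam / r * (33 * 2 ^ 37 * (A * (L ^ 4 * R))) := by
    rw [hsq]
    field_simp
  have T2 : 3 * c₂ * lam * (ℓ / t) ≤ lam / r * (3 * c₂) := by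
    calc _ ≤ 3 * c₂ * lam * (r / t) := by gcongr
      _ = _ := by
          rw [hsq]
          field_simp
  have hfin : 33 * 2 ^ 37 * (A * (L ^ 4 * R)) + 3 * c₂ + 768 * A ≤
      2 * (2 ^ 43 * (A + c₂) * L ^ 4 * R) := by
    have h1 : A * 1 ≤ A * (L ^ 4 * R) := by gcongr
    have h2 : c₂ * 1 ≤ c₂ * (L ^ 4 * R) := by gcongr
    have e : 2 * (2 ^ 43 * (A + c₂) * L ^ 4 * R) =
      2 ^ 44 * (A * (L ^ 4 * R)) + 2 ^ 44 * (c₂ * (L ^ 4 * R)) := by ring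
    rw [e]
    linarith
  have hlr : 0 ≤ lam / r := by positivity
  have := mul_le_mul_of_nonneg_left hfin hlr
  linarith

/-- A crude total variation bound, from the comparison with independent labels. -/
lemma tvDist_le_crude (h : ComparableFamilies m q lam c₁ c₂ c₃ μ ν) {t : ℕ} (ht : 1 ≤ t) :
    tvDist (μ t) (ν t) ≤ lam / √t *
      ((1024 * ((1 + c₁ + c₃) / q ^ 2) + 3 * c₂) * (t : ℝ) ^ 2 * (1 + Real.log t)) := by
  have := h.prob_right
  have := h.prob_left t
  have hlam := h.lam_nonneg
  have hq := h.q_pos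
  have hq4 := h.q_le
  have hc₁ := h.c₁_nonneg
  have hc₂ := h.c₂_nonneg
  have hc₃ := h.c₃_nonneg
  have ht1 : (1 : ℝ) ≤ t := by exact_mod_cast ht
  have ht0 : (0 : ℝ) < t := by linarith
  have hpi := Real.pi_pos
  have hpi2 := Real.pi_lt_d2
  have hsum : ∑ _i : Fin t, 1 = t := by simp
  have hone : (fun j => (μ 1).real {j}) = fun j => (ν 1).real {j} := funext h.one
  -- With single labels as pieces the two families coincide on each piece, so only the
  -- multiplicativity error remains: 4λtqθ² with q ≤ 1/4 and θ² ≤ 10.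
  have hB : ∀ j : ℤ, |(μ t).real {j} - (indepSum fun _ : Fin t => ν 1).real {j}| ≤
      10 * lam * t := by
    intro j
    have H := abs_coeff_le_of_norm_trigSum_le
      (a := fun j => (μ t).real {j} - (indepSum fun _ : Fin t => ν 1).real {j})
      (g := fun _ => 10 * lam * t)
      ((summable_measureReal_singleton _).sub (summable_measureReal_singleton _)) (by simp)
      (fun θ h1 h2 => by
        have hθ : |θ| ≤ Real.pi := abs_le.2 ⟨h1, h2⟩
        rw [trigSum_sub (summable_measureReal_singleton _) (summable_measureReal_singleton _),
          trigSum_indepSum, ← hone]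
        refine (h.mult_left t t ht (fun _ => 1) (fun _ => le_rfl) hsum θ hθ).trans ?_
        have hθ2 : θ ^ 2 ≤ 10 := by
          rw [← sq_abs]
          nlinarith [abs_nonneg θ]
        have he : Real.exp (-(q * t * θ ^ 2 / 20)) ≤ 1 := by
          rw [Real.exp_le_one_iff, neg_nonpos]
          positivity
        calc 4 * lam * t * q * θ ^ 2 * Real.exp (-(q * t * θ ^ 2 / 20)) ≤
              4 * lam * t * (1 / 4) * 10 * 1 := by gcongr
          _ = _ := by ring) j
    refine H.trans (le_of_eq ?_)
    rw [intervalIntegral.integral_const, smul_eq_mul]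
    field_simp
    ring
  have H := h.tvDist_le_of_pointwise ht le_rfl (fun _ => le_rfl) hsum hB
  have hr1 : 1 ≤ √(t : ℝ) := Real.one_le_sqrt.2 ht1
  have hsq : (t : ℝ) = √(t : ℝ) ^ 2 := (Real.sq_sqrt ht0.le).symm
  set A := (1 + c₁ + c₃) / q ^ 2
  have hA1 : 1 ≤ A := by
    rw [le_div_iff₀ (by positivity)]
    nlinarith
  set L := 1 + Real.log t
  have hL1 : 1 ≤ L := by linarith [Real.log_nonneg ht1]
  set r := √(t : ℝ)
  set M := (t : ℝ) ^ 2 * L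
  have hM : 1 ≤ M := one_le_mul_of_one_le_of_one_le (one_le_pow₀ ht1) hL1
  have hrM : r ≤ M := by
    calc r ≤ r ^ 4 := le_self_pow₀ hr1 (by norm_num)
      _ = (t : ℝ) ^ 2 * 1 := by rw [hsq]; ring
      _ ≤ M := mul_le_mul_of_nonneg_left hL1 (by positivity)
  have hlr : 0 ≤ lam / r := by positivity
  have T1 : 33 * (r * L) * (10 * lam * t) = lam / r * (330 * M) := by
    simp only [M]
    rw [hsq]
    field_simp
    ring
  have T2 : 3 * c₂ * lam * ((t : ℝ) / t) = lam / r * (3 * c₂ * r) := by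
    rw [div_self ht0.ne']
    field_simp
  rw [T1, T2] at H
  have hfin : 330 * M + 3 * c₂ * r + 768 * A ≤ 2 * ((1024 * A + 3 * c₂) * M) := by
    have h1 : 1 * M ≤ A * M := by gcongr
    have h2 : A * 1 ≤ A * M := by gcongr
    have h3 : c₂ * r ≤ c₂ * M := by gcongr
    have h4 : 0 ≤ c₂ * M := by positivity
    linarith
  have := mul_le_mul_of_nonneg_left hfin hlr
  rw [mul_assoc (1024 * A + 3 * c₂)]
  linarith

end ComparableFamilies

/-! ### Solving the recursion -/

section QuasipolynomialGrowth

open Real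

lemma log_log_two_ge : -(1 / 2) ≤ log (log 2) := by
  have h := log_two_gt_d9
  have h1 := one_sub_inv_le_log_of_pos (x := log 2) (by linarith)
  have h2 : (log 2)⁻¹ ≤ 3 / 2 := by
    rw [inv_le_comm₀ (by linarith) (by norm_num)]
    norm_num
    linarith
  linarith

/-- The double logarithm is negative for t < e. The constant term 140 outweighs it, since 140 log
log 2 ≥ -70. -/
lemma exponent_ge {t : ℝ} (ht : 2 ≤ t) {η : ℝ} (hη : 140 ≤ η) :
    70 ≤ 140 * log (log t) + η := by
  have h1 : log 2 ≤ log t := log_le_log (by norm_num) ht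
  have h2 : log (log 2) ≤ log (log t) := log_le_log (log_pos (by norm_num)) h1
  linarith [log_log_two_ge]

/-- The case s = 1 is separate: there the double logarithm takes the default value `log 0 = 0`,
which may exceed log log u, but the base is 1. -/
lemma rpow_growth_mono {s u η : ℝ} (hs : 1 ≤ s) (hu : 2 ≤ u) (hsu : s = 1 ∨ 2 ≤ s ∧ s ≤ u)
    (hη : 140 ≤ η) :
    (1 + log s) ^ (140 * log (log s) + η) ≤ (1 + log u) ^ (140 * log (log u) + η) := by
  have hu0 : 0 ≤ log u := log_nonneg (by linarith)
  have he := exponent_ge hu hη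
  rcases hsu with rfl | ⟨h2, hle⟩
  · rw [log_one, add_zero, one_rpow]
    exact one_le_rpow (by linarith) (by linarith)
  · have h1 : log s ≤ log u := log_le_log (by linarith) hle
    have h3 : 0 < log s := log_pos (by linarith)
    have h4 : log (log s) ≤ log (log u) := log_le_log h3 h1
    calc (1 + log s) ^ (140 * log (log s) + η) ≤ (1 + log s) ^ (140 * log (log u) + η) :=
          rpow_le_rpow_of_exponent_le (by linarith) (by linarith)
      _ ≤ _ := rpow_le_rpow (by linarith) (by linarith) (by linarith)

/-- In logarithms, with l = log(1 + log t): l ≥ 1/3 lets 3l · log K pay for log K, and l ≥ (log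
t)/21 lets the exponent, at least 70, pay for 2 log t + l ≤ 43l. -/
lemma small_time_growth {t K : ℝ} (ht : 2 ≤ t) (hlog : log t ≤ 20) (hK : 1 ≤ K) :
    K * t ^ 2 * (1 + log t) ≤ (1 + log t) ^ (140 * log (log t) + (140 + 3 * log K)) := by
  have hk : 0 ≤ log K := log_nonneg hK
  have he := exponent_ge ht (η := 140) le_rfl
  have hx : log 2 ≤ log t := log_le_log (by norm_num) ht
  have h2 := log_two_gt_d9
  have hLpos : 0 < 1 + log t := by linarith
  have hK0 : 0 < K := by linarith
  have ht0 : 0 < t := by linarith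
  rw [rpow_def_of_pos hLpos, ← log_le_iff_le_exp (by positivity), log_mul (by positivity)
    (by positivity), log_mul (by positivity) (by positivity), log_pow]
  push_cast
  have h1 := one_sub_inv_le_log_of_pos hLpos
  have h3 : 1 - (1 + log t)⁻¹ = log t / (1 + log t) := by field_simp; ring
  have h4 : log t / 21 ≤ log t / (1 + log t) := by
    apply div_le_div_of_nonneg_left _ _ _ <;> linarith
  have h5 : 1 / 3 ≤ log (1 + log t) := by
    refine le_trans ?_ h1
    have : (1 + log t)⁻¹ ≤ 2 / 3 := by
      rw [inv_le_comm₀ hLpos (by norm_num)]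
      norm_num
      linarith
    linarith
  set l := log (1 + log t)
  nlinarith [mul_nonneg (by linarith : 0 ≤ l - 1 / 3) hk,
    mul_nonneg (by linarith : 0 ≤ l) (by linarith : 0 ≤ 140 * log (log t) + 140 - 70)]

lemma log_three_mul_sqrt_le {t : ℝ} (ht : 0 < t) : log (3 * √t) ≤ 11 / 10 + log t / 2 := by
  rw [log_mul (by norm_num) (sqrt_pos.2 ht).ne', log_sqrt ht.le]
  have : log 3 ≤ 11 / 10 := by
    rw [log_le_iff_le_exp (by norm_num)]
    have h1 : exp (11 / 10) ^ 10 = exp 1 ^ 11 := by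
      rw [← exp_nat_mul, ← exp_nat_mul]
      norm_num
    have h2 : (2.718 : ℝ) ^ 11 ≤ exp 1 ^ 11 := by
      gcongr
      linarith [exp_one_gt_d9]
    by_contra hlt
    have h3 : exp (11 / 10) ^ 10 < 3 ^ 10 := by
      gcongr
      exact not_le.1 hlt
    rw [h1] at h3
    norm_num at h2 h3
    linarith
  linarith

lemma add_half_le_log_of_mul_le {a b : ℝ} (ha : 0 < a) (hab : 33 / 20 * a ≤ b) :
    log a + 1 / 2 ≤ log b := by
  have h1 : exp (1 / 2) ≤ 33 / 20 := by
    have h2 : exp (1 / 2) ^ 2 = exp 1 := by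
      rw [← exp_nat_mul]
      norm_num
    nlinarith [exp_one_lt_d9, exp_pos (1 / 2)]
  have h3 : 1 / 2 ≤ log (33 / 20) := (le_log_iff_exp_le (by norm_num)).2 h1
  have h4 := log_le_log (by positivity) hab
  rw [log_mul (by norm_num) ha.ne'] at h4
  linarith

/-- Put x = log t and y = log(3√t). For x ≥ 20 both log(1 + y) and log y fall short of log(1 + x)
and log x by at least 1/2. In the logarithm of the right side this gains at least 70 log(1 + x) + 70
+ (3/2) log K, which covers the prefactor 43 log 2 + log K + 4 log(1 + x). The multiple 3 of log K
in the exponent leaves room here. -/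
lemma large_time_growth {t K : ℝ} (ht : 0 < t) (hlog : 20 ≤ log t) (hK : 1 ≤ K) :
    2 ^ 43 * K * (1 + log t) ^ 4 *
      (1 + log (3 * √t)) ^ (140 * log (log (3 * √t)) + (140 + 3 * log K)) ≤
      (1 + log t) ^ (140 * log (log t) + (140 + 3 * log K)) := by
  have hk : 0 ≤ log K := log_nonneg hK
  have hK0 : 0 < K := by linarith
  have hy := log_three_mul_sqrt_le ht
  have hy1 : 10 ≤ log (3 * √t) := by
    rw [log_mul (by norm_num) (sqrt_pos.2 ht).ne', log_sqrt ht.le]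
    linarith [log_pos (by norm_num : (1 : ℝ) < 3)]
  set x := log t
  set y := log (3 * √t)
  have h1 := add_half_le_log_of_mul_le (a := 1 + y) (b := 1 + x) (by linarith) (by linarith)
  have h2 := add_half_le_log_of_mul_le (a := y) (b := x) (by linarith) (by linarith)
  have hly : 0 ≤ log y := log_nonneg (by linarith)
  have hLy : 0 ≤ log (1 + y) := log_nonneg (by linarith)
  have hx0 : 0 < 1 + x := by linarith
  have hy0 : 0 < 1 + y := by linarith
  rw [rpow_def_of_pos hx0, rpow_def_of_pos hy0, ← log_le_iff_le_exp (by positivity),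
    log_mul (by positivity) (by positivity), log_mul (by positivity) (by positivity),
    log_mul (by positivity) (by positivity), log_pow, log_pow, log_exp]
  push_cast
  have hl2 := log_two_lt_d9
  set X := log (1 + x)
  set Y := log (1 + y)
  set k := log K
  have e1 : Y * (140 * log y + (140 + 3 * k)) ≤ (X - 1 / 2) * (140 * log y + (140 + 3 * k)) := by
    gcongr
    linarith
  have e2 : X * (140 * log y) ≤ X * (140 * (log x - 1 / 2)) := by
    gcongr
    · linarith
    · linarith
  nlinarith

end QuasipolynomialGrowth

/-! ### Strong induction on time -/

namespace ComparableFamilies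

variable {m q lam c₁ c₂ c₃ : ℝ} {μ ν : ℕ → Measure ℤ}

/-- The quasipolylogarithmic total variation bound. -/
theorem tvDist_le (h : ComparableFamilies m q lam c₁ c₂ c₃ μ ν) {K : ℝ}
    (hK : 1024 * ((1 + c₁ + c₃) / q ^ 2) + 3 * c₂ ≤ K) {t : ℕ} (ht : 1 ≤ t) :
    tvDist (μ t) (ν t) ≤ lam / √t *
      (1 + Real.log t) ^ (140 * Real.log (Real.log t) + (140 + 3 * Real.log K)) := by
  have hlam := h.lam_nonneg
  have hq := h.q_pos
  have hq4 := h.q_le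
  have hc₁ := h.c₁_nonneg
  have hc₂ := h.c₂_nonneg
  have hc₃ := h.c₃_nonneg
  have hA : 1 ≤ (1 + c₁ + c₃) / q ^ 2 := by
    rw [le_div_iff₀ (by positivity)]
    nlinarith
  have hK1 : 1 ≤ K := by linarith
  have hη : 140 ≤ 140 + 3 * Real.log K := by linarith [Real.log_nonneg hK1]
  induction t using Nat.strong_induction_on with
  | _ t ih =>
    rcases ht.eq_or_lt with rfl | ht2
    · have : tvDist (μ 1) (ν 1) = 0 := by simp [tvDist, h.one]
      rw [this]
      simp [hlam]
    have ht2' : (2 : ℝ) ≤ t := by exact_mod_cast ht2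
    rcases le_total (Real.log t) 20 with hlog | hlog
    · refine (h.tvDist_le_crude ht).trans ?_
      refine mul_le_mul_of_nonneg_left ?_ (by positivity)
      refine le_trans ?_ (small_time_growth ht2' hlog hK1)
      have : 0 ≤ Real.log t := Real.log_nonneg (by linarith)
      gcongr
    · have ht0 : (0 : ℝ) < t := by linarith
      -- A modest consequence of log t ≥ 20. It gives t ≥ 36 for the bootstrap and √t > 3, so that
      -- 3√t < t and the induction descends.
      have ht200 : (200 : ℝ) ≤ t := by
        rw [← Real.exp_log ht0]
        have h1 := Real.quadratic_le_exp_of_nonneg (x := Real.log t) (by linarith)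
        nlinarith
      have hr : 3 < √(t : ℝ) := Real.lt_sqrt_of_sq_lt (by linarith)
      have hsq : √(t : ℝ) ^ 2 = t := Real.sq_sqrt ht0.le
      set R := (1 + Real.log (3 * √t)) ^
        (140 * Real.log (Real.log (3 * √t)) + (140 + 3 * Real.log K)) with hR
      have hR1 : 1 ≤ R := by
        have := rpow_growth_mono (s := 1) (u := 3 * √(t : ℝ)) le_rfl (by linarith) (Or.inl rfl) hη
        simpa using this
      have hstep := h.tvDist_le_of_sqrt (t := t)
        (by exact_mod_cast (by linarith : (36 : ℝ) ≤ t)) hR1 (fun s hs hs3 => by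
          have hst : s < t := by
            have : (s : ℝ) < t := by nlinarith
            exact_mod_cast this
          refine (ih s hst hs).trans ?_
          refine mul_le_mul_of_nonneg_left ?_ (by positivity)
          refine rpow_growth_mono (by exact_mod_cast hs) (by linarith) ?_ hη
          rcases hs.eq_or_lt with rfl | hs2
          · left; simp
          · right
            exact ⟨by exact_mod_cast hs2, hs3⟩)
      refine hstep.trans ?_
      refine mul_le_mul_of_nonneg_left ?_ (by positivity)
      refine le_trans ?_ (large_time_growth ht0 hlog hK1)
      gcongr
      linarith

end ComparableFamilies

/-! ### Walk label sums and discrete normal families are comparable -/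

namespace RegularDigraph

variable {V : Type*} [Fintype V] [Nonempty V] [DecidableEq V]
variable {p : unitInterval} {lam : ℝ} {G : RegularDigraph V} {val : V → Fin 2}

lemma labelSum_one_eq_bernoulli (hval : ∀ b : Fin 2,
      (Fintype.card {v : V // val v = b} : ℝ) / Fintype.card V = labelWeight p b) (j : ℤ) :
    (G.labelSum val 1).real {j} = (bernoulliMeasure (1 : ℤ) 0 p).real {j} := by
  have hb : (binomial 1 p).map (Nat.cast : ℕ → ℤ) = bernoulliMeasure (1 : ℤ) 0 p := by
    rw [binomial_one_eq_bernoulliMeasure, bernoulliMeasure_def, bernoulliMeasure_def,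
      Measure.map_add _ _ (by fun_prop), Measure.map_smul, Measure.map_smul,
      Measure.map_dirac' .of_discrete, Measure.map_dirac' .of_discrete]
    simp
  -- Without tilt and with equal transforms, inversion gives equality of the point masses.
  have h := abs_labelSum_sub_binomial_le_of_transform G val p 0 0 1 (fun θ => by
    have hone : G.walkTransform val p ((0 : ℝ) + θ * Complex.I) 1 =
        bernoulliTransform p ((0 : ℝ) + θ * Complex.I) := by
      have h0 := G.integral_cexp_labelSum val ((0 : ℝ) + θ * Complex.I) (p : ℝ) 0
      rw [alternatingProduct, inner_diagOp_constUnit, card_inv_mul_sum_tilt hval] at h0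
      simpa [walkTransform] using h0
    rw [hone, pow_one, sub_self, norm_zero]) j
  rw [zero_mul] at h
  rw [← hb]
  exact sub_eq_zero.1 (abs_nonpos_iff.1 h)

end RegularDigraph

namespace IsDiscreteNormalFamily

variable {p : unitInterval} {σsq c₁ c₂ c₃ : ℝ} {N : ℕ → ProbabilityMeasure ℤ}

lemma abs_sub_binomial_le (h : IsDiscreteNormalFamily p σsq c₁ c₂ c₃ N) {t : ℕ} (ht : 1 ≤ t)
    (j : ℤ) : |(N t : Measure ℤ).real {j} -
        ((binomial t p).map (Nat.cast : ℕ → ℤ)).real {j}| ≤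
      c₃ * |σsq / (labelWeight p 0 * labelWeight p 1) - 1| *
        Real.exp (-|(j : ℝ) - labelWeight p 1 * t| ^ 2 / (8 * t)) := by
  refine le_trans ?_ (h.tail t ht |(j : ℝ) - labelWeight p 1 * t| (abs_nonneg _))
  have hs : Summable fun j : ℤ => |(N t : Measure ℤ).real {j} -
      ((binomial t p).map (Nat.cast : ℕ → ℤ)).real {j}| :=
    ((summable_measureReal_singleton _).sub (summable_measureReal_singleton _)).abs
  exact (hs.subtype _).le_tsum (⟨j, le_rfl⟩ : {k : ℤ // |(j : ℝ) - labelWeight p 1 * t| ≤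
    |(k : ℝ) - labelWeight p 1 * t|}) fun _ _ => abs_nonneg _

lemma norm_trigSum_le (h : IsDiscreteNormalFamily p σsq c₁ c₂ c₃ N) {t : ℕ} (ht : 1 ≤ t) {θ : ℝ}
    (hθ : |θ| ≤ Real.pi) : ‖trigSum (fun j => (N t : Measure ℤ).real {j}) θ‖ ≤
      Real.exp (-(labelWeight p 0 * labelWeight p 1 * t * θ ^ 2 / 20)) := by
  obtain ⟨h1, h2⟩ := abs_le.1 hθ
  have := h.fourier t ht (-θ) (by linarith) (by linarith)
  rw [neg_sq] at this
  rw [trigSum_measureReal]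
  refine le_trans (le_of_eq ?_) this
  congr 2
  funext j
  congr 1
  push_cast
  ring

end IsDiscreteNormalFamily

/-- Completing the square: the exponents differ by (x/√t - 2)²/8 up to the constant 1/2, and e^(1/2)
≤ 2. This puts the Gaussian tails of the family into the exponential form of the tails of the walk.
-/
lemma exp_neg_sq_div_le {t : ℕ} (ht : 1 ≤ t) (x : ℝ) :
    Real.exp (-x ^ 2 / (8 * t)) ≤ 2 * Real.exp (-x / (2 * √t)) := by
  have ht0 : (0 : ℝ) < t := by exact_mod_cast ht
  have hs : 0 < √(t : ℝ) := Real.sqrt_pos.2 ht0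
  have hsq : (t : ℝ) = √(t : ℝ) ^ 2 := (Real.sq_sqrt ht0.le).symm
  have h2 : Real.exp (1 / 2) ≤ 2 := by
    have h3 : Real.exp (1 / 2) ^ 2 = Real.exp 1 := by
      rw [← Real.exp_nat_mul]
      norm_num
    nlinarith [Real.exp_one_lt_d9, Real.exp_pos (1 / 2)]
  have h4 : -x ^ 2 / (8 * t) ≤ 1 / 2 + -x / (2 * √t) := by
    have e : 1 / 2 + -x / (2 * √t) - -x ^ 2 / (8 * t) = (x / √t - 2) ^ 2 / 8 := by
      conv_lhs => enter [2]; rw [hsq]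
      field_simp
      ring
    have : 0 ≤ (x / √t - 2) ^ 2 / 8 := by positivity
    linarith
  calc _ ≤ Real.exp (1 / 2 + -x / (2 * √t)) := Real.exp_le_exp.2 h4
    _ = Real.exp (1 / 2) * Real.exp (-x / (2 * √t)) := Real.exp_add _ _
    _ ≤ _ := by gcongr

namespace RegularDigraph

variable {V : Type*} [Fintype V] [Nonempty V] [DecidableEq V]
variable {p : unitInterval} {lam : ℝ} {G : RegularDigraph V} {val : V → Fin 2}

/-- Label sums along an expander walk are comparable to every discrete normal family with the
same asymptotic variance. -/
lemma comparableFamilies (hlam : lam ≤ 1 / 100) (hG : G.IsSpectralExpander lam)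
    (hval : ∀ b : Fin 2,
      (Fintype.card {v : V // val v = b} : ℝ) / Fintype.card V = labelWeight p b)
    {c₁ c₂ c₃ : ℝ} (hc₁ : 0 ≤ c₁) (hc₂ : 0 ≤ c₂) (hc₃ : 0 ≤ c₃) {N : ℕ → ProbabilityMeasure ℤ}
    (hN : IsDiscreteNormalFamily p (asymptoticVariance (G.labelSum val)) c₁ c₂ c₃ N) :
    ComparableFamilies p ((p : ℝ) * (1 - p)) lam c₁ c₂ c₃ (G.labelSum val)
      fun t => (N t : Measure ℤ) := by
  have hlam0 : 0 ≤ lam := G.spectralExpansion_nonneg.trans hG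
  have hvar := (tendsto_intVariance_div_and_bound hlam hG hval).2
  set σsq := asymptoticVariance (G.labelSum val)
  have hw0 : labelWeight p 0 = 1 - (p : ℝ) := by simp [labelWeight]
  have hw1 : labelWeight p 1 = (p : ℝ) := by simp [labelWeight]
  have hw : labelWeight p 0 * labelWeight p 1 = (p : ℝ) * (1 - p) := by rw [hw0, hw1, mul_comm]
  set q := (p : ℝ) * (1 - p) with hqdef
  have hσq : |σsq - q| ≤ 3 * (q * lam) := by
    have := hvar 1 le_rfl
    rw [intVariance_labelSum_one hval, Nat.cast_one, mul_one, abs_sub_comm] at this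
    exact this
  have hq0 : 0 ≤ q := mul_nonneg p.2.1 (by linarith [p.2.2])
  -- Were q zero, the variance bound at t = 1 would force σ² = 0.
  have hq : 0 < q := by
    refine lt_of_le_of_ne hq0 fun h => ?_
    rw [← h, zero_mul, mul_zero, sub_zero] at hσq
    exact hN.sigma_pos.ne' (abs_nonpos_iff.1 hσq)
  -- This is how λ enters the closure and tail estimates of the normal family, which are stated
  -- relative to |σ²/q - 1|.
  have hδ : |σsq / q - 1| ≤ 3 * lam := by
    have e : σsq / q - 1 = (σsq - q) / q := by field_simp
    rw [e, abs_div, abs_of_pos hq, div_le_iff₀ hq]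
    linarith
  refine
    { prob_left := inferInstance
      prob_right := fun t => inferInstance
      lam_nonneg := hlam0
      q_pos := hq
      q_le := by nlinarith [sq_nonneg ((p : ℝ) - 1 / 2)]
      c₁_nonneg := hc₁
      c₂_nonneg := hc₂
      c₃_nonneg := hc₃
      one := fun j => by rw [hN.bern, labelSum_one_eq_bernoulli hval]
      fourier_left := fun t ht θ hθ => norm_trigSum_labelSum_le hlam hG hval hθ ht
      fourier_right := fun t ht θ hθ => by
        have := hN.norm_trigSum_le ht hθ
        rwa [hw] at this
      mult_left := fun t ℓ hℓ s hs hst θ hθ =>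
        norm_trigSum_labelSum_sub_prod_le hlam hG hval hθ hℓ s hs hst
      conv_right := fun t ht ℓ hℓ hℓt s hs hst => ?_
      tail := fun t ht j => ?_
      memLp_left := fun t _ => ?_
      memLp_right := hN.memLp
      mean_left := fun t ht => integral_labelSum_id hval ht
      mean_right := fun t ht => by rw [hN.mean t ht, hw1]
      variance := fun t ht => ?_ }
  · have ht0 : (0 : ℝ) < t := by exact_mod_cast ht
    have hℓ1 : (0 : ℝ) ≤ ℓ - 1 := by
      have : (1 : ℝ) ≤ ℓ := by exact_mod_cast hℓ
      linarith
    refine (hN.sum t ht ℓ hℓ hℓt s hs hst).trans ?_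
    rw [hw]
    calc _ ≤ c₂ / 2 * (((ℓ : ℝ) - 1) * (3 * lam) / t) := by gcongr
      _ ≤ c₂ / 2 * ((ℓ : ℝ) * (3 * lam) / t) := by
        gcongr
        linarith
      _ = _ := by ring
  · have h1 := abs_labelSum_sub_binomial_le hlam hG hval ht j
    have h2 := hN.abs_sub_binomial_le ht j
    rw [hw, hw1] at h2
    have h3 := exp_neg_sq_div_le ht |(j : ℝ) - p * t|
    set X := Real.exp (-|(j : ℝ) - p * t| / (2 * √t))
    have h4 : c₃ * |σsq / q - 1| * Real.exp (-|(j : ℝ) - p * t| ^ 2 / (8 * t)) ≤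
        c₃ * (3 * lam) * (2 * X) := by gcongr
    have h5 := abs_sub_le ((G.labelSum val t).real {j})
      (((binomial t p).map (Nat.cast : ℕ → ℤ)).real {j}) ((N t : Measure ℤ).real {j})
    rw [abs_sub_comm (((binomial t p).map (Nat.cast : ℕ → ℤ)).real {j})] at h5
    calc _ ≤ 16 * lam * t * X + c₃ * (3 * lam) * (2 * X) := by linarith
      _ = _ := by ring
  · exact (memLp_two_iff_integrable_sq
      (StronglyMeasurable.of_discrete).aestronglyMeasurable).2 (integrable_labelSum G val t _)
  · have h1 := hvar t ht
    have h2 := hN.var t ht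
    rw [hw] at h2
    have h3 : c₁ * |σsq - q| ≤ c₁ * (3 * (q * lam)) := by gcongr
    have h4 := abs_sub_le (intVariance (G.labelSum val t)) (σsq * t) (intVariance (N t))
    rw [abs_sub_comm (σsq * t)] at h4
    linarith

end RegularDigraph

/-- The argument needs only the power q⁻² and the coefficient 1024; as q ≤ 1, the constant in the
statement is larger. -/
lemma le_growth_constant {q c₁ c₂ c₃ : ℝ} (hq : 0 < q) (hq1 : q ≤ 1) (hc₁ : 0 ≤ c₁)
    (hc₃ : 0 ≤ c₃) :
    1024 * ((1 + c₁ + c₃) / q ^ 2) + 3 * c₂ ≤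
      (2 ^ 28 + 2 ^ 10 * c₁ + 2 ^ 18 * c₃) / q ^ (7 / 2 : ℝ) + 3 * c₂ := by
  have hpow : q ^ (7 / 2 : ℝ) ≤ q ^ 2 := by
    rw [← Real.rpow_two]
    exact Real.rpow_le_rpow_of_exponent_ge hq hq1 (by norm_num)
  have : 0 < q ^ (7 / 2 : ℝ) := Real.rpow_pos_of_pos hq _
  rw [← mul_div_assoc]
  gcongr
  linarith

theorem theorem3p1 {V : Type*} [Fintype V] [DecidableEq V] [Nonempty V]
    (p : unitInterval) (lam : ℝ) (hlam : lam ≤ 1 / 100)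
    (G : RegularDigraph V) (hG : G.IsSpectralExpander lam) (val : V → Fin 2)
    (hval : ∀ b : Fin 2,
      (Fintype.card {v : V // val v = b} : ℝ) / Fintype.card V = labelWeight p b) :
    Tendsto (fun t : ℕ => intVariance (G.labelSum val t) / t) atTop
      (𝓝 (asymptoticVariance (G.labelSum val))) ∧
    ∀ c₁ c₂ c₃ : ℝ, 0 ≤ c₁ → 0 ≤ c₂ → 0 ≤ c₃ →
    ∀ N : ℕ → ProbabilityMeasure ℤ,
      IsDiscreteNormalFamily p (asymptoticVariance (G.labelSum val)) c₁ c₂ c₃ N →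
    ∀ t : ℕ, 1 ≤ t →
      tvDist (G.labelSum val t) (N t) ≤
        lam / √t * (1 + Real.log t) ^ (etaOne * Real.log (Real.log t) + etaTwo p c₁ c₂ c₃) := by
  refine ⟨(RegularDigraph.tendsto_intVariance_div_and_bound hlam hG hval).1, ?_⟩
  intro c₁ c₂ c₃ hc₁ hc₂ hc₃ N hN t ht
  have h := RegularDigraph.comparableFamilies hlam hG hval hc₁ hc₂ hc₃ hN
  have hw : labelWeight p 0 * labelWeight p 1 = (p : ℝ) * (1 - p) := by
    simp [labelWeight, mul_comm]
  rw [etaOne, etaTwo, hw]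
  exact h.tvDist_le (le_growth_constant h.q_pos (by linarith [h.q_le]) hc₁ hc₃) ht
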